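/- Let $G=(V,E)$ be a finite simple undirected graph. A pair $(A,B)$ of disjoint subsets of $V$ is a pair of perfectly matched sets of $G$ if every vertex of $A$ has exactly one neighbour in $B$ and every vertex of $B$ has exactly one neighbour in $A$; its size is $|A|=|B|$ (the pair $(\emptyset,\emptyset)$, of size $0$, is allowed). Theorem. There is an algorithm that accepts a graph $G$ on $n$ vertices and finds a largest pair of perfectly matched sets of $G$ in time $O^*(1.966^n)$, that is, in time at most $p(n)\cdot 1.966^n$ for some fixed polynomial $p$. Here an algorithm is a deterministic program for a random access machine, given the number $n$ and the adjacency matrix of $G$; every test and every elementary operation (assignment, increment, decrement, and reading or writing an array cell) takes one unit of time. -/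

import Mathlib

/-! ### Perfectly matched sets -/

/-- `(A, B)` is a pair of perfectly matched sets of `G`: the sets are disjoint, every vertex of `A`
has exactly one neighbour in `B`, and every vertex of `B` has exactly one neighbour in `A`. -/
def IsPerfectlyMatched {V : Type*} (G : SimpleGraph V) (A B : Finset V) : Prop :=
  Disjoint A B ∧ (∀ a ∈ A, ∃! b, b ∈ B ∧ G.Adj a b) ∧ (∀ b ∈ B, ∃! a, a ∈ A ∧ G.Adj b a)

/-- The two sets of such a pair have the same cardinality, the size of the pair. -/
theorem IsPerfectlyMatched.card_eq {V : Type*} {G : SimpleGraph V} {A B : Finset V}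
    (h : IsPerfectlyMatched G A B) : A.card = B.card := by
  obtain ⟨-, hA, hB⟩ := h
  choose f hf hf' using hA
  refine Finset.card_bij f (fun a ha => (hf a ha).1) ?_ ?_
  · intro a ha a' ha' e
    refine (hB _ (hf a ha).1).unique ⟨ha, (hf a ha).2.symm⟩ ⟨ha', ?_⟩
    rw [e]
    exact (hf a' ha').2.symm
  · intro b hb
    obtain ⟨a, ⟨ha, hab⟩, -⟩ := hB b hb
    exact ⟨a, ha, (hf' a ha b ⟨hb, hab.symm⟩).symm⟩

/-- `(A, B)` is a pair of perfectly matched sets of `G` of largest size. -/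
def IsLargestPerfectlyMatched {V : Type*} (G : SimpleGraph V) (A B : Finset V) : Prop :=
  IsPerfectlyMatched G A B ∧
    ∀ A' B' : Finset V, IsPerfectlyMatched G A' B' → A'.card ≤ A.card

/-! ### Random access machine programs and their running time

The machine has registers `r₀, r₁, …` and arrays `M₀, M₁, …`, each array being a sequence of cells
addressed by natural numbers; registers and cells hold natural numbers. A program is a fixed finite
text, so it mentions only finitely many registers and arrays, but it can address every cell of these
arrays through the contents of a register. The only arithmetic operations are increment and
decrement; hence no number ever exceeds the largest number in the input
and the program text by more than the elapsed time, and charging one unit of time for every operation is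
legitimate. -/

namespace RAM

/-- The contents of the registers and of the arrays. -/
@[ext] structure Store where
  reg : ℕ → ℕ
  arr : ℕ → ℕ → ℕ

/-- Replace the content of register `x` by `v`. -/
def Store.setReg (s : Store) (x v : ℕ) : Store :=
  { s with reg := Function.update s.reg x v }

/-- Replace the content of cell `i` of array `a` by `v`. -/
def Store.setArr (s : Store) (a i v : ℕ) : Store :=
  { s with arr := Function.update s.arr a (Function.update (s.arr a) i v) }

/-- Elementary operations. Numbers `x`, `y` are names of registers, `a` is the name of an array. -/
inductive Op where
  /-- `r_x := c` -/
  | const (x c : ℕ)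
  /-- `r_x := r_y` -/
  | copy (x y : ℕ)
  /-- `r_x := r_x + 1` -/
  | inc (x : ℕ)
  /-- `r_x := r_x - 1`, where `0 - 1 = 0` -/
  | dec (x : ℕ)
  /-- `r_x := M_a[r_y]` -/
  | load (x a y : ℕ)
  /-- `M_a[r_x] := r_y` -/
  | store (a x y : ℕ)

/-- The effect of an elementary operation. -/
def Op.apply : Op → Store → Store
  | .const x c, s => s.setReg x c
  | .copy x y, s => s.setReg x (s.reg y)
  | .inc x, s => s.setReg x (s.reg x + 1)
  | .dec x, s => s.setReg x (s.reg x - 1)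
  | .load x a y, s => s.setReg x (s.arr a (s.reg y))
  | .store a x y, s => s.setArr a (s.reg x) (s.reg y)

/-- Tests: comparisons of two registers and their negations. -/
inductive Test where
  | lt (x y : ℕ)
  | eq (x y : ℕ)
  | nlt (x y : ℕ)
  | neq (x y : ℕ)

/-- A test succeeds. -/
def Test.Holds : Test → Store → Prop
  | .lt x y, s => s.reg x < s.reg y
  | .eq x y, s => s.reg x = s.reg y
  | .nlt x y, s => ¬ s.reg x < s.reg y
  | .neq x y, s => s.reg x ≠ s.reg y

/-- Programs. -/
inductive Program where
  | skip
  | op (o : Op)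
  | seq (P Q : Program)
  | ite (b : Test) (P Q : Program)
  | while (b : Test) (P : Program)

/-- `Exec P s t s'`: started in `s`, the program `P` halts after exactly `t` units of time, in `s'`.
Every execution of an elementary operation and every evaluation of a test takes one unit. -/
inductive Exec : Program → Store → ℕ → Store → Prop where
  | skip (s : Store) : Exec .skip s 0 s
  | op (o : Op) (s : Store) : Exec (.op o) s 1 (o.apply s)
  | seq {P Q : Program} {s s' s'' : Store} {t t' : ℕ} :
      Exec P s t s' → Exec Q s' t' s'' → Exec (.seq P Q) s (t + t') s''
  | ite_true {b : Test} {P Q : Program} {s s' : Store} {t : ℕ} :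
      b.Holds s → Exec P s t s' → Exec (.ite b P Q) s (1 + t) s'
  | ite_false {b : Test} {P Q : Program} {s s' : Store} {t : ℕ} :
      ¬ b.Holds s → Exec Q s t s' → Exec (.ite b P Q) s (1 + t) s'
  | while_true {b : Test} {P : Program} {s s' s'' : Store} {t t' : ℕ} :
      b.Holds s → Exec P s t s' → Exec (.while b P) s' t' s'' →
        Exec (.while b P) s (1 + t + t') s''
  | while_false {b : Test} {P : Program} {s : Store} :
      ¬ b.Holds s → Exec (.while b P) s 1 s

/-- Programs are deterministic: the running time and the final store are determined by the program
and the initial store. -/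
theorem Exec.unique {P : Program} {s s₁ s₂ : Store} {t₁ t₂ : ℕ}
    (h₁ : Exec P s t₁ s₁) (h₂ : Exec P s t₂ s₂) : t₁ = t₂ ∧ s₁ = s₂ := by
  induction h₁ generalizing t₂ s₂ with
  | skip s => cases h₂; exact ⟨rfl, rfl⟩
  | op o s => cases h₂; exact ⟨rfl, rfl⟩
  | seq _ _ ih ih' =>
    cases h₂ with
    | seq g g' =>
      obtain ⟨rfl, rfl⟩ := ih g
      obtain ⟨rfl, rfl⟩ := ih' g'
      exact ⟨rfl, rfl⟩
  | ite_true hb _ ih =>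
    cases h₂ with
    | ite_true _ g =>
      obtain ⟨rfl, rfl⟩ := ih g
      exact ⟨rfl, rfl⟩
    | ite_false hb' _ => exact absurd hb hb'
  | ite_false hb _ ih =>
    cases h₂ with
    | ite_true hb' _ => exact absurd hb' hb
    | ite_false _ g =>
      obtain ⟨rfl, rfl⟩ := ih g
      exact ⟨rfl, rfl⟩
  | while_true hb _ _ ih ih' =>
    cases h₂ with
    | while_true _ g g' =>
      obtain ⟨rfl, rfl⟩ := ih g
      obtain ⟨rfl, rfl⟩ := ih' g'
      exact ⟨rfl, rfl⟩
    | while_false hb' => exact absurd hb hb'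
  | while_false hb =>
    cases h₂ with
    | while_true hb' _ _ => exact absurd hb' hb
    | while_false _ => exact ⟨rfl, rfl⟩

open Classical in
/-- The input: register `r₀` holds the number `n` of vertices, the array `M₀` holds the adjacency
matrix of `G` row by row; all other registers and cells hold `0`. -/
noncomputable def input {n : ℕ} (G : SimpleGraph (Fin n)) : Store where
  reg x := if x = 0 then n else 0
  arr a k := if a = 0 ∧ ∃ i j : Fin n, G.Adj i j ∧ k = (i : ℕ) * n + (j : ℕ) then 1 else 0

/-- The output is a sequence of `n` numbers in the array `M₁`, one for each vertex; this is the set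
of the vertices whose number is `c`. -/
def outputSet (n : ℕ) (s : Store) (c : ℕ) : Finset (Fin n) :=
  Finset.univ.filter fun v => s.arr 1 v = c

end RAM

set_option linter.unusedSectionVars false

/-! ### Stores after an update. -/

namespace RAM

/-! A pair of perfectly matched sets either has a small first set or leaves few vertices outside,
since the number of outside vertices is `n - 2|A|` (`IsSol.numLab_add`). The threshold is `|A| =
11n/27`: beyond it at most `5n/27` vertices lie outside. Each case has its own search tree, and both
trees are processed with a stack.

In the first tree every vertex is put into `A` (label `1`) or not (label `5`). Once `A` is fixed, no
search for `B` is needed: only vertices with exactly one neighbour in `A` qualify, each of them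
serves a single vertex of `A`, and so the choices for different vertices of `A` do not interfere. A
greedy choice succeeds whenever some `B` exists (`not_conf_candidates`,
`IsPartial.not_conf_greedy`). The size of the pair depends on `A` alone, so any completion is as
good as any other.

In the second tree every vertex is put outside (label `3`) or into the pair (label `4`). The
vertices of the pair must then be divided into two sides so that each has exactly one neighbour on
the other side. This is solved by branching with propagation, where `clo` decides a free vertex as
soon as one of its two labels creates a conflict. In a closed labeling a matched vertex has no free
neighbour and an unmatched one has at least two, so matching a vertex decides many others at once.
The case analysis in `exists_goodBranch` shows that there is always a vertex whose branches are
cheap in total, or for which a single branch suffices. The latter happens for two reasons: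
exchanging the sides of all free vertices is a symmetry if every decided vertex is matched
(`IsSol.flip`), or the new decisions do not interact with the remaining vertices (`IsSol.exchange`).
Division of `m` vertices thus costs about `1.2728 ^ m` up to a polynomial factor.

Both trees are measured by one potential, `κ ^ n * y ^ #p * c ^ #q * (c + y) ^ #0` times a linear
factor, where `p` is the label of bounded frequency, `q` the other label of the tree, and `0` marks
undecided vertices. Here `c` is the price of a vertex with label `q`, and `y` and `κ` charge for the
label `p` so that a labeling within its limit has potential at least `1`. A round of the search
lowers the total potential by at least `1` (`IsWeight.progress_branch`, `IsWeight.progress_expand`),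
so `exec_while` bounds the number of rounds by the potential of the root, at most `(2n + 1) * 1.966
^ n`.

The body of each search is built from loops that run up to `n` only, hence has polynomial cost
(`Stmt.exists_polynomial_cost`); only the two outer loops run exponentially often. Their invariant
says that every pair within the limit is either matched in size by the recorded one or survives,
possibly exchanged for one of the same size, below a labeling on the stack (`exec_search`). -/

@[simp] theorem Store.setReg_reg (s : Store) (x v y : ℕ) :
    (s.setReg x v).reg y = if y = x then v else s.reg y := by
  simp [Store.setReg, Function.update_apply]

@[simp] theorem Store.setReg_arr (s : Store) (x v : ℕ) : (s.setReg x v).arr = s.arr := rfl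

@[simp] theorem Store.setArr_reg (s : Store) (a i v : ℕ) : (s.setArr a i v).reg = s.reg := rfl

theorem Store.setArr_arr (s : Store) (a i v b : ℕ) :
    (s.setArr a i v).arr b = if b = a then Function.update (s.arr a) i v else s.arr b := by
  simp [Store.setArr, Function.update_apply]

instance Test.decidableHolds (b : Test) (s : Store) : Decidable (b.Holds s) := by
  cases b <;> unfold Test.Holds <;> infer_instance

/-! ### Structured programs with bounded loops -/

/-- Structured programs: the only loops run a register through the numbers below the content of the
register `r₀`. -/
inductive Stmt where
  | skip
  | op (o : Op)
  | seq (P Q : Stmt)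
  | ite (b : Test) (P Q : Stmt)
  | loop (x : ℕ) (P : Stmt)

namespace Stmt

/-- The program that a structured program stands for. -/
def compile : Stmt → Program
  | skip => .skip
  | op o => .op o
  | seq P Q => .seq P.compile Q.compile
  | ite b P Q => .ite b P.compile Q.compile
  | loop x P => .seq (.op (.const x 0)) (.while (.lt x 0) (.seq P.compile (.op (.inc x))))

/-- The effect of a structured program. -/
def eval : Stmt → Store → Store
  | skip, s => s
  | op o, s => o.apply s
  | seq P Q, s => Q.eval (P.eval s)
  | ite b P Q, s => if b.Holds s then P.eval s else Q.eval s
  | loop x P, s => (fun s' => (Op.inc x).apply (P.eval s'))^[s.reg 0] (s.setReg x 0)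

/-- A bound for the running time when the content of `r₀` is `n`. -/
def cost (n : ℕ) : Stmt → ℕ
  | skip => 0
  | op _ => 1
  | seq P Q => P.cost n + Q.cost n
  | ite _ P Q => 1 + (P.cost n + Q.cost n)
  | loop _ P => 2 + n * (2 + P.cost n)

end Stmt

/-! ### What a structured program may change, and how long it runs. -/

/-- The operation may change register `r`. -/
def Op.writesReg (r : ℕ) : Op → Bool
  | .const x _ => r == x
  | .copy x _ => r == x
  | .inc x => r == x
  | .dec x => r == x
  | .load x _ _ => r == x
  | .store _ _ _ => false

/-- The operation may change array `b`. -/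
def Op.writesArr (b : ℕ) : Op → Bool
  | .store a _ _ => b == a
  | _ => false

theorem Op.apply_reg {o : Op} {r : ℕ} (h : o.writesReg r = false) (s : Store) :
    (o.apply s).reg r = s.reg r := by
  cases o <;> simp_all [Op.writesReg, Op.apply]

theorem Op.apply_arr {o : Op} {b : ℕ} (h : o.writesArr b = false) (s : Store) :
    (o.apply s).arr b = s.arr b := by
  cases o <;> simp_all [Op.writesArr, Op.apply, Store.setArr_arr]

namespace Stmt

/-- The structured program may change register `r`. -/
def writesReg (r : ℕ) : Stmt → Bool
  | skip => false
  | op o => o.writesReg r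
  | seq P Q => P.writesReg r || Q.writesReg r
  | ite _ P Q => P.writesReg r || Q.writesReg r
  | loop x P => r == x || P.writesReg r

/-- The structured program may change array `b`. -/
def writesArr (b : ℕ) : Stmt → Bool
  | skip => false
  | op o => o.writesArr b
  | seq P Q => P.writesArr b || Q.writesArr b
  | ite _ P Q => P.writesArr b || Q.writesArr b
  | loop _ P => P.writesArr b

/-- No loop changes its own bound or its own counter in its body. -/
def wf : Stmt → Bool
  | skip => true
  | op _ => true
  | seq P Q => P.wf && Q.wf
  | ite _ P Q => P.wf && Q.wf
  | loop x P => x != 0 && !P.writesReg 0 && !P.writesReg x && P.wf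

theorem eval_reg {S : Stmt} {r : ℕ} (h : S.writesReg r = false) (s : Store) :
    (S.eval s).reg r = s.reg r := by
  induction S generalizing s with
  | skip => rfl
  | op o => exact Op.apply_reg h s
  | seq P Q ihP ihQ =>
    simp only [writesReg, Bool.or_eq_false_iff] at h
    exact (ihQ h.2 _).trans (ihP h.1 _)
  | ite b P Q ihP ihQ =>
    simp only [writesReg, Bool.or_eq_false_iff] at h
    simp only [eval]
    split
    · exact ihP h.1 _
    · exact ihQ h.2 _
  | loop x P ih =>
    simp only [writesReg, Bool.or_eq_false_iff, beq_eq_false_iff_ne] at h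
    have key : ∀ (k : ℕ) (s' : Store),
        ((fun s' => (Op.inc x).apply (P.eval s'))^[k] s').reg r = s'.reg r := by
      intro k
      induction k with
      | zero => intro s'; rfl
      | succ k ihk =>
        intro s'
        rw [Function.iterate_succ_apply, ihk]
        simp [Op.apply, h.1, ih h.2]
    simp only [eval]
    rw [key]
    simp [h.1]

theorem eval_arr {S : Stmt} {b : ℕ} (h : S.writesArr b = false) (s : Store) :
    (S.eval s).arr b = s.arr b := by
  induction S generalizing s with
  | skip => rfl
  | op o => exact Op.apply_arr h s
  | seq P Q ihP ihQ =>
    simp only [writesArr, Bool.or_eq_false_iff] at h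
    exact (ihQ h.2 _).trans (ihP h.1 _)
  | ite b P Q ihP ihQ =>
    simp only [writesArr, Bool.or_eq_false_iff] at h
    simp only [eval]
    split
    · exact ihP h.1 _
    · exact ihQ h.2 _
  | loop x P ih =>
    simp only [writesArr] at h
    have key : ∀ (k : ℕ) (s' : Store),
        ((fun s' => (Op.inc x).apply (P.eval s'))^[k] s').arr b = s'.arr b := by
      intro k
      induction k with
      | zero => intro s'; rfl
      | succ k ihk =>
        intro s'
        rw [Function.iterate_succ_apply, ihk]
        simp [Op.apply, ih h]
    simp only [eval]
    rw [key]
    simp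

/-- Induction along a loop. -/
theorem eval_loop_induction {x : ℕ} {P : Stmt} {s : Store} (I : ℕ → Store → Prop)
    (hwf : (loop x P).wf = true) (h0 : I 0 (s.setReg x 0))
    (hstep : ∀ i < s.reg 0, ∀ s' : Store,
      (∀ r, (loop x P).writesReg r = false → s'.reg r = s.reg r) →
      (∀ a, P.writesArr a = false → s'.arr a = s.arr a) → s'.reg x = i →
      I i s' → I (i + 1) ((P.eval s').setReg x (i + 1))) :
    I (s.reg 0) ((loop x P).eval s) := by
  simp only [wf, Bool.and_eq_true, bne_iff_ne, Bool.not_eq_true'] at hwf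
  obtain ⟨⟨⟨hx, hP0⟩, hPx⟩, -⟩ := hwf
  -- The invariant travels with the facts its step may use: the counter equals the number of
  -- completed rounds, and everything outside the footprint of the loop is as at the start.
  have key : ∀ k ≤ s.reg 0,
      I k ((fun s' => (Op.inc x).apply (P.eval s'))^[k] (s.setReg x 0)) ∧
      ((fun s' => (Op.inc x).apply (P.eval s'))^[k] (s.setReg x 0)).reg x = k ∧
      (∀ r, (loop x P).writesReg r = false →
        ((fun s' => (Op.inc x).apply (P.eval s'))^[k] (s.setReg x 0)).reg r = s.reg r) ∧
      (∀ a, P.writesArr a = false →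
        ((fun s' => (Op.inc x).apply (P.eval s'))^[k] (s.setReg x 0)).arr a = s.arr a) := by
    intro k
    induction k with
    | zero =>
      intro _
      refine ⟨h0, by simp, fun r hr => ?_, fun a _ => by simp⟩
      simp only [writesReg, Bool.or_eq_false_iff, beq_eq_false_iff_ne] at hr
      simp [hr.1]
    | succ k ih =>
      intro hk
      obtain ⟨h1, h2, h3, h4⟩ := ih (by omega)
      rw [Function.iterate_succ_apply']
      have e := hstep k (by omega) _ h3 h4 h2 h1
      generalize (fun s' => (Op.inc x).apply (P.eval s'))^[k] (s.setReg x 0) = s' at *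
      have e2 : (Op.inc x).apply (P.eval s') = (P.eval s').setReg x (k + 1) := by
        simp [Op.apply, eval_reg hPx, h2]
      simp only [e2]
      refine ⟨e, by simp, fun r hr => ?_, fun a ha => ?_⟩
      · have hr' := hr
        simp only [writesReg, Bool.or_eq_false_iff, beq_eq_false_iff_ne] at hr'
        simp [hr'.1, eval_reg hr'.2, h3 r hr]
      · simp [eval_arr ha, h4 a ha]
  simpa [eval] using (key _ le_rfl).1

/-- Because the body of a loop writes neither `r₀` nor the counter, the compiled while loop makes
exactly the rounds that `eval` iterates, and every nested cost can be expressed by the same initial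
content of `r₀`. -/
theorem exec_compile {S : Stmt} (hwf : S.wf = true) (h0 : S.writesReg 0 = false) (s : Store) :
    ∃ t ≤ S.cost (s.reg 0), Exec S.compile s t (S.eval s) := by
  induction S generalizing s with
  | skip => exact ⟨0, le_rfl, .skip s⟩
  | op o => exact ⟨1, le_rfl, .op o s⟩
  | seq P Q ihP ihQ =>
    simp only [writesReg, Bool.or_eq_false_iff] at h0
    simp only [wf, Bool.and_eq_true] at hwf
    obtain ⟨t, ht, h⟩ := ihP hwf.1 h0.1 s
    obtain ⟨t', ht', h'⟩ := ihQ hwf.2 h0.2 (P.eval s)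
    rw [eval_reg h0.1] at ht'
    exact ⟨t + t', Nat.add_le_add ht ht', .seq h h'⟩
  | ite b P Q ihP ihQ =>
    simp only [writesReg, Bool.or_eq_false_iff] at h0
    simp only [wf, Bool.and_eq_true] at hwf
    obtain ⟨t, ht, h⟩ := ihP hwf.1 h0.1 s
    obtain ⟨t', ht', h'⟩ := ihQ hwf.2 h0.2 s
    by_cases hb : b.Holds s
    · exact ⟨1 + t, by simp only [cost]; omega, by simpa [eval, compile, hb] using Exec.ite_true hb h⟩
    · exact ⟨1 + t', by simp only [cost]; omega, by simpa [eval, compile, hb] using Exec.ite_false hb h'⟩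
  | loop x P ih =>
    simp only [writesReg, Bool.or_eq_false_iff, beq_eq_false_iff_ne] at h0
    simp only [wf, Bool.and_eq_true, bne_iff_ne, Bool.not_eq_true'] at hwf
    obtain ⟨⟨⟨hx, hP0⟩, hPx⟩, hwf⟩ := hwf
    set f : Store → Store := fun s' => (Op.inc x).apply (P.eval s') with hf
    -- Here `i` rounds are completed and `k` remain; the sum stays equal to the loop bound, so the
    -- cost of the body is the same in all rounds. The summand `1` is the final failing test.
    have key : ∀ (k i : ℕ) (s' : Store), s'.reg 0 = i + k → s'.reg x = i →
        ∃ t ≤ 1 + k * (2 + P.cost (i + k)),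
          Exec (.while (.lt x 0) (.seq P.compile (.op (.inc x)))) s' t (f^[k] s') := by
      intro k
      induction k with
      | zero =>
        intro i s' h1 h2
        exact ⟨1, by omega, .while_false (by simp [Test.Holds, h1, h2])⟩
      | succ k ihk =>
        intro i s' h1 h2
        obtain ⟨t, ht, h⟩ := ih hwf hP0 s'
        obtain ⟨t', ht', h'⟩ := ihk (i + 1) (f s')
          (by simp [hf, Op.apply, Ne.symm hx, eval_reg hP0, h1]; omega)
          (by simp [hf, Op.apply, eval_reg hPx, h2])
        refine ⟨1 + (t + 1) + t', ?_, .while_true (by simp [Test.Holds, h1, h2])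
          (.seq h (.op _ _)) h'⟩
        rw [h1] at ht
        have : i + 1 + k = i + (k + 1) := by omega
        rw [this] at ht'
        linarith
    obtain ⟨t, ht, h⟩ := key (s.reg 0) 0 (s.setReg x 0) (by simp [Ne.symm hx]) (by simp)
    refine ⟨1 + t, ?_, .seq (.op _ _) h⟩
    simp only [cost, zero_add] at ht ⊢
    omega

/-- A loop contributes a factor `n` and everything else adds up. Charging both arms of a conditional
in `cost` avoids a maximum, which need not be a polynomial. -/
theorem exists_polynomial_cost (S : Stmt) :
    ∃ p : Polynomial ℕ, ∀ n, S.cost n = p.eval n := by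
  induction S with
  | skip => exact ⟨0, by simp [cost]⟩
  | op o => exact ⟨1, by simp [cost]⟩
  | seq P Q ihP ihQ =>
    obtain ⟨p, hp⟩ := ihP
    obtain ⟨q, hq⟩ := ihQ
    exact ⟨p + q, by simp [cost, hp, hq]⟩
  | ite b P Q ihP ihQ =>
    obtain ⟨p, hp⟩ := ihP
    obtain ⟨q, hq⟩ := ihQ
    exact ⟨1 + (p + q), by simp [cost, hp, hq]⟩
  | loop x P ih =>
    obtain ⟨p, hp⟩ := ih
    exact ⟨2 + Polynomial.X * (2 + p), by simp [cost, hp]⟩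

/-- The structured programs of a list, one after the other. -/
def block : List Stmt → Stmt
  | [] => skip
  | S :: l => seq S (block l)

/-- Increase a register by a constant. -/
def incBy (x : ℕ) : ℕ → Stmt
  | 0 => skip
  | k + 1 => seq (op (.inc x)) (incBy x k)

theorem eval_incBy (x k : ℕ) (s : Store) : (incBy x k).eval s = s.setReg x (s.reg x + k) := by
  induction k generalizing s with
  | zero => simp [incBy, eval, Store.setReg]
  | succ k ih =>
    simp only [incBy, eval, ih, Op.apply]
    ext <;> simp [Store.setReg, Function.update_apply]
    split <;> omega

end Stmt

/-- A loop whose body consumes a potential of at least `1` in every round. -/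
theorem exec_while {α : Type*} {b : Test} {P : Program} {K : ℕ} (I : List α → Store → Prop)
    (Φ : List α → ℝ) (hΦ : ∀ L, 0 ≤ Φ L) (hb : ∀ L s, I L s → (b.Holds s ↔ L ≠ []))
    (hstep : ∀ L s, I L s → L ≠ [] → ∃ t ≤ K, ∃ s' L', Exec P s t s' ∧ I L' s' ∧ Φ L' + 1 ≤ Φ L)
    {L : List α} {s : Store} (h : I L s) :
    ∃ (t : ℕ) (s' : Store), Exec (.while b P) s t s' ∧ I [] s' ∧ (t : ℝ) ≤ Φ L * (K + 1) + 1 := by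
  -- Induction on an integer bound for the potential: a round needs potential at least `1`, and it
  -- costs at most `K` plus one test. The last summand `1` pays for the test that ends the loop.
  have key : ∀ (N : ℕ) (L : List α) (s : Store), I L s → Φ L < N + 1 →
      ∃ (t : ℕ) (s' : Store), Exec (.while b P) s t s' ∧ I [] s' ∧
        (t : ℝ) ≤ Φ L * (K + 1) + 1 := by
    intro N
    induction N with
    | zero =>
      intro L s h hN
      by_cases hL : L = []
      · subst hL
        refine ⟨1, s, .while_false (by simp [hb _ _ h]), h, ?_⟩
        have := hΦ []
        push_cast
        nlinarith [Nat.cast_nonneg (α := ℝ) K]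
      · obtain ⟨t, -, s', L', -, -, h'⟩ := hstep L s h hL
        have := hΦ L'
        norm_num at hN
        linarith
    | succ N ih =>
      intro L s h hN
      by_cases hL : L = []
      · subst hL
        refine ⟨1, s, .while_false (by simp [hb _ _ h]), h, ?_⟩
        have := hΦ []
        push_cast
        nlinarith [Nat.cast_nonneg (α := ℝ) K]
      · obtain ⟨t, ht, s', L', hx, hI, h'⟩ := hstep L s h hL
        obtain ⟨t', s'', hx', hI', ht'⟩ := ih L' s' hI (by push_cast at hN; linarith)
        refine ⟨_, s'', .while_true ((hb _ _ h).2 hL) hx hx', hI', ?_⟩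
        have : (t : ℝ) ≤ K := by exact_mod_cast ht
        push_cast
        nlinarith [Nat.cast_nonneg (α := ℝ) K]
  refine key ⌊Φ L⌋₊ L s h (Nat.lt_floor_add_one _)

end RAM

/-! ### Labelings

Partial assignments of the vertices are labelings by numbers: `1` and `2` for the first and the
second set of the pair, `3` for the remaining vertices, `4` for a vertex that belongs to one of the
two sets, `5` for a vertex outside the first set, and `0` for a vertex that is completely undecided. -/

namespace PMS

open Finset

/-- The label of the other set of the pair. -/
def opp (a : ℕ) : ℕ := if a = 1 then 2 else if a = 2 then 1 else 7

theorem opp_one : opp 1 = 2 := rfl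
theorem opp_two : opp 2 = 1 := rfl

variable {V : Type*} [Fintype V] [DecidableEq V] (G : SimpleGraph V)

open Classical in
/-- The neighbours of `x` that lie in the opposite set. -/
noncomputable def oppNbrs (T : V → ℕ) (x : V) : Finset V :=
  univ.filter fun y => G.Adj x y ∧ T y = opp (T x)

open Classical in
/-- The neighbours of `x` that are free to join either set. -/
noncomputable def freeNbrs (T : V → ℕ) (x : V) : Finset V :=
  univ.filter fun y => G.Adj x y ∧ T y = 4

/-- The vertex belongs to the first or to the second set. -/
def Dec (T : V → ℕ) (x : V) : Prop := T x = 1 ∨ T x = 2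

/-- Some vertex of the pair can no longer have exactly one opposite neighbour. -/
def Conf (T : V → ℕ) : Prop :=
  ∃ x, Dec T x ∧ (2 ≤ (oppNbrs G T x).card ∨ (oppNbrs G T x = ∅ ∧ freeNbrs G T x = ∅))

/-- `T'` arises from `T` by deciding free vertices. -/
def Ext (T T' : V → ℕ) : Prop := ∀ v, T' v = T v ∨ (T v = 4 ∧ (T' v = 1 ∨ T' v = 2))

/-- Deciding a single free vertex does not create a conflict. -/
def Closed (T : V → ℕ) : Prop :=
  ∀ v, T v = 4 → ∀ c, c = 1 ∨ c = 2 → ¬ Conf G (Function.update T v c)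

/-- A labeling that describes a pair of perfectly matched sets. -/
def IsSol (S : V → ℕ) : Prop := (∀ v, S v = 1 ∨ S v = 2 ∨ S v = 3) ∧ ¬ Conf G S

/-- The vertices that are free in `T` but no longer in `T'`. -/
def newDec (T T' : V → ℕ) : Finset V := univ.filter fun v => T v = 4 ∧ T' v ≠ 4

/-- The number of vertices with a given label. -/
def numLab (T : V → ℕ) (a : ℕ) : ℕ := (univ.filter fun v => T v = a).card

variable {G}

theorem mem_oppNbrs {T : V → ℕ} {x y : V} :
    y ∈ oppNbrs G T x ↔ G.Adj x y ∧ T y = opp (T x) := by simp [oppNbrs]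

theorem mem_freeNbrs {T : V → ℕ} {x y : V} :
    y ∈ freeNbrs G T x ↔ G.Adj x y ∧ T y = 4 := by simp [freeNbrs]

theorem mem_newDec {T T' : V → ℕ} {x : V} : x ∈ newDec T T' ↔ T x = 4 ∧ T' x ≠ 4 := by
  simp [newDec]

theorem Dec.opp {T : V → ℕ} {x : V} (h : Dec T x) : opp (T x) = 1 ∨ PMS.opp (T x) = 2 := by
  rcases h with h | h <;> simp [h, PMS.opp]

theorem conf_of_two {T : V → ℕ} {x y z : V} (hx : Dec T x) (hy : G.Adj x y) (hz : G.Adj x z)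
    (hyz : y ≠ z) (hy' : T y = opp (T x)) (hz' : T z = opp (T x)) : Conf G T :=
  ⟨x, hx, Or.inl (Finset.one_lt_card.2 ⟨y, mem_oppNbrs.2 ⟨hy, hy'⟩, z, mem_oppNbrs.2 ⟨hz, hz'⟩, hyz⟩)⟩

theorem Ext.refl (T : V → ℕ) : Ext T T := fun _ => Or.inl rfl

theorem Ext.trans {T T' T'' : V → ℕ} (h : Ext T T') (h' : Ext T' T'') : Ext T T'' := by
  intro v
  rcases h v with e | ⟨e, f | f⟩ <;> rcases h' v with e' | ⟨e', f' | f'⟩ <;> simp_all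

theorem Ext.eq_of_ne {T T' : V → ℕ} (h : Ext T T') {v : V} (hv : T v ≠ 4) : T' v = T v := by
  rcases h v with e | e
  · exact e
  · exact absurd e.1 hv

theorem Ext.eq_four {T T' : V → ℕ} (h : Ext T T') {v : V} (hv : T' v = 4) : T v = 4 := by
  rcases h v with e | e
  · exact e ▸ hv
  · exact e.1

theorem Ext.dec_of {T T' : V → ℕ} (h : Ext T T') {v : V} (hv : T v = 4) (hv' : T' v ≠ 4) :
    Dec T' v := by
  rcases h v with e | e
  · exact absurd (e.trans hv) hv'
  · exact e.2

theorem Dec.ne_four {T : V → ℕ} {x : V} (h : Dec T x) : T x ≠ 4 := by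
  rcases h with h | h <;> simp [h]

theorem Ext.dec {T T' : V → ℕ} (h : Ext T T') {v : V} (hv : Dec T v) : Dec T' v := by
  unfold Dec
  rw [h.eq_of_ne hv.ne_four]
  exact hv

theorem ext_update {T : V → ℕ} {v : V} {c : ℕ} (hv : T v = 4) (hc : c = 1 ∨ c = 2) :
    Ext T (Function.update T v c) := by
  intro w
  by_cases h : w = v
  · subst h; simp [hv, hc]
  · simp [h]

theorem Ext.update {T S : V → ℕ} (h : Ext T S) {v : V} {c : ℕ} (hc : S v = c) :
    Ext (Function.update T v c) S := by
  intro w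
  by_cases e : w = v
  · subst e; simp [hc]
  · simpa [e] using h w

/-- Deciding free vertices never removes an opposite neighbour, and a vertex without free neighbours
sees no further change. So a conflict excludes every solution below it, which justifies both pruning
and propagation. -/
theorem Conf.mono {T T' : V → ℕ} (h : Conf G T) (hT : Ext T T') : Conf G T' := by
  obtain ⟨x, hx, h⟩ := h
  have ex : T' x = T x := hT.eq_of_ne hx.ne_four
  refine ⟨x, hT.dec hx, ?_⟩
  have ho : opp (T x) ≠ 4 := by rcases hx with e | e <;> simp [e, opp]
  rcases h with h | ⟨h1, h2⟩
  · refine Or.inl (h.trans (Finset.card_le_card ?_))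
    intro y hy
    rw [mem_oppNbrs] at hy ⊢
    rw [ex, hT.eq_of_ne (by rw [hy.2]; exact ho)]
    exact hy
  · right
    have key : ∀ y, G.Adj x y → T y ≠ 4 := fun y hy e => by
      have : y ∈ freeNbrs G T x := mem_freeNbrs.2 ⟨hy, e⟩
      simp [h2] at this
    constructor
    · refine Finset.eq_empty_of_forall_notMem fun y hy => ?_
      rw [mem_oppNbrs, ex] at hy
      have : y ∈ oppNbrs G T x := mem_oppNbrs.2 ⟨hy.1, by rw [← hT.eq_of_ne (key y hy.1)]; exact hy.2⟩
      simp [h1] at this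
    · refine Finset.eq_empty_of_forall_notMem fun y hy => ?_
      rw [mem_freeNbrs] at hy
      exact key y hy.1 (hT.eq_four hy.2)

/-! ### Propagation -/

variable (G) in
open Classical in
/-- Decide the vertex `v` if one of the two decisions creates a conflict. -/
noncomputable def upd (v : V) (T : V → ℕ) : V → ℕ :=
  if T v = 4 then
    if Conf G (Function.update T v 2) then Function.update T v 1
    else if Conf G (Function.update T v 1) then Function.update T v 2
    else T
  else T

theorem ext_upd (v : V) (T : V → ℕ) : Ext T (upd G v T) := by
  unfold upd
  split_ifs with h
  · exact ext_update h (.inl rfl)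
  · exact ext_update h (.inr rfl)
  · exact .refl T
  · exact .refl T

/-- A conflict created by one label of `v` persists in all extensions, so a solution uses the other
label. If both labels conflict, there is no solution, and the choice that `upd` makes is irrelevant.
-/
theorem upd_sound {v : V} {T S : V → ℕ} (hS : IsSol G S) (h : Ext T S) : Ext (upd G v T) S := by
  unfold upd
  split_ifs with h4 h1 h2
  · refine h.update ?_
    rcases h v with e | ⟨-, e | e⟩
    · have := hS.1 v
      omega
    · exact e
    · exact absurd (h1.mono (h.update e)) hS.2
  · refine h.update ?_
    rcases h v with e | ⟨-, e | e⟩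
    · have := hS.1 v
      omega
    · exact absurd (h2.mono (h.update e)) hS.2
    · exact e
  · exact h
  · exact h

/-- The dichotomy behind the termination of propagation: an idle update certifies closedness at `v`,
and any other update uses up a free vertex. -/
theorem upd_eq_or (v : V) (T : V → ℕ) :
    (upd G v T = T ∧ (T v = 4 → ∀ c, c = 1 ∨ c = 2 → ¬ Conf G (Function.update T v c))) ∨
      numLab (upd G v T) 4 < numLab T 4 := by
  have key : ∀ c, c ≠ 4 → T v = 4 → numLab (Function.update T v c) 4 < numLab T 4 := by
    intro c hc hv
    refine Finset.card_lt_card ?_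
    rw [Finset.ssubset_iff_of_subset]
    · exact ⟨v, by simp [hv], by simp [hc]⟩
    · intro w hw
      simp only [mem_filter, mem_univ, true_and] at hw ⊢
      by_cases e : w = v
      · exact e ▸ hv
      · simpa [e] using hw
  unfold upd
  split_ifs with h4 h1 h2
  · exact Or.inr (key 1 (by simp) h4)
  · exact Or.inr (key 2 (by simp) h4)
  · refine Or.inl ⟨rfl, ?_⟩
    rintro - c (rfl | rfl) <;> assumption
  · exact Or.inl ⟨rfl, fun h => absurd h h4⟩

theorem Ext.numLab_le {T T' : V → ℕ} (h : Ext T T') : numLab T' 4 ≤ numLab T 4 := by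
  refine Finset.card_le_card fun v hv => ?_
  simp only [mem_filter, mem_univ, true_and] at hv ⊢
  exact h.eq_four hv

section

variable {n : ℕ} (G : SimpleGraph (Fin n))

/-- Propagation at the vertices below `i`. -/
noncomputable def passTo (T : Fin n → ℕ) : ℕ → Fin n → ℕ
  | 0 => T
  | i + 1 => if h : i < n then upd G ⟨i, h⟩ (passTo T i) else passTo T i

/-- Propagation at all vertices. -/
noncomputable def pass (T : Fin n → ℕ) : Fin n → ℕ := passTo G T n

/-- Exhaustive propagation. -/
noncomputable def clo (T : Fin n → ℕ) : Fin n → ℕ := (pass G)^[n] T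

variable {G}

theorem ext_passTo (T : Fin n → ℕ) (i : ℕ) : Ext T (passTo G T i) := by
  induction i with
  | zero => exact .refl T
  | succ i ih =>
    unfold passTo
    split
    · exact ih.trans (ext_upd _ _)
    · exact ih

theorem passTo_sound {T S : Fin n → ℕ} (hS : IsSol G S) (h : Ext T S) (i : ℕ) :
    Ext (passTo G T i) S := by
  induction i with
  | zero => exact h
  | succ i ih =>
    unfold passTo
    split
    · exact upd_sound hS ih
    · exact ih

theorem passTo_eq_or (T : Fin n → ℕ) (i : ℕ) :
    (passTo G T i = T ∧ ∀ v : Fin n, v.1 < i → T v = 4 → ∀ c, c = 1 ∨ c = 2 →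
      ¬ Conf G (Function.update T v c)) ∨ numLab (passTo G T i) 4 < numLab T 4 := by
  induction i with
  | zero => exact Or.inl ⟨rfl, fun v hv => absurd hv (Nat.not_lt_zero _)⟩
  | succ i ih =>
    unfold passTo
    split
    · next h =>
      rcases ih with ⟨e, ih⟩ | ih
      · rw [e]
        rcases upd_eq_or (G := G) ⟨i, h⟩ T with ⟨e', h'⟩ | h'
        · refine Or.inl ⟨e', fun v hv => ?_⟩
          rcases Nat.lt_succ_iff_lt_or_eq.1 hv with hv | hv
          · exact ih v hv
          · have : v = ⟨i, h⟩ := Fin.ext hv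
            exact this ▸ h'
        · exact Or.inr h'
      · exact Or.inr ((ext_upd _ _).numLab_le.trans_lt ih)
    · next h =>
      rcases ih with ⟨e, ih⟩ | ih
      · exact Or.inl ⟨e, fun v _ => ih v (by omega)⟩
      · exact Or.inr ih

theorem ext_iterate_pass (T : Fin n → ℕ) (k : ℕ) : Ext T ((pass G)^[k] T) := by
  induction k with
  | zero => exact .refl T
  | succ k ih =>
    rw [Function.iterate_succ_apply']
    exact ih.trans (ext_passTo _ _)

theorem ext_clo (T : Fin n → ℕ) : Ext T (clo G T) := ext_iterate_pass T n

theorem clo_sound {T S : Fin n → ℕ} (hS : IsSol G S) (h : Ext T S) : Ext (clo G T) S := by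
  have key : ∀ k, Ext ((pass G)^[k] T) S := by
    intro k
    induction k with
    | zero => exact h
    | succ k ih =>
      rw [Function.iterate_succ_apply']
      exact passTo_sound hS ih n
  exact key n

/-- A pass is either idle, and then the labeling is closed, or it uses up a free vertex. After `n`
passes without an idle one, no vertex is free, and closedness is vacuous. -/
theorem closed_clo (T : Fin n → ℕ) : Closed G (clo G T) := by
  have key : ∀ k, Closed G ((pass G)^[k] T) ∨ numLab ((pass G)^[k] T) 4 + k ≤ numLab T 4 := by
    intro k
    induction k with
    | zero => exact Or.inr le_rfl
    | succ k ih =>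
      rw [Function.iterate_succ_apply']
      generalize (pass G)^[k] T = U at *
      rcases passTo_eq_or (G := G) U n with ⟨e, h⟩ | h
      · left
        unfold pass
        rw [e]
        exact fun v hv => h v v.2 hv
      · rcases ih with ih | ih
        · left
          -- A closed labeling is a fixed point of propagation, so closedness survives the remaining
          -- passes.
          have : passTo G U n = U := by
            have : ∀ i, passTo G U i = U := by
              intro i
              induction i with
              | zero => rfl
              | succ i ihi =>
                unfold passTo
                split
                · rw [ihi]
                  unfold upd
                  split_ifs with h4 h1 h2
                  · exact absurd h1 (ih _ h4 _ (.inr rfl))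
                  · exact absurd h2 (ih _ h4 _ (.inl rfl))
                  · rfl
                  · rfl
                · exact ihi
            exact this n
          unfold pass
          rwa [this]
        · right
          unfold pass
          omega
  rcases key n with h | h
  · exact h
  · intro v hv
    have h1 : numLab T 4 ≤ n := by simpa [numLab] using Finset.card_le_univ (univ.filter fun v => T v = 4)
    have h2 : 0 < numLab (clo G T) 4 := Finset.card_pos.2 ⟨v, by simp [hv]⟩
    unfold clo at h2
    omega

end

end PMS

namespace PMS

open Finset

variable {V : Type*} [Fintype V] [DecidableEq V] {G : SimpleGraph V}

/-! ### Local structure of propagated labelings -/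

/-- If `x` has its opposite neighbour, then every other neighbour is on the side of `x`. -/
theorem Closed.ne_of_matched {T : V → ℕ} (hT : Closed G T) (hc : ¬ Conf G T) {x y z : V}
    (hx : Dec T x) (hz : G.Adj x z) (hz' : T z = opp (T x)) (hy : G.Adj x y) (hyz : y ≠ z) :
    T y ≠ 4 ∧ T y ≠ opp (T x) := by
  refine ⟨fun e => ?_, fun e => hc (conf_of_two hx hy hz hyz e hz')⟩
  -- A free `y` could not take the side opposite to `x`, as `x` would get a second opposite
  -- neighbour; propagation would have noticed.
  refine hT y e _ hx.opp ?_
  have hxy : x ≠ y := hy.ne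
  have ex : Function.update T y (opp (T x)) x = T x := by simp [hxy]
  refine conf_of_two (x := x) (y := y) (z := z) ?_ hy hz hyz ?_ ?_
  · unfold Dec; rw [ex]; exact hx
  · rw [ex]; simp
  · rw [ex]; simpa [hyz.symm] using hz'

/-- A vertex without opposite neighbour has at least two free neighbours. -/
theorem Closed.two_le_card_freeNbrs {T : V → ℕ} (hT : Closed G T) (hc : ¬ Conf G T) {x : V}
    (hx : Dec T x) (h : oppNbrs G T x = ∅) : 2 ≤ (freeNbrs G T x).card := by
  by_contra hlt
  rcases (freeNbrs G T x).eq_empty_or_nonempty with h0 | ⟨y, hy⟩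
  · exact hc ⟨x, hx, Or.inr ⟨h, h0⟩⟩
  · have huniq : ∀ w ∈ freeNbrs G T x, w = y := by
      intro w hw
      by_contra hwy
      exact hlt (Finset.one_lt_card.2 ⟨w, hw, y, hy, hwy⟩)
    rw [mem_freeNbrs] at hy
    -- If `y` were the only free neighbour of `x`, putting it on the side of `x` would leave `x`
    -- without a partner.
    refine hT y hy.2 (T x) hx ?_
    have hxy : x ≠ y := hy.1.ne
    have ex : Function.update T y (T x) x = T x := by simp [hxy]
    refine ⟨x, by unfold Dec; rw [ex]; exact hx, Or.inr ⟨?_, ?_⟩⟩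
    · refine Finset.eq_empty_of_forall_notMem fun w hw => ?_
      rw [mem_oppNbrs, ex] at hw
      by_cases e : w = y
      · subst e
        rcases hx with e | e <;> simp [e, opp] at hw
      · have : w ∈ oppNbrs G T x := mem_oppNbrs.2 ⟨hw.1, by simpa [e] using hw.2⟩
        simp [h] at this
    · refine Finset.eq_empty_of_forall_notMem fun w hw => ?_
      rw [mem_freeNbrs] at hw
      by_cases e : w = y
      · subst e
        have := hw.2
        rcases hx with e | e <;> simp [e] at this
      · exact e (huniq w (mem_freeNbrs.2 ⟨hw.1, by simpa [e] using hw.2⟩))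

/-- A free vertex has at most one neighbour in each of the two sets. -/
theorem Closed.eq_of_adj_free {T : V → ℕ} (hT : Closed G T) {y z z' : V} (hy : T y = 4)
    (hz : G.Adj y z) (hz' : G.Adj y z') (hd : Dec T z) (e : T z' = T z) : z' = z := by
  by_contra hne
  -- On the other side, `y` itself would have the two opposite neighbours `z` and `z'`.
  refine hT y hy _ hd.opp ?_
  have h1 : z ≠ y := hz.ne'
  have h2 : z' ≠ y := hz'.ne'
  have ho : opp (opp (T z)) = T z := by rcases hd with e | e <;> simp [e, opp]
  refine conf_of_two (x := y) (y := z) (z := z') ?_ hz hz' (Ne.symm hne) ?_ ?_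
  · simpa [Dec] using hd.opp
  · simp [h1, ho]
  · simp [h2, ho, e]

/-- A decided neighbour of a free vertex has no opposite neighbour yet. -/
theorem Closed.oppNbrs_eq_empty {T : V → ℕ} (hT : Closed G T) (hc : ¬ Conf G T) {x y : V}
    (hx : Dec T x) (hy : y ∈ freeNbrs G T x) : oppNbrs G T x = ∅ := by
  refine Finset.eq_empty_of_forall_notMem fun z hz => ?_
  rw [mem_oppNbrs] at hz
  rw [mem_freeNbrs] at hy
  have hyz : y ≠ z := by
    rintro rfl
    rcases hx with e | e <;> simp [e, opp, hy.2] at hz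
  exact (hT.ne_of_matched hc hx hz.1 hz.2 hy.1 hyz).1 hy.2

variable {l T : V → ℕ}

/-- Finding the partner of `x` fixes the side of every other neighbour too. This is the main source
of gain in the branching analysis. -/
theorem freeNbrs_subset_newDec (hT : Closed G T) (hc : ¬ Conf G T) {x z : V}
    (hx : Dec T x) (hz : G.Adj x z) (hz' : T z = opp (T x)) : freeNbrs G l x ⊆ newDec l T := by
  intro y hy
  rw [mem_freeNbrs] at hy
  refine mem_newDec.2 ⟨hy.2, ?_⟩
  by_cases hyz : y = z
  · subst hyz
    rcases hx with e | e <;> simp [e, opp, hz']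
  · exact (hT.ne_of_matched hc hx hz hz' hy.1 hyz).1

/-- In a closed labeling an unmatched vertex keeps at least two free neighbours, so a vertex that
has lost all of them is matched. -/
theorem exists_opp_of_subset (hlT : Ext l T) (hT : Closed G T) (hc : ¬ Conf G T) {x : V}
    (hx : Dec T x) (h : freeNbrs G l x ⊆ newDec l T) : ∃ z, G.Adj x z ∧ T z = opp (T x) := by
  by_contra hne
  have h0 : oppNbrs G T x = ∅ := Finset.eq_empty_of_forall_notMem fun z hz =>
    hne ⟨z, mem_oppNbrs.1 hz⟩
  have h2 := hT.two_le_card_freeNbrs hc hx h0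
  obtain ⟨y, hy⟩ := Finset.card_pos.1 (by omega : 0 < (freeNbrs G T x).card)
  rw [mem_freeNbrs] at hy
  have := h (mem_freeNbrs.2 ⟨hy.1, hlT.eq_four hy.2⟩)
  exact (mem_newDec.1 this).2 hy.2

/-- When all free neighbours of `x` but one are decided, the last one is decided as well. -/
theorem freeNbrs_subset_of_card_two (hlT : Ext l T) (hT : Closed G T) (hc : ¬ Conf G T) {x u : V}
    (hx : Dec T x) (hu : u ∈ freeNbrs G l x) (hu' : T u ≠ 4) (h2 : (freeNbrs G l x).card ≤ 2) :
    freeNbrs G l x ⊆ newDec l T := by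
  by_cases h : ∃ z, G.Adj x z ∧ T z = opp (T x)
  · obtain ⟨z, hz, hz'⟩ := h
    exact freeNbrs_subset_newDec hT hc hx hz hz'
  · exfalso
    have h0 : oppNbrs G T x = ∅ := Finset.eq_empty_of_forall_notMem fun z hz =>
      h ⟨z, mem_oppNbrs.1 hz⟩
    have h3 := hT.two_le_card_freeNbrs hc hx h0
    -- With `u` decided, at most one free neighbour is left, but an unmatched `x` would need two.
    have : freeNbrs G T x ⊂ freeNbrs G l x := by
      rw [Finset.ssubset_iff_of_subset]
      · exact ⟨u, hu, fun h => hu' (mem_freeNbrs.1 h).2⟩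
      · intro y hy
        rw [mem_freeNbrs] at hy ⊢
        exact ⟨hy.1, hlT.eq_four hy.2⟩
    have := Finset.card_lt_card this
    omega

/-! ### Branching -/

/-- The weight of a branch in which `g` vertices are decided. -/
def wt (g : ℕ) : ℕ :=
  if g ≤ 1 then 27 else if g = 2 then 21 else if g = 3 then 17 else if g = 4 then 13
  else if g = 5 then 11 else if g = 6 then 8 else 7

/-- The weights for `1 ≤ g ≤ 7` are the values `34 / 1.2728 ^ g` rounded up, so a total weight of at
most `34` is what the potential can pay for. Being integers, they can be added and compared by the
machine. Monotonicity makes lower bounds for the gain sufficient. -/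
theorem wt_antitone : Antitone wt := by
  intro a b h
  unfold wt
  split_ifs <;> omega

variable (G) in
/-- All decided vertices have their opposite neighbour. -/
def NoActive (l : V → ℕ) : Prop := ∀ x, Dec l x → oppNbrs G l x ≠ ∅

variable (G) in
/-- The decisions made in `T` on top of `l` do not concern the vertices left free. -/
def Autark (l T : V → ℕ) : Prop :=
  ∀ x, Dec T x → oppNbrs G T x = ∅ → ∀ y, (y = x ∨ G.Adj x y) → ¬ (l y = 4 ∧ T y ≠ 4)

variable (G) in
/-- The branches on `x`: decide a free vertex `x`, or choose the partner of a decided `x`. -/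
def IsOption (l : V → ℕ) (x u : V) (c : ℕ) : Prop :=
  l u = 4 ∧ ((u = x ∧ (c = 1 ∨ c = 2)) ∨ (Dec l x ∧ G.Adj x u ∧ c = opp (l x)))

/-- If the vertices decided in `T` are the common free neighbours of two decided vertices, then no
free vertex is affected. -/
theorem autark_of_common (hl : Closed G l) {v w : V} (hdv : Dec l v) (hdw : Dec l w)
    (hab : l w = opp (l v)) (hvw : freeNbrs G l v = freeNbrs G l w) (eT : Ext l T)
    (kT : Closed G T) (nT : ¬ Conf G T) (hsub : freeNbrs G l v ⊆ newDec l T)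
    (hle : (newDec l T).card ≤ (freeNbrs G l v).card) : Autark G l T := by
  intro x hx hx0 y hxy hy
  have hD : freeNbrs G l v = newDec l T := Finset.eq_of_subset_of_card_le hsub hle
  have memv : ∀ z ∈ newDec l T, G.Adj v z := fun z hz => by
    rw [← hD] at hz; exact (mem_freeNbrs.1 hz).1
  have memw : ∀ z ∈ newDec l T, G.Adj w z := fun z hz => by
    rw [← hD, hvw] at hz; exact (mem_freeNbrs.1 hz).1
  have noopp : ∀ z, G.Adj x z → T z ≠ opp (T x) := fun z hz e => by
    have : z ∈ oppNbrs G T x := mem_oppNbrs.2 ⟨hz, e⟩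
    simp [hx0] at this
  have Tv : T v = l v := eT.eq_of_ne hdv.ne_four
  have Tw : T w = l w := eT.eq_of_ne hdw.ne_four
  by_cases hnew : x ∈ newDec l T
  -- A newly decided vertex is adjacent to `v` and to `w`, which lie on different sides, so one of
  -- them is its opposite neighbour.
  · have n1 := noopp v (memv x hnew).symm
    have n2 := noopp w (memw x hnew).symm
    rw [Tv] at n1
    rw [Tw, hab] at n2
    rcases hx with e | e <;> rcases hdv with e' | e' <;> simp [e, e', opp] at n1 n2
  · have hyx : G.Adj x y := by
      rcases hxy with rfl | h
      · exact absurd (mem_newDec.2 hy) hnew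
      · exact h
    have hyn : y ∈ newDec l T := mem_newDec.2 hy
    have hlx : l x ≠ 4 := fun e => hnew (mem_newDec.2 ⟨e, hx.ne_four⟩)
    have ex : T x = l x := eT.eq_of_ne hlx
    have hsub' : freeNbrs G l w ⊆ newDec l T := hvw ▸ hsub
    -- While `y` was free it had at most one neighbour on each side, and these are `v` and `w`. Both
    -- have lost all their free neighbours and are therefore matched.
    have : x = v ∨ x = w := by
      have : l x = l v ∨ l x = l w := by
        rw [hab]
        unfold Dec at hx
        rw [ex] at hx
        rcases hx with e | e <;> rcases hdv with e' | e' <;> simp [e, e', opp]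
      rcases this with e | e
      · exact Or.inl (hl.eq_of_adj_free hy.1 (memv y hyn).symm hyx.symm hdv e)
      · exact Or.inr (hl.eq_of_adj_free hy.1 (memw y hyn).symm hyx.symm hdw e)
    rcases this with rfl | rfl
    · obtain ⟨z, hz, hz'⟩ := exists_opp_of_subset eT kT nT hx hsub
      exact noopp z hz hz'
    · obtain ⟨z, hz, hz'⟩ := exists_opp_of_subset eT kT nT hx hsub'
      exact noopp z hz hz'

/-! ### Weights of branches and the existence of a cheap branching. -/

section

variable {n : ℕ} (G : SimpleGraph (Fin n)) (l : Fin n → ℕ)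

/-- The branch in which `u` gets the label `c`. -/
noncomputable def child (u : Fin n) (c : ℕ) : Fin n → ℕ := clo G (Function.update l u c)

open Classical in
/-- The weight of a branch, `0` if it is in conflict. -/
noncomputable def childWt (u : Fin n) (c : ℕ) : ℕ :=
  if Conf G (child G l u c) then 0 else wt (newDec l (child G l u c)).card

open Classical in
/-- The total weight of the branches on `x`. -/
noncomputable def totalWt (x : Fin n) : ℕ :=
  if l x = 4 then childWt G l x 1 + childWt G l x 2
  else if Dec l x then ∑ u ∈ freeNbrs G l x, childWt G l u (opp (l x))
  else 0

/-- Branching on `x` is cheap enough. -/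
def GoodBranch (x : Fin n) : Prop :=
  (l x = 4 ∨ (Dec l x ∧ (freeNbrs G l x).Nonempty)) ∧
    (totalWt G l x ≤ 34 ∨
      ∃ u c, IsOption G l x u c ∧ ¬ Conf G (child G l u c) ∧
        (NoActive G l ∨ Autark G l (child G l u c)))

variable {G l}

theorem ext_child {u : Fin n} {c : ℕ} (hu : l u = 4) (hc : c = 1 ∨ c = 2) :
    Ext l (child G l u c) :=
  (ext_update hu hc).trans (ext_clo _)

theorem closed_child (u : Fin n) (c : ℕ) : Closed G (child G l u c) := closed_clo _

theorem child_apply {u : Fin n} {c : ℕ} (hc : c = 1 ∨ c = 2) : child G l u c u = c := by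
  have := (ext_clo (G := G) (Function.update l u c)).eq_of_ne (v := u)
    (by rcases hc with rfl | rfl <;> simp)
  simpa [child] using this

theorem mem_newDec_child {u : Fin n} {c : ℕ} (hu : l u = 4) (hc : c = 1 ∨ c = 2) :
    u ∈ newDec l (child G l u c) :=
  mem_newDec.2 ⟨hu, by rw [child_apply hc]; rcases hc with rfl | rfl <;> simp⟩

theorem childWt_le {u : Fin n} {c k : ℕ}
    (h : ¬ Conf G (child G l u c) → k ≤ (newDec l (child G l u c)).card) :
    childWt G l u c ≤ wt k := by
  unfold childWt
  split_ifs with hc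
  · exact Nat.zero_le _
  · exact wt_antitone (h hc)

theorem childWt_le_wt_one {u : Fin n} {c : ℕ} : childWt G l u c ≤ 27 :=
  childWt_le (k := 0) fun _ => Nat.zero_le _

theorem totalWt_free {x : Fin n} (hx : l x = 4) {a b : ℕ} (ha : a = 1 ∨ a = 2) (hb : b = opp a) :
    totalWt G l x = childWt G l x a + childWt G l x b := by
  rcases ha with rfl | rfl <;> simp [totalWt, hx, hb, opp, add_comm]

/-- Branching on a free vertex that has a neighbour in both sets. -/
theorem goodBranch_of_two (hl : Closed G l) (hcl : ¬ Conf G l) {u v w : Fin n} {a b : ℕ}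
    (ha : a = 1 ∨ a = 2) (hb : b = opp a) (hu : l u = 4) (hv : l v = a) (hw : l w = b)
    (huv : G.Adj u v) (huw : G.Adj u w)
    (hcard : (freeNbrs G l v).card ≤ (freeNbrs G l w).card) : GoodBranch G l u := by
  refine ⟨Or.inl hu, ?_⟩
  have hb' : b = 1 ∨ b = 2 := by rcases ha with rfl | rfl <;> simp [hb, opp]
  have hab : a = opp b := by rcases ha with rfl | rfl <;> simp [hb, opp]
  have hpair : (a = 1 ∧ b = 2) ∨ (a = 2 ∧ b = 1) := by
    rcases ha with rfl | rfl <;> simp [hb, opp]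
  have hdv : Dec l v := by unfold Dec; rw [hv]; exact ha
  have hdw : Dec l w := by unfold Dec; rw [hw]; exact hb'
  have huv' : u ∈ freeNbrs G l v := mem_freeNbrs.2 ⟨huv.symm, hu⟩
  have huw' : u ∈ freeNbrs G l w := mem_freeNbrs.2 ⟨huw.symm, hu⟩
  have cv := hl.two_le_card_freeNbrs hcl hdv (hl.oppNbrs_eq_empty hcl hdv huv')
  have cw := hl.two_le_card_freeNbrs hcl hdw (hl.oppNbrs_eq_empty hcl hdw huw')
  rw [totalWt_free hu ha hb]
  have ea := ext_child (G := G) hu ha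
  have eb := ext_child (G := G) hu hb'
  have ka := closed_child (G := G) (l := l) u a
  have kb := closed_child (G := G) (l := l) u b
  have ua := child_apply (G := G) (l := l) (u := u) ha
  have ub := child_apply (G := G) (l := l) (u := u) hb'
  have childWt3 : ∀ c, (¬ Conf G (child G l u c) → 3 ≤ (newDec l (child G l u c)).card) →
      childWt G l u c ≤ 17 := fun c h => childWt_le h
  have hWa : childWt G l u a ≤ 27 := childWt_le_wt_one
  have hWb : childWt G l u b ≤ 27 := childWt_le_wt_one
  have hca : Conf G (child G l u a) → childWt G l u a = 0 := fun h => by simp [childWt, h]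
  have hcb : Conf G (child G l u b) → childWt G l u b = 0 := fun h => by simp [childWt, h]
  by_cases na : Conf G (child G l u a)
  · have := hca na
    left; omega
  by_cases nb : Conf G (child G l u b)
  · have := hcb nb
    left; omega
  set Ta := child G l u a
  set Tb := child G l u b
  have va : Ta v = a := by rw [ea.eq_of_ne hdv.ne_four, hv]
  have vb : Tb v = a := by rw [eb.eq_of_ne hdv.ne_four, hv]
  have wa : Ta w = b := by rw [ea.eq_of_ne hdw.ne_four, hw]
  have wb : Tb w = b := by rw [eb.eq_of_ne hdw.ne_four, hw]
  -- Whichever side `u` takes, it becomes the partner of `v` or of `w`, whose free neighbours are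
  -- then all decided.
  have sub1 : freeNbrs G l v ⊆ newDec l Tb :=
    freeNbrs_subset_newDec kb nb (eb.dec hdv) huv.symm (by rw [ub, vb, hb])
  have sub2 : freeNbrs G l w ⊆ newDec l Ta :=
    freeNbrs_subset_newDec ka na (ea.dec hdw) huw.symm (by rw [ua, wa, hab])
  have nua : Ta u ≠ 4 := by rw [ua]; rcases ha with rfl | rfl <;> simp
  have nub : Tb u ≠ 4 := by rw [ub]; rcases hb' with h | h <;> simp [h]
  have c1 := Finset.card_le_card sub1
  have c2 := Finset.card_le_card sub2
  -- Three decided vertices in both branches are exactly affordable: `17 + 17 = 34`.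
  by_cases hv3 : 3 ≤ (freeNbrs G l v).card
  · left
    have h1 := childWt3 a fun _ => (by omega : 3 ≤ (newDec l Ta).card)
    have h2 := childWt3 b fun _ => (by omega : 3 ≤ (newDec l Tb).card)
    omega
  -- From here on `v` has exactly two free neighbours. If `u` joins the side of `v`, the other one
  -- must be the partner of `v`, so both are decided in this branch as well.
  have sub3 : freeNbrs G l v ⊆ newDec l Ta :=
    freeNbrs_subset_of_card_two ea ka na (ea.dec hdv) huv' nua (by omega)
  by_cases hss : freeNbrs G l v ⊆ freeNbrs G l w
  · obtain ⟨u', hu', huu'⟩ := Finset.exists_mem_ne (by omega : 1 < (freeNbrs G l v).card) u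
    -- In `Tb` the partner of `v` is `u`, so the second neighbour `u'` joins the side of `v` and
    -- thereby becomes the partner of `w`.
    have sub4 : freeNbrs G l w ⊆ newDec l Tb := by
      have hn := mem_freeNbrs.1 hu'
      have hn' := mem_freeNbrs.1 (hss hu')
      have := kb.ne_of_matched nb (eb.dec hdv) huv.symm (by rw [ub, vb, hb]) hn.1 huu'
      have hd := eb.dec_of hn.2 this.1
      refine freeNbrs_subset_newDec kb nb (eb.dec hdw) hn'.1 ?_
      have h2 := this.2
      rw [vb, ← hb] at h2
      rw [wb, ← hab]
      rcases hd with h | h <;> omega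
    have c4 := Finset.card_le_card sub4
    by_cases hw3 : 3 ≤ (freeNbrs G l w).card
    · left
      have h1 := childWt3 a fun _ => (by omega : 3 ≤ (newDec l Ta).card)
      have h2 := childWt3 b fun _ => (by omega : 3 ≤ (newDec l Tb).card)
      omega
    -- The hard configuration: `v` and `w` share both free neighbours. A branch that decides only
    -- these two vertices is autark and can stand alone; otherwise both branches decide three.
    have hvw : freeNbrs G l v = freeNbrs G l w := Finset.eq_of_subset_of_card_le hss (by omega)
    have autark : ∀ T : Fin n → ℕ, Ext l T → Closed G T → ¬ Conf G T →
        freeNbrs G l v ⊆ newDec l T → (newDec l T).card ≤ 2 → Autark G l T :=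
      fun T eT kT nT hsub hle => autark_of_common hl hdv hdw (by rw [hv, hw, hb]) hvw eT kT nT hsub
        (by omega)
    by_cases h3a : 3 ≤ (newDec l Ta).card
    · by_cases h3b : 3 ≤ (newDec l Tb).card
      · left
        have h1 := childWt3 a fun _ => h3a
        have h2 := childWt3 b fun _ => h3b
        omega
      · exact Or.inr ⟨u, b, ⟨hu, Or.inl ⟨rfl, hb'⟩⟩, nb,
          Or.inr (autark Tb eb kb nb sub1 (by omega))⟩
    · exact Or.inr ⟨u, a, ⟨hu, Or.inl ⟨rfl, ha⟩⟩, na,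
        Or.inr (autark Ta ea ka na sub3 (by omega))⟩
  · left
    obtain ⟨u', hu', hnot⟩ := Finset.not_subset.1 hss
    have hu'w : insert u' (freeNbrs G l w) ⊆ newDec l Ta :=
      Finset.insert_subset (sub3 hu') sub2
    have c5 := Finset.card_le_card hu'w
    rw [Finset.card_insert_of_notMem hnot] at c5
    -- The additional vertex `u'` raises one gain to four, and `13 + 21 = 34`. If `w` also has only
    -- two free neighbours, the situation is symmetric and both gains are at least three.
    by_cases hw3 : 3 ≤ (freeNbrs G l w).card
    · have h1 : childWt G l u a ≤ wt 4 := childWt_le fun _ => (by omega : 4 ≤ (newDec l Ta).card)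
      have h2 : childWt G l u b ≤ wt 2 := childWt_le fun _ => (by omega : 2 ≤ (newDec l Tb).card)
      simp only [wt] at h1 h2
      norm_num at h1 h2
      omega
    · have sub4 : freeNbrs G l w ⊆ newDec l Tb :=
        freeNbrs_subset_of_card_two eb kb nb (eb.dec hdw) huw' nub (by omega)
      have hss' : ¬ freeNbrs G l w ⊆ freeNbrs G l v := fun h =>
        hss (Finset.eq_of_subset_of_card_le h (by omega)).ge
      obtain ⟨z, hz, hznot⟩ := Finset.not_subset.1 hss'
      have c6 := Finset.card_le_card (Finset.insert_subset (sub4 hz) sub1)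
      rw [Finset.card_insert_of_notMem hznot] at c6
      have h1 := childWt3 a fun _ => (by omega : 3 ≤ (newDec l Ta).card)
      have h2 := childWt3 b fun _ => (by omega : 3 ≤ (newDec l Tb).card)
      omega

/-- As long as there is a free vertex, there is a cheap branching. -/
theorem exists_goodBranch (hl : Closed G l ∨ NoActive G l) (hcl : ¬ Conf G l)
    (hfree : ∃ v, l v = 4) : ∃ x, GoodBranch G l x := by
  by_cases hna : NoActive G l
  · obtain ⟨u, hu⟩ := hfree
    refine ⟨u, Or.inl hu, ?_⟩
    by_cases h1 : Conf G (child G l u 1)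
    · left
      have e : childWt G l u 1 = 0 := by simp [childWt, h1]
      have h : childWt G l u 2 ≤ 27 := childWt_le_wt_one
      simp only [totalWt, hu, if_true]
      omega
    -- With all decided vertices matched, the two sides are interchangeable on the free vertices, so
    -- label `1` may be chosen.
    · exact Or.inr ⟨u, 1, ⟨hu, Or.inl ⟨rfl, Or.inl rfl⟩⟩, h1, Or.inl hna⟩
  replace hl := hl.resolve_right hna
  by_cases htwo : ∃ u v w, l u = 4 ∧ l v = 1 ∧ l w = 2 ∧ G.Adj u v ∧ G.Adj u w
  · obtain ⟨u, v, w, hu, hv, hw, huv, huw⟩ := htwo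
    rcases le_total (freeNbrs G l v).card (freeNbrs G l w).card with h | h
    · exact ⟨u, goodBranch_of_two hl hcl (.inl rfl) rfl hu hv hw huv huw h⟩
    · exact ⟨u, goodBranch_of_two hl hcl (.inr rfl) rfl hu hw hv huw huv h⟩
  unfold NoActive at hna
  push Not at hna
  obtain ⟨v, hdv, hv0⟩ := hna
  set a := l v with hav
  have ha : a = 1 ∨ a = 2 := hdv
  have hb' := hdv.opp
  rw [← hav] at hb'
  have c2 := hl.two_le_card_freeNbrs hcl hdv hv0
  set d := (freeNbrs G l v).card
  have notwo : ∀ u z, l u = 4 → G.Adj u v → G.Adj u z → l z ≠ opp a := by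
    intro u z hu huv huz hz
    rcases ha with e | e
    · exact htwo ⟨u, v, z, hu, by omega, by rw [hz, e]; rfl, huv, huz⟩
    · exact htwo ⟨u, z, v, hu, by rw [hz, e]; rfl, by omega, huz, huv⟩
  have hnbr : ∀ u ∈ freeNbrs G l v, 1 ≤ (freeNbrs G l u).card := by
    intro u hu
    rw [mem_freeNbrs] at hu
    refine Finset.card_pos.2 ?_
    by_contra hempty
    rw [Finset.not_nonempty_iff_eq_empty] at hempty
    -- On the side of `v`, the vertex `u` could find no partner: `notwo` excludes decided ones, and
    -- `hempty` excludes free ones.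
    refine hl u hu.2 a ha ⟨u, by simpa [Dec] using ha, Or.inr ⟨?_, ?_⟩⟩
    · refine Finset.eq_empty_of_forall_notMem fun z hz => ?_
      rw [mem_oppNbrs] at hz
      have hzu : z ≠ u := hz.1.ne'
      exact notwo u z hu.2 hu.1.symm hz.1 (by simpa [hzu] using hz.2)
    · refine Finset.eq_empty_of_forall_notMem fun z hz => ?_
      rw [mem_freeNbrs] at hz
      have hzu : z ≠ u := hz.1.ne'
      have : z ∈ freeNbrs G l u := mem_freeNbrs.2 ⟨hz.1, by simpa [hzu] using hz.2⟩
      simp [hempty] at this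
  have gain : ∀ u ∈ freeNbrs G l v, ¬ Conf G (child G l u (opp a)) →
      d + (freeNbrs G l u).card ≤ (newDec l (child G l u (opp a))).card := by
    intro u hu nT
    rw [mem_freeNbrs] at hu
    have eT := ext_child (G := G) hu.2 hb'
    have kT := closed_child (G := G) (l := l) u (opp a)
    have Tu := child_apply (G := G) (l := l) (u := u) hb'
    set T := child G l u (opp a)
    have Tv : T v = a := eT.eq_of_ne hdv.ne_four
    have hdu : Dec T u := by unfold Dec; rw [Tu]; exact hb'
    have hoo : opp (opp a) = a := by rcases ha with e | e <;> simp [e, opp]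
    have s1 : freeNbrs G l v ⊆ newDec l T :=
      freeNbrs_subset_newDec kT nT (eT.dec hdv) hu.1 (by rw [Tu, Tv])
    have s2 : freeNbrs G l u ⊆ newDec l T :=
      freeNbrs_subset_newDec kT nT hdu hu.1.symm (by rw [Tu, Tv, hoo])
    -- Once `u` is the partner of `v`, a common free neighbour would have to be on the side of `v`
    -- and on the side of `u`. So the gains at both ends of the edge add up.
    have hdisj : Disjoint (freeNbrs G l v) (freeNbrs G l u) := by
      rw [Finset.disjoint_left]
      intro y hy hy'
      rw [mem_freeNbrs] at hy hy'
      have hyu : y ≠ u := hy'.1.ne'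
      have hyv : y ≠ v := hy.1.ne'
      have h1 := kT.ne_of_matched nT (eT.dec hdv) hu.1 (by rw [Tu, Tv]) hy.1 hyu
      have h2 := kT.ne_of_matched nT hdu hu.1.symm (by rw [Tu, Tv, hoo]) hy'.1 hyv
      have hdy := eT.dec_of hy.2 h1.1
      have h3 := h1.2
      have h4 := h2.2
      rw [Tv] at h3
      rw [Tu, hoo] at h4
      rcases hdy with e | e <;> rcases ha with e' | e' <;> simp [e, e', opp] at h3 h4
    rw [← Finset.card_union_of_disjoint hdisj]
    exact Finset.card_le_card (Finset.union_subset s1 s2)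
  have dway : ∀ k, (∀ u ∈ freeNbrs G l v, k ≤ d + (freeNbrs G l u).card) → d * wt k ≤ 34 →
      GoodBranch G l v := by
    intro k hk h34
    refine ⟨Or.inr ⟨hdv, Finset.card_pos.1 (by omega)⟩, Or.inl ?_⟩
    rw [totalWt, if_neg hdv.ne_four, if_pos hdv]
    calc _ ≤ ∑ _u ∈ freeNbrs G l v, wt k :=
          Finset.sum_le_sum fun u hu => childWt_le fun h => (hk u hu).trans (gain u hu h)
      _ = d * wt k := by simp [d]
      _ ≤ 34 := h34
  by_cases hd2 : d = 2
  -- Two choices of the partner of `v`, with gain at least `2 + 1` each: `2 * 17 = 34`.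
  · exact ⟨v, dway 3 (fun u hu => by have := hnbr u hu; omega) (by rw [hd2]; decide)⟩
  by_cases hone : ∃ u ∈ freeNbrs G l v, (freeNbrs G l u).card = 1
  · obtain ⟨u, hu, h1⟩ := hone
    have hu' := mem_freeNbrs.1 hu
    refine ⟨u, Or.inl hu'.2, Or.inl ?_⟩
    rw [totalWt_free hu'.2 ha rfl]
    have hWb : childWt G l u (opp a) ≤ wt 4 := childWt_le fun h => by
      have := gain u hu h
      omega
    have hWa : childWt G l u a ≤ wt 2 := childWt_le fun nT => by
      have eT := ext_child (G := G) hu'.2 ha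
      have kT := closed_child (G := G) (l := l) u a
      have Tu := child_apply (G := G) (l := l) (u := u) ha
      have hmem := mem_newDec_child (G := G) hu'.2 ha
      set T := child G l u a
      have hdu : Dec T u := by unfold Dec; rw [Tu]; exact ha
      -- With a single free neighbour, `u` cannot remain unmatched in the closed labeling. Its
      -- partner was free before by `notwo`, so this branch decides two vertices, while the other
      -- one decides at least `3 + 1`; and `21 + 13 = 34`.
      have : ∃ z, G.Adj u z ∧ T z = opp (T u) := by
        by_contra hne
        have h0 : oppNbrs G T u = ∅ := Finset.eq_empty_of_forall_notMem fun z hz =>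
          hne ⟨z, mem_oppNbrs.1 hz⟩
        have h2 := kT.two_le_card_freeNbrs nT hdu h0
        have : freeNbrs G T u ⊆ freeNbrs G l u := fun y hy => by
          rw [mem_freeNbrs] at hy ⊢
          exact ⟨hy.1, eT.eq_four hy.2⟩
        have := Finset.card_le_card this
        omega
      obtain ⟨z, hz, hz'⟩ := this
      rw [Tu] at hz'
      have hz4 : T z ≠ 4 := by rcases hb' with e | e <;> simp [hz', e]
      have lz : l z = 4 := by
        by_contra hne
        exact notwo u z hu'.2 hu'.1.symm hz (by rw [← hz', eT.eq_of_ne hne])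
      exact Finset.one_lt_card.2 ⟨u, hmem, z, mem_newDec.2 ⟨lz, hz4⟩, hz.ne⟩
    simp only [wt] at hWa hWb
    norm_num at hWa hWb
    omega
  have he : ∀ u ∈ freeNbrs G l v, 2 ≤ (freeNbrs G l u).card := by
    intro u hu
    have := hnbr u hu
    have : (freeNbrs G l u).card ≠ 1 := fun h => hone ⟨u, hu, h⟩
    omega
  -- Choosing the partner of `v` costs `3 * 11 = 33` for `d = 3` and `4 * 8 = 32` for `d = 4`.
  by_cases hd3 : d = 3
  · exact ⟨v, dway 5 (fun u hu => by have := he u hu; omega) (by rw [hd3]; decide)⟩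
  by_cases hd4 : d = 4
  · exact ⟨v, dway 6 (fun u hu => by have := he u hu; omega) (by rw [hd4]; decide)⟩
  -- For `d ≥ 5` it is better to ask whether `u` is the partner of `v`: a yes decides at least seven
  -- vertices, and `7 + 27 = 34` leaves room for any gain on a no.
  obtain ⟨u, hu⟩ := Finset.card_pos.1 (by omega : 0 < d)
  have hu' := mem_freeNbrs.1 hu
  refine ⟨u, Or.inl hu'.2, Or.inl ?_⟩
  rw [totalWt_free hu'.2 ha rfl]
  have hWb : childWt G l u (opp a) ≤ wt 7 := childWt_le fun h => by
    have := gain u hu h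
    have := he u hu
    omega
  have hWa : childWt G l u a ≤ 27 := childWt_le_wt_one
  simp only [wt] at hWb
  norm_num at hWb
  omega

end

end PMS

namespace PMS

open Finset

section

variable {V : Type*} [Fintype V] [DecidableEq V] {G : SimpleGraph V} {l T S : V → ℕ}

/-! ### Soundness of the branching -/

/-- The constraint at `x` only depends on the labels of `x` and its neighbours. -/
theorem conf_of_agree {S' : V → ℕ} {x : V} (hx : Dec S' x)
    (h : 2 ≤ (oppNbrs G S' x).card ∨ (oppNbrs G S' x = ∅ ∧ freeNbrs G S' x = ∅))
    (e : ∀ y, (y = x ∨ G.Adj x y) → S' y = S y) : Conf G S := by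
  have ex := e x (.inl rfl)
  have e1 : oppNbrs G S' x = oppNbrs G S x := by
    ext y
    simp only [mem_oppNbrs]
    exact and_congr_right fun h => by rw [e y (.inr h), ex]
  have e2 : freeNbrs G S' x = freeNbrs G S x := by
    ext y
    simp only [mem_freeNbrs]
    exact and_congr_right fun h => by rw [e y (.inr h)]
  rw [e1, e2] at h
  unfold Dec at hx
  rw [ex] at hx
  exact ⟨x, hx, h⟩

theorem IsSol.of_four (hS : IsSol G S) (h : Ext l S) {v : V} (hv : l v = 4) :
    S v = 1 ∨ S v = 2 := by
  rcases h v with e | e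
  · have := hS.1 v
    omega
  · exact e.2

theorem IsSol.exists_opp (hS : IsSol G S) {x : V} (hx : Dec S x) :
    ∃ y, G.Adj x y ∧ S y = opp (S x) := by
  by_contra hne
  refine hS.2 ⟨x, hx, Or.inr ⟨?_, ?_⟩⟩
  · exact Finset.eq_empty_of_forall_notMem fun y hy => hne ⟨y, mem_oppNbrs.1 hy⟩
  · refine Finset.eq_empty_of_forall_notMem fun y hy => ?_
    have := (mem_freeNbrs.1 hy).2
    have := hS.1 y
    omega

/-- Overwrite `S` by `T` wherever `T` is not free. A vertex of the new pair that is near a newly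
decided one is not free in `T`: its newly decided neighbour is matched by autarky and has no free
neighbours. Being decided, it is matched by autarky too, so everything it sees comes from `T`. Every
other vertex sees only labels of `S`. -/
theorem IsSol.exchange (hS : IsSol G S) (hlS : Ext l S) (hlT : Ext l T) (hT : Closed G T)
    (hc : ¬ Conf G T) (haut : Autark G l T) : ∃ S', IsSol G S' ∧ Ext T S' ∧ Ext l S' := by
  set S' : V → ℕ := fun v => if T v = 4 then S v else T v with hS'
  have s4 : ∀ v, T v = 4 → S' v = S v := fun v h => by simp [hS', h]
  have sT : ∀ v, T v ≠ 4 → S' v = T v := fun v h => by simp [hS', h]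
  have hTS : Ext T S' := by
    intro v
    by_cases h : T v = 4
    · exact Or.inr ⟨h, by rw [s4 v h]; exact hS.of_four hlS (hlT.eq_four h)⟩
    · exact Or.inl (sT v h)
  refine ⟨S', ⟨fun v => ?_, ?_⟩, hTS, hlT.trans hTS⟩
  · by_cases h : T v = 4
    · rw [s4 v h]; exact hS.1 v
    · rw [sT v h]
      by_cases h' : l v = 4
      · have := hlT.dec_of h' h
        unfold Dec at this
        omega
      · rw [hlT.eq_of_ne h', ← hlS.eq_of_ne h']
        exact hS.1 v
  · rintro ⟨x, hx, hconf⟩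
    by_cases hnear : ∃ y, (y = x ∨ G.Adj x y) ∧ (l y = 4 ∧ T y ≠ 4)
    · obtain ⟨y, hxy, hy⟩ := hnear
      by_cases hx4 : T x = 4
      · have hne : y ≠ x := by rintro rfl; exact hy.2 hx4
        have hadj : G.Adj x y := hxy.resolve_left hne
        have hdy : Dec T y := hlT.dec_of hy.1 hy.2
        have h1 : oppNbrs G T y ≠ ∅ := fun h => haut y hdy h y (.inl rfl) hy
        exact h1 (hT.oppNbrs_eq_empty hc hdy (mem_freeNbrs.2 ⟨hadj.symm, hx4⟩))
      · have ex : S' x = T x := sT x hx4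
        have hdx : Dec T x := by unfold Dec at hx ⊢; rwa [ex] at hx
        have h1 : oppNbrs G T x ≠ ∅ := fun h => haut x hdx h y hxy hy
        have hfree : freeNbrs G T x = ∅ := by
          by_contra h
          obtain ⟨z, hz⟩ := Finset.nonempty_iff_ne_empty.2 h
          exact h1 (hT.oppNbrs_eq_empty hc hdx hz)
        refine hc (conf_of_agree hx hconf fun z hz => sT z ?_)
        rcases hz with rfl | hz
        · exact hx4
        · intro h
          have : z ∈ freeNbrs G T x := mem_freeNbrs.2 ⟨hz, h⟩
          simp [hfree] at this
    · refine hS.2 (conf_of_agree hx hconf fun y hy => ?_)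
      by_cases h : T y = 4
      · exact s4 y h
      · have h' : l y ≠ 4 := fun e => hnear ⟨y, hy, e, h⟩
        rw [sT y h, hlT.eq_of_ne h', hlS.eq_of_ne h']

/-- No edge joins a free vertex to a decided one, so the free vertices see only each other and
vertices outside the pair. Swapping their two sides preserves all constraints. -/
theorem IsSol.flip (hS : IsSol G S) (hlS : Ext l S) (hfree : ∀ x, Dec l x → freeNbrs G l x = ∅) :
    IsSol G (fun v => if l v = 4 then opp (S v) else S v) := by
  have key : ∀ x y, l x = 4 → G.Adj x y → l y ≠ 4 → S y = 3 := by
    intro x y hx hxy hy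
    have e := hlS.eq_of_ne hy
    have h1 := hS.1 y
    have : ¬ Dec l y := fun h => by
      have hx : x ∈ freeNbrs G l y := mem_freeNbrs.2 ⟨hxy.symm, hx⟩
      simp [hfree y h] at hx
    unfold Dec at this
    omega
  refine ⟨fun v => ?_, ?_⟩
  · simp only
    split_ifs with h
    · rcases hS.of_four hlS h with e | e <;> simp [e, opp]
    · exact hS.1 v
  · rintro ⟨x, hx, hconf⟩
    by_cases hx4 : l x = 4
    · have hSx := hS.of_four hlS hx4
      refine hS.2 ⟨x, hSx, ?_⟩
      have e1 : oppNbrs G (fun v => if l v = 4 then opp (S v) else S v) x = oppNbrs G S x := by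
        ext y
        simp only [mem_oppNbrs, hx4, if_true]
        refine and_congr_right fun hxy => ?_
        split_ifs with hy
        · rcases hSx with e | e <;> rcases hS.of_four hlS hy with e' | e' <;> simp [e, e', opp]
        · rw [key x y hx4 hxy hy]
          rcases hSx with e | e <;> simp [e, opp]
      have e2 : freeNbrs G S x = ∅ := by
        refine Finset.eq_empty_of_forall_notMem fun y hy => ?_
        have := (mem_freeNbrs.1 hy).2
        have := hS.1 y
        omega
      rw [e1] at hconf
      exact hconf.imp_right fun h => ⟨h.1, e2⟩
    · have hdx : Dec l x := by
        unfold Dec at hx ⊢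
        simpa [hx4, hlS.eq_of_ne hx4] using hx
      refine hS.2 (conf_of_agree hx hconf fun y hy => ?_)
      have : l y ≠ 4 := by
        rcases hy with rfl | hy
        · exact hx4
        · intro h
          have : y ∈ freeNbrs G l x := mem_freeNbrs.2 ⟨hy, h⟩
          simp [hfree x hdx] at this
      simp [this]

/-- What is known about a labeling in the second phase of the search. -/
def Entry (G : SimpleGraph V) (l : V → ℕ) : Prop :=
  (∀ v, l v = 1 ∨ l v = 2 ∨ l v = 3 ∨ l v = 4) ∧ ¬ Conf G l ∧ (Closed G l ∨ ∀ v, ¬ Dec l v)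

theorem Entry.freeNbrs_eq_empty (h : Entry G l) {x : V} (hx : Dec l x)
    (hx' : oppNbrs G l x ≠ ∅) : freeNbrs G l x = ∅ := by
  by_contra hne
  obtain ⟨y, hy⟩ := Finset.nonempty_iff_ne_empty.2 hne
  rcases h.2.2 with hc | hd
  · exact hx' (hc.oppNbrs_eq_empty h.2.1 hx hy)
  · exact hd x hx

theorem Entry.labels_of_ext (h : Entry G l) (hT : Ext l T) (v : V) :
    T v = 1 ∨ T v = 2 ∨ T v = 3 ∨ T v = 4 := by
  have := h.1 v
  rcases hT v with e | e <;> omega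

theorem Ext.card_newDec (h : Ext l T) : numLab T 4 + (newDec l T).card = numLab l 4 := by
  unfold numLab newDec
  rw [← Finset.card_union_of_disjoint]
  · congr 1
    ext v
    simp only [mem_union, mem_filter, mem_univ, true_and]
    constructor
    · rintro (e | e)
      · exact h.eq_four e
      · exact e.1
    · intro e
      by_cases e' : T v = 4
      · exact Or.inl e'
      · exact Or.inr ⟨e, e'⟩
  · rw [Finset.disjoint_left]
    intro v hv hv'
    simp only [mem_filter, mem_univ, true_and] at hv hv'
    exact hv'.2 hv

end

variable {n : ℕ} {G : SimpleGraph (Fin n)} {l S : Fin n → ℕ}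

theorem child_sound {u : Fin n} (hS : IsSol G S) (hlS : Ext l S) {c : ℕ} (hc : S u = c) :
    Ext (child G l u c) S :=
  clo_sound hS (hlS.update hc)

theorem IsOption.label {x u : Fin n} {c : ℕ} (h : IsOption G l x u c) : c = 1 ∨ c = 2 := by
  rcases h.2 with h | ⟨hd, -, rfl⟩
  · exact h.2
  · exact hd.opp

/-- The branches are exhaustive: a decided vertex with a free neighbour is unmatched, so its partner
in the solution is one of its free neighbours. -/
theorem Entry.exists_option (hl : Entry G l) (hS : IsSol G S) (hlS : Ext l S) {x : Fin n}
    (hx : ∃ u c, IsOption G l x u c) : ∃ u c, IsOption G l x u c ∧ Ext (child G l u c) S := by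
  obtain ⟨u, c, hu, ⟨rfl, -⟩ | ⟨hd, hadj, -⟩⟩ := hx
  · exact ⟨u, S u, ⟨hu, Or.inl ⟨rfl, hS.of_four hlS hu⟩⟩, child_sound hS hlS rfl⟩
  · have h0 : oppNbrs G l x = ∅ := by
      by_contra h
      have := hl.freeNbrs_eq_empty hd h
      have hu' : u ∈ freeNbrs G l x := mem_freeNbrs.2 ⟨hadj, hu⟩
      simp [this] at hu'
    have ex : S x = l x := hlS.eq_of_ne hd.ne_four
    obtain ⟨y, hy, hy'⟩ := hS.exists_opp (hlS.dec hd)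
    rw [ex] at hy'
    have hly : l y = 4 := by
      by_contra h
      have : y ∈ oppNbrs G l x := mem_oppNbrs.2 ⟨hy, by rw [← hlS.eq_of_ne h]; exact hy'⟩
      simp [h0] at this
    exact ⟨y, opp (l x), ⟨hly, Or.inr ⟨hd, hy, rfl⟩⟩, child_sound hS hlS hy'⟩

/-- Why one branch may represent all. Without active vertices, either the solution or its flip gives
`u` the label `c`; for an autark branch the solution is grafted onto it. -/
theorem Entry.exchange (hl : Entry G l) (hS : IsSol G S) (hlS : Ext l S) {x u : Fin n} {c : ℕ}
    (ho : IsOption G l x u c) (hc : ¬ Conf G (child G l u c))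
    (h : NoActive G l ∨ Autark G l (child G l u c)) :
    ∃ S', IsSol G S' ∧ Ext (child G l u c) S' ∧ Ext l S' := by
  rcases h with h | h
  · by_cases e : S u = c
    · exact ⟨S, hS, child_sound hS hlS e, hlS⟩
    · have hfree : ∀ x, Dec l x → freeNbrs G l x = ∅ := fun x hx => hl.freeNbrs_eq_empty hx (h x hx)
      have hlS' : Ext l (fun v => if l v = 4 then opp (S v) else S v) := by
        intro v
        by_cases hv : l v = 4
        · right
          refine ⟨hv, ?_⟩
          rcases hS.of_four hlS hv with e | e <;> simp [hv, e, opp]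
        · left
          simp [hv, hlS.eq_of_ne hv]
      refine ⟨_, hS.flip hlS hfree, child_sound (hS.flip hlS hfree) hlS' ?_, hlS'⟩
      have hSu := hS.of_four hlS ho.1
      have hcc := ho.label
      simp only [ho.1, if_true]
      rcases hSu with e' | e' <;> rcases hcc with rfl | rfl <;> simp_all [opp]
  · exact hS.exchange hlS (ext_child ho.1 ho.label) (closed_child u c) hc h

/-! ### Admissible lists of branches. -/

/-- The list `L` is an admissible list of branches for `l`. -/
def Expands (G : SimpleGraph (Fin n)) (l : Fin n → ℕ) (L : List (Fin n → ℕ)) : Prop :=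
  (∀ T ∈ L, Ext l T ∧ Closed G T ∧ ¬ Conf G T ∧ 0 < (newDec l T).card) ∧
  (∀ S, IsSol G S → Ext l S → ∃ T ∈ L, ∃ S', IsSol G S' ∧ Ext T S' ∧ Ext l S') ∧
  (L.map fun T => wt (newDec l T).card).sum ≤ 34

theorem expands_single (hl : Entry G l) {x u : Fin n} {c : ℕ} (ho : IsOption G l x u c)
    (hc : ¬ Conf G (child G l u c)) (h : NoActive G l ∨ Autark G l (child G l u c)) :
    Expands G l [child G l u c] := by
  refine ⟨?_, fun S hS hlS => ⟨_, by simp, hl.exchange hS hlS ho hc h⟩, ?_⟩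
  · simp only [List.mem_singleton, forall_eq]
    exact ⟨ext_child ho.1 ho.label, closed_child u c, hc,
      Finset.card_pos.2 ⟨u, mem_newDec_child ho.1 ho.label⟩⟩
  · have : wt (newDec l (child G l u c)).card ≤ 27 := wt_antitone (Nat.zero_le _)
    simp only [List.map_cons, List.map_nil, List.sum_cons, List.sum_nil]
    omega

open Classical in
variable (G l) in
/-- The branches on `x` that concern the vertex `u`. -/
noncomputable def optsAt (x u : Fin n) : List (Fin n × ℕ) :=
  if l u = 4 then
    if l x = 4 then if u = x then [(u, 1), (u, 2)] else []
    else if Dec l x then if G.Adj x u then [(u, opp (l x))] else [] else []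
  else []

variable (G l) in
/-- The branches on `x` that concern the vertices below `i`. -/
noncomputable def optsTo (x : Fin n) : ℕ → List (Fin n × ℕ)
  | 0 => []
  | i + 1 => optsTo x i ++ if h : i < n then optsAt G l x ⟨i, h⟩ else []

theorem mem_optsAt {x u : Fin n} {o : Fin n × ℕ} :
    o ∈ optsAt G l x u ↔ o.1 = u ∧ IsOption G l x o.1 o.2 := by
  obtain ⟨w, c⟩ := o
  have h4 : ∀ y, Dec l y → l y ≠ 4 := fun y h => h.ne_four
  unfold optsAt IsOption
  split_ifs with h1 h2 h3 h3 h5 <;> simp only [List.mem_cons, Prod.mk.injEq, List.not_mem_nil,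
    or_false, false_iff, not_and] <;> grind

theorem mem_optsTo {x : Fin n} {i : ℕ} {o : Fin n × ℕ} :
    o ∈ optsTo G l x i ↔ o.1.1 < i ∧ IsOption G l x o.1 o.2 := by
  induction i with
  | zero => simp [optsTo]
  | succ i ih =>
    rw [optsTo, List.mem_append, ih]
    split_ifs with h
    · rw [mem_optsAt, Fin.ext_iff]
      simp only
      constructor
      · rintro (h | h)
        · exact ⟨by omega, h.2⟩
        · exact ⟨by omega, h.2⟩
      · rintro ⟨h1, h2⟩
        rcases Nat.lt_succ_iff_lt_or_eq.1 h1 with h1 | h1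
        · exact Or.inl ⟨h1, h2⟩
        · exact Or.inr ⟨h1, h2⟩
    · have := o.1.2
      simp only [List.not_mem_nil, or_false]
      constructor
      · rintro ⟨h1, h2⟩
        exact ⟨by omega, h2⟩
      · rintro ⟨h1, h2⟩
        exact ⟨by omega, h2⟩

/-- Connects the order in which the machine enumerates the branches with the sum used in the
branching analysis. -/
theorem sum_optsTo (x : Fin n) :
    ((optsTo G l x n).map fun o => childWt G l o.1 o.2).sum = totalWt G l x := by
  set f : Fin n → ℕ := fun u => ((optsAt G l x u).map fun o => childWt G l o.1 o.2).sum with hf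
  have h1 : ∀ i, ((optsTo G l x i).map fun o => childWt G l o.1 o.2).sum =
      ∑ j ∈ range i, if h : j < n then f ⟨j, h⟩ else 0 := by
    intro i
    induction i with
    | zero => simp [optsTo]
    | succ i ih =>
      rw [optsTo, List.map_append, List.sum_append, ih, Finset.sum_range_succ]
      congr 1
      split_ifs <;> simp [hf]
  rw [h1, ← Fin.sum_univ_eq_sum_range (fun j => if h : j < n then f ⟨j, h⟩ else 0) n]
  simp only [Fin.is_lt, dite_true, Fin.eta]
  unfold totalWt
  split_ifs with h4 hd
  · rw [Finset.sum_eq_single x]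
    · simp [hf, optsAt, h4]
    · intro u _ hu
      simp [hf, optsAt, h4, hu]
    · simp
  · unfold freeNbrs
    rw [Finset.sum_filter]
    refine Finset.sum_congr rfl fun u _ => ?_
    by_cases hu : l u = 4 <;> by_cases ha : G.Adj x u <;> simp [hf, optsAt, hu, ha, h4, hd]
  · refine Finset.sum_eq_zero fun u _ => ?_
    simp [hf, optsAt, h4, hd]

open Classical in
variable (G l) in
/-- The branches of a list that are not in conflict. -/
noncomputable def children (O : List (Fin n × ℕ)) : List (Fin n → ℕ) :=
  (O.filter fun o => ¬ Conf G (child G l o.1 o.2)).map fun o => child G l o.1 o.2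

theorem mem_children {O : List (Fin n × ℕ)} {T : Fin n → ℕ} :
    T ∈ children G l O ↔ ∃ o ∈ O, ¬ Conf G (child G l o.1 o.2) ∧ child G l o.1 o.2 = T := by
  simp [children, and_assoc]

theorem sum_children (O : List (Fin n × ℕ)) :
    ((children G l O).map fun T => wt (newDec l T).card).sum =
      (O.map fun o => childWt G l o.1 o.2).sum := by
  induction O with
  | nil => simp [children]
  | cons o O ih =>
    rw [List.map_cons, List.sum_cons, ← ih]
    unfold children childWt
    by_cases h : Conf G (child G l o.1 o.2) <;> simp [h]

theorem expands_children (hl : Entry G l) {x : Fin n} (hx : ∃ u c, IsOption G l x u c)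
    (h : ((optsTo G l x n).map fun o => childWt G l o.1 o.2).sum ≤ 34) :
    Expands G l (children G l (optsTo G l x n)) := by
  refine ⟨?_, ?_, by rw [sum_children]; exact h⟩
  · intro T hT
    obtain ⟨o, ho, hc, rfl⟩ := mem_children.1 hT
    have ho := (mem_optsTo.1 ho).2
    exact ⟨ext_child ho.1 ho.label, closed_child _ _, hc,
      Finset.card_pos.2 ⟨o.1, mem_newDec_child ho.1 ho.label⟩⟩
  · intro S hS hlS
    obtain ⟨u, c, ho, hext⟩ := hl.exists_option hS hlS hx
    refine ⟨_, mem_children.2 ⟨(u, c), mem_optsTo.2 ⟨u.2, ho⟩, fun hc => hS.2 (hc.mono hext), rfl⟩,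
      S, hS, hext, hlS⟩

theorem GoodBranch.exists_option {x : Fin n} (h : GoodBranch G l x) :
    ∃ u c, IsOption G l x u c := by
  rcases h.1 with h | ⟨h, y, hy⟩
  · exact ⟨x, 1, h, Or.inl ⟨rfl, Or.inl rfl⟩⟩
  · rw [mem_freeNbrs] at hy
    exact ⟨y, _, hy.2, Or.inr ⟨h, hy.1, rfl⟩⟩

/-! ### Labelings and pairs of perfectly matched sets -/

theorem isSol_of_isPerfectlyMatched {A B : Finset (Fin n)} (h : IsPerfectlyMatched G A B) :
    IsSol G (fun v => if v ∈ A then 1 else if v ∈ B then 2 else 3) := by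
  obtain ⟨hd, hA, hB⟩ := h
  set S : Fin n → ℕ := fun v => if v ∈ A then 1 else if v ∈ B then 2 else 3 with hS
  have s1 : ∀ v, S v = 1 ↔ v ∈ A := fun v => by simp only [hS]; split_ifs <;> simp_all
  have s2 : ∀ v, S v = 2 ↔ v ∈ B := fun v => by
    have h : v ∈ A → v ∉ B := fun h => Finset.disjoint_left.1 hd h
    simp only [hS]; split_ifs <;> simp_all
  refine ⟨fun v => by simp only [hS]; split_ifs <;> simp, ?_⟩
  have key : ∀ x, Dec S x → ∃! y, S y = opp (S x) ∧ G.Adj x y := by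
    rintro x (hx | hx)
    · rw [hx]
      simpa only [opp_one, s2] using hA x ((s1 x).1 hx)
    · rw [hx]
      simpa only [opp_two, s1] using hB x ((s2 x).1 hx)
  rintro ⟨x, hx, h⟩
  obtain ⟨y, ⟨hy, hxy⟩, huniq⟩ := key x hx
  rcases h with h | h
  · obtain ⟨z, hz, w, hw, hzw⟩ := Finset.one_lt_card.1 h
    rw [mem_oppNbrs] at hz hw
    exact hzw ((huniq z ⟨hz.2, hz.1⟩).trans (huniq w ⟨hw.2, hw.1⟩).symm)
  · have : y ∈ oppNbrs G S x := mem_oppNbrs.2 ⟨hxy, hy⟩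
    simp [h.1] at this

theorem IsSol.isPerfectlyMatched (hS : IsSol G S) :
    IsPerfectlyMatched G (univ.filter fun v => S v = 1) (univ.filter fun v => S v = 2) := by
  have key : ∀ x, Dec S x → ∃! y, S y = opp (S x) ∧ G.Adj x y := by
    intro x hx
    obtain ⟨y, hy, hy'⟩ := hS.exists_opp hx
    refine ⟨y, ⟨hy', hy⟩, fun z hz => ?_⟩
    by_contra hne
    exact hS.2 (conf_of_two hx hz.2 hy hne hz.1 hy')
  refine ⟨?_, ?_, ?_⟩
  · rw [Finset.disjoint_left]
    intro v hv hv'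
    simp only [mem_filter, mem_univ, true_and] at hv hv'
    omega
  · intro a ha
    simp only [mem_filter, mem_univ, true_and] at ha ⊢
    have := key a (.inl ha)
    rwa [ha] at this
  · intro a ha
    simp only [mem_filter, mem_univ, true_and] at ha ⊢
    have := key a (.inr ha)
    rwa [ha] at this

/-- Both sides have the same size, so a large pair has few vertices outside, and solutions with
equally many outside vertices have equal size. -/
theorem IsSol.numLab_add (hS : IsSol G S) : 2 * numLab S 1 + numLab S 3 = n := by
  have h1 : numLab S 1 = numLab S 2 := hS.isPerfectlyMatched.card_eq
  have h2 : numLab S 1 + numLab S 2 + numLab S 3 = n := by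
    have := Finset.card_eq_sum_card_fiberwise (s := univ) (f := S) (t := {1, 2, 3})
      (fun v _ => by
        have := hS.1 v
        simp only [coe_insert, coe_singleton, Set.mem_insert_iff, Set.mem_singleton_iff]
        exact this)
    rw [Finset.sum_insert (by simp), Finset.sum_insert (by simp), Finset.sum_singleton] at this
    simp only [card_univ, Fintype.card_fin] at this
    unfold numLab
    omega
  omega

end PMS

/-! ### The routines of the machine -/

namespace PMS

open Finset RAM RAM.Stmt

/-- Counters of loops are naturally `Nat.count`, while the combinatorial notions are cardinalities
of finsets. -/
theorem count_eq_card {n : ℕ} (P : ℕ → Prop) [DecidablePred P] (Q : Fin n → Prop)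
    [DecidablePred Q] (h : ∀ v : Fin n, P v ↔ Q v) :
    Nat.count P n = (univ.filter Q).card := by
  have h1 : (univ.filter Q).card = ∑ v : Fin n, if P v then 1 else 0 := by
    rw [Finset.card_filter]
    exact Finset.sum_congr rfl fun v _ => by simp [h]
  rw [h1, Fin.sum_univ_eq_sum_range (fun j => if P j then 1 else 0) n, Nat.count_eq_card_filter_range,
    Finset.card_filter]

/-- The labeling that is stored in an array. -/
def lab (n : ℕ) (s : Store) (a : ℕ) : Fin n → ℕ := fun v => s.arr a v

/-- The registers `r₀, …, r₈` hold the number of vertices and some constants, and the array `M₀` holds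
the adjacency matrix. -/
structure Ctx {n : ℕ} (G : SimpleGraph (Fin n)) (s : Store) : Prop where
  reg0 : s.reg 0 = n
  reg1 : s.reg 1 = 1
  reg2 : s.reg 2 = 2
  reg3 : s.reg 3 = 3
  reg4 : s.reg 4 = 4
  reg5 : s.reg 5 = 5
  reg6 : s.reg 6 = 6
  reg7 : s.reg 7 = 34
  reg8 : s.reg 8 = 0
  adj : ∀ x y : Fin n, s.arr 0 (x * n + y) = 1 ↔ G.Adj x y

/-- The structured program does not change the data of `Ctx`. -/
def keeps (S : Stmt) : Bool := (List.range 9).all (fun r => !S.writesReg r) && !S.writesArr 0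

theorem Ctx.of_eq {n : ℕ} {G : SimpleGraph (Fin n)} {s s' : Store} (h : Ctx G s)
    (hr : ∀ r < 9, s'.reg r = s.reg r) (ha : s'.arr 0 = s.arr 0) : Ctx G s' := by
  obtain ⟨h0, h1, h2, h3, h4, h5, h6, h7, h8, h9⟩ := h
  constructor
  all_goals first | rw [hr _ (by norm_num)]; assumption | rw [ha]; assumption

theorem Ctx.eval {n : ℕ} {G : SimpleGraph (Fin n)} {s : Store} (h : Ctx G s) {S : Stmt}
    (hS : keeps S = true) : Ctx G (S.eval s) := by
  simp only [keeps, Bool.and_eq_true, List.all_eq_true, List.mem_range, Bool.not_eq_true'] at hS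
  exact h.of_eq (fun r hr => eval_reg (hS.1 r hr) s) (eval_arr hS.2 s)

theorem lab_eval {n a : ℕ} {S : Stmt} (h : S.writesArr a = false) (s : Store) :
    lab n (S.eval s) a = lab n s a := by
  unfold lab
  rw [eval_arr h]

theorem lab_setReg {n a x v : ℕ} (s : Store) : lab n (s.setReg x v) a = lab n s a := rfl

local notation "rConf" => (12 : ℕ)
local notation "rAct" => (13 : ℕ)
local notation "rNau" => (14 : ℕ)
local notation "rP" => (15 : ℕ)
local notation "rX" => (16 : ℕ)
local notation "rY" => (17 : ℕ)
local notation "rLx" => (18 : ℕ)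
local notation "rLo" => (19 : ℕ)
local notation "rOpp" => (20 : ℕ)
local notation "rFr" => (21 : ℕ)
local notation "rNw" => (22 : ℕ)
local notation "rAd" => (23 : ℕ)
local notation "rL" => (24 : ℕ)
local notation "rLy" => (25 : ℕ)

/-- Without an alternative. -/
def when (b : Test) (P : Stmt) : Stmt := .ite b P .skip

/-! #### Looking for conflicts -/

/-- Count the neighbours of a vertex in array `4` by their labels. -/
def scanRow : Stmt := .loop rY (block [
  .op (.load rAd 0 rP), .op (.inc rP),
  when (.eq rAd 1) (block [
    .op (.load rLy 4 rY), .op (.load rL 3 rY),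
    when (.eq rLy rLo) (.op (.inc rOpp)),
    when (.eq rLy 4) (.op (.inc rFr)),
    when (.eq rL 4) (when (.neq rLy 4) (.op (.inc rNw)))])])

/-- Prepare the examination of vertex `rX`. -/
def scanPre : Stmt := block [
  .op (.load rLx 4 rX), .op (.load rL 3 rX), .op (.const rLo 7),
  when (.eq rLx 1) (.op (.const rLo 2)), when (.eq rLx 2) (.op (.const rLo 1)),
  .op (.const rOpp 0), .op (.const rFr 0), .op (.const rNw 0),
  when (.eq rL 4) (when (.neq rLx 4) (.op (.inc rNw)))]

/-- Evaluate the counts for a vertex. -/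
def scanPost : Stmt :=
  when (.lt rLo 3) (block [
    when (.nlt rOpp 2) (.op (.const rConf 1)),
    when (.eq rOpp 8) (block [
      .op (.const rAct 1),
      when (.eq rFr 8) (.op (.const rConf 1)),
      when (.neq rNw 8) (.op (.const rNau 1))])])

/-- Look for conflicts and for unmatched vertices in array `4`, compared with array `3`. -/
def scan : Stmt := block [
  .op (.const rConf 0), .op (.const rAct 0), .op (.const rNau 0), .op (.const rP 0),
  .loop rX (block [scanPre, scanRow, scanPost])]

/-- The machine cannot multiply, so `rP` is a running pointer into the adjacency matrix; after the
loop it stands at the next row. -/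
theorem scanRow_spec (s : Store) (h1 : s.reg 1 = 1) (h4 : s.reg 4 = 4) :
    (scanRow.eval s).reg rP = s.reg rP + s.reg 0 ∧
    (scanRow.eval s).reg rOpp = s.reg rOpp +
      Nat.count (fun j => s.arr 0 (s.reg rP + j) = 1 ∧ s.arr 4 j = s.reg rLo) (s.reg 0) ∧
    (scanRow.eval s).reg rFr = s.reg rFr +
      Nat.count (fun j => s.arr 0 (s.reg rP + j) = 1 ∧ s.arr 4 j = 4) (s.reg 0) ∧
    (scanRow.eval s).reg rNw = s.reg rNw +
      Nat.count (fun j => s.arr 0 (s.reg rP + j) = 1 ∧ s.arr 3 j = 4 ∧ s.arr 4 j ≠ 4)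
        (s.reg 0) := by
  refine eval_loop_induction (fun i s' => s'.reg rP = s.reg rP + i ∧
    s'.reg rOpp = s.reg rOpp +
      Nat.count (fun j => s.arr 0 (s.reg rP + j) = 1 ∧ s.arr 4 j = s.reg rLo) i ∧
    s'.reg rFr = s.reg rFr +
      Nat.count (fun j => s.arr 0 (s.reg rP + j) = 1 ∧ s.arr 4 j = 4) i ∧
    s'.reg rNw = s.reg rNw +
      Nat.count (fun j => s.arr 0 (s.reg rP + j) = 1 ∧ s.arr 3 j = 4 ∧ s.arr 4 j ≠ 4) i)
    rfl (by simp) ?_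
  rintro i hi s' hr ha hx ⟨e1, e2, e3, e4⟩
  have f1 := hr 1 rfl
  have f4 := hr 4 rfl
  have fl := hr rLo rfl
  have a0 := ha 0 rfl
  have a3 := ha 3 rfl
  have a4 := ha 4 rfl
  have f1' := f1.trans h1
  have f4' := f4.trans h4
  simp only [Nat.count_succ]
  -- Replacing every tested condition by `True` or `False` lets `simp` execute the loop body
  -- symbolically in each case.
  rcases Classical.propComplete (s.arr 0 (s.reg rP + i) = 1) with c1 | c1 <;>
    rcases Classical.propComplete (s.arr 4 i = s.reg rLo) with c2 | c2 <;>
    rcases Classical.propComplete (s.arr 4 i = 4) with c3 | c3 <;>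
    rcases Classical.propComplete (s.arr 3 i = 4) with c4 | c4 <;>
    simp [block, eval, Op.apply, when, Test.Holds, f1', f4', fl, a0, a3, a4, hx, c1, c2, c3, c4,
      e1, e2, e3, e4, add_assoc]

theorem scanPre_spec (s : Store) (h1 : s.reg 1 = 1) (h2 : s.reg 2 = 2) (h4 : s.reg 4 = 4) :
    (scanPre.eval s).reg rLo = opp (s.arr 4 (s.reg rX)) ∧ (scanPre.eval s).reg rOpp = 0 ∧
    (scanPre.eval s).reg rFr = 0 ∧ (scanPre.eval s).reg rNw =
      if s.arr 3 (s.reg rX) = 4 ∧ s.arr 4 (s.reg rX) ≠ 4 then 1 else 0 := by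
  unfold opp
  rcases Classical.propComplete (s.arr 4 (s.reg rX) = 1) with c1 | c1 <;>
    rcases Classical.propComplete (s.arr 4 (s.reg rX) = 2) with c2 | c2 <;>
    rcases Classical.propComplete (s.arr 4 (s.reg rX) = 4) with c3 | c3 <;>
    rcases Classical.propComplete (s.arr 3 (s.reg rX) = 4) with c4 | c4 <;>
    first
      | exfalso; simp only [eq_iff_iff, iff_true, iff_false] at c1 c2 c3; omega
      | simp [scanPre, block, eval, Op.apply, when, Test.Holds, h1, h2, h4, c1, c2, c3, c4]

theorem scanPost_spec (s : Store) (h2 : s.reg 2 = 2) (h3 : s.reg 3 = 3) (h8 : s.reg 8 = 0) :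
    ((scanPost.eval s).reg rConf ≠ 0 ↔ s.reg rConf ≠ 0 ∨
      (s.reg rLo < 3 ∧ (2 ≤ s.reg rOpp ∨ (s.reg rOpp = 0 ∧ s.reg rFr = 0)))) ∧
    ((scanPost.eval s).reg rAct ≠ 0 ↔ s.reg rAct ≠ 0 ∨ (s.reg rLo < 3 ∧ s.reg rOpp = 0)) ∧
    ((scanPost.eval s).reg rNau ≠ 0 ↔ s.reg rNau ≠ 0 ∨
      (s.reg rLo < 3 ∧ s.reg rOpp = 0 ∧ s.reg rNw ≠ 0)) := by
  rw [show 2 ≤ s.reg rOpp ↔ ¬ s.reg rOpp < 2 from not_lt.symm]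
  rcases Classical.propComplete (s.reg rLo < 3) with c1 | c1 <;>
    rcases Classical.propComplete (s.reg rOpp < 2) with c2 | c2 <;>
    rcases Classical.propComplete (s.reg rOpp = 0) with c3 | c3 <;>
    rcases Classical.propComplete (s.reg rFr = 0) with c4 | c4 <;>
    rcases Classical.propComplete (s.reg rNw = 0) with c5 | c5 <;>
    first
      | exfalso; simp only [eq_iff_iff, iff_true, iff_false] at c2 c3; omega
      | simp [scanPost, block, eval, Op.apply, when, Test.Holds, h2, h3, h8, c1, c2, c3, c4, c5,
          -not_lt]

/-- The default value `7` of `opp` is no label and exceeds `2`, so one comparison recognizes decided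
vertices. -/
theorem opp_lt_three {T : ℕ} : opp T < 3 ↔ T = 1 ∨ T = 2 := by
  unfold opp
  split_ifs <;> omega

theorem exists_lt_succ {n i : ℕ} (hi : i < n) (P : Fin n → Prop) :
    (∃ x : Fin n, x.1 < i + 1 ∧ P x) ↔ (∃ x : Fin n, x.1 < i ∧ P x) ∨ P ⟨i, hi⟩ := by
  constructor
  · rintro ⟨x, hx, h⟩
    rcases Nat.lt_succ_iff_lt_or_eq.1 hx with hx | rfl
    · exact Or.inl ⟨x, hx, h⟩
    · exact Or.inr h
  · rintro (⟨x, hx, h⟩ | h)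
    · exact ⟨x, by omega, h⟩
    · exact ⟨_, Nat.lt_succ_self _, h⟩

variable {n : ℕ} {G : SimpleGraph (Fin n)} {s : Store}

theorem scan_spec (h : Ctx G s) :
    ((scan.eval s).reg rConf ≠ 0 ↔ Conf G (lab n s 4)) ∧
    ((scan.eval s).reg rAct ≠ 0 ↔ ¬ NoActive G (lab n s 4)) ∧
    ((scan.eval s).reg rNau ≠ 0 ↔ ¬ Autark G (lab n s 3) (lab n s 4)) := by
  classical
  set T := lab n s 4 with hT
  set l := lab n s 3 with hl
  set s₀ := (((s.setReg rConf 0).setReg rAct 0).setReg rNau 0).setReg rP 0 with hs₀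
  have e0 : s₀.reg 0 = n := by simp [hs₀, h.reg0]
  set new : Fin n → Fin n → Prop := fun x y => (y = x ∨ G.Adj x y) ∧ l y = 4 ∧ T y ≠ 4 with hnew
  have key := eval_loop_induction (s := s₀) (x := rX) (P := block [scanPre, scanRow, scanPost])
    (fun i s' => s'.reg rP = i * n ∧
      (s'.reg rConf ≠ 0 ↔ ∃ x : Fin n, x.1 < i ∧ Dec T x ∧
        (2 ≤ (oppNbrs G T x).card ∨ (oppNbrs G T x = ∅ ∧ freeNbrs G T x = ∅))) ∧
      (s'.reg rAct ≠ 0 ↔ ∃ x : Fin n, x.1 < i ∧ Dec T x ∧ oppNbrs G T x = ∅) ∧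
      (s'.reg rNau ≠ 0 ↔ ∃ x : Fin n, x.1 < i ∧ Dec T x ∧ oppNbrs G T x = ∅ ∧ ∃ y, new x y))
    rfl (by simp [hs₀]) ?_
  · rw [e0] at key
    obtain ⟨-, k1, k2, k3⟩ := key
    change ((_ : Store).reg rConf ≠ 0 ↔ _) at k1
    refine ⟨k1.trans ?_, k2.trans ?_, k3.trans ?_⟩
    · exact ⟨fun ⟨x, _, hx⟩ => ⟨x, hx⟩, fun ⟨x, hx⟩ => ⟨x, x.2, hx⟩⟩
    · unfold NoActive
      push Not
      exact ⟨fun ⟨x, _, hx⟩ => ⟨x, hx⟩, fun ⟨x, hx⟩ => ⟨x, x.2, hx⟩⟩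
    · unfold Autark
      push Not
      exact ⟨fun ⟨x, _, hx, hx', y, hy, hy'⟩ => ⟨x, hx, hx', y, hy, hy'⟩,
        fun ⟨x, hx, hx', y, hy, hy'⟩ => ⟨x, x.2, hx, hx', y, hy, hy'⟩⟩
  · rintro i hi s' hr ha hx ⟨e1, e2, e3, e4⟩
    rw [e0] at hi
    have hc : Ctx G s' := by
      refine h.of_eq (fun r hr' => ?_) (ha 0 rfl)
      rw [hr r (by interval_cases r <;> rfl)]
      interval_cases r <;> simp [hs₀]
    have a3 : s'.arr 3 = s.arr 3 := ha 3 rfl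
    have a4 : s'.arr 4 = s.arr 4 := ha 4 rfl
    obtain ⟨p1, p2, p3, p4⟩ := scanPre_spec s' hc.reg1 hc.reg2 hc.reg4
    have hc1 : Ctx G (scanPre.eval s') := hc.eval rfl
    obtain ⟨q1, q2, q3, q4⟩ := scanRow_spec (scanPre.eval s') hc1.reg1 hc1.reg4
    have hc2 : Ctx G (scanRow.eval (scanPre.eval s')) := hc1.eval rfl
    obtain ⟨r1, r2, r3⟩ := scanPost_spec (scanRow.eval (scanPre.eval s')) hc2.reg2 hc2.reg3 hc2.reg8
    have xi : s'.reg rX = ((⟨i, hi⟩ : Fin n) : ℕ) := hx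
    set x : Fin n := ⟨i, hi⟩ with hxdef
    have pP : (scanPre.eval s').reg rP = x * n := (eval_reg rfl s').trans e1
    have b0 : (scanPre.eval s').arr 0 = s'.arr 0 := eval_arr rfl _
    have b3 : (scanPre.eval s').arr 3 = s.arr 3 := (eval_arr rfl _).trans a3
    have b4 : (scanPre.eval s').arr 4 = s.arr 4 := (eval_arr rfl _).trans a4
    rw [xi] at p1 p4
    have p1' : (scanPre.eval s').reg rLo = opp (T x) := by rw [p1, a4]; rfl
    rw [hc1.reg0, pP, b0, b4, p1', p2, zero_add] at q2
    rw [hc1.reg0, pP, b0, b4, p3, zero_add] at q3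
    rw [hc1.reg0, pP, b0, b3, b4, p4] at q4
    rw [count_eq_card _ (fun y : Fin n => G.Adj x y ∧ T y = opp (T x))
      (fun y => by rw [hc.adj]; rfl)] at q2
    rw [count_eq_card _ (fun y : Fin n => G.Adj x y ∧ T y = 4) (fun y => by rw [hc.adj]; rfl)] at q3
    rw [count_eq_card _ (fun y : Fin n => G.Adj x y ∧ l y = 4 ∧ T y ≠ 4)
      (fun y => by rw [hc.adj]; rfl), a3, a4] at q4
    have f0 : (scanRow.eval (scanPre.eval s')).reg rOpp = (oppNbrs G T x).card := by
      rw [q2]; unfold oppNbrs; congr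
    have f1 : (scanRow.eval (scanPre.eval s')).reg rFr = (freeNbrs G T x).card := by
      rw [q3]; unfold freeNbrs; congr
    -- Autarky refers to the closed neighbourhood: the counter starts with the contribution of `x`
    -- itself.
    have f2 : (scanRow.eval (scanPre.eval s')).reg rNw ≠ 0 ↔ ∃ y, new x y := by
      rw [q4]
      constructor
      · intro hne
        by_cases hx4 : l x = 4 ∧ T x ≠ 4
        · exact ⟨x, Or.inl rfl, hx4⟩
        · have : ¬ (s.arr 3 (x : ℕ) = 4 ∧ s.arr 4 (x : ℕ) ≠ 4) := hx4
          rw [if_neg this, zero_add] at hne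
          obtain ⟨y, hy⟩ := Finset.card_pos.1 (Nat.pos_of_ne_zero hne)
          simp only [mem_filter, mem_univ, true_and] at hy
          exact ⟨y, Or.inr hy.1, hy.2⟩
      · rintro ⟨y, rfl | hy, hy'⟩
        · have : s.arr 3 (x : ℕ) = 4 ∧ s.arr 4 (x : ℕ) ≠ 4 := hy'
          rw [if_pos this]
          omega
        · have := Finset.card_pos.2 ⟨y, (by simp [hy, hy'] :
            y ∈ univ.filter fun y => G.Adj x y ∧ l y = 4 ∧ T y ≠ 4)⟩
          omega
    have f3 : (scanRow.eval (scanPre.eval s')).reg rLo < 3 ↔ Dec T x := by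
      rw [eval_reg (S := scanRow) rfl, p1', opp_lt_three]; rfl
    have g1 : (scanRow.eval (scanPre.eval s')).reg rConf = s'.reg rConf :=
      (eval_reg rfl _).trans (eval_reg rfl _)
    have g2 : (scanRow.eval (scanPre.eval s')).reg rAct = s'.reg rAct :=
      (eval_reg rfl _).trans (eval_reg rfl _)
    have g3 : (scanRow.eval (scanPre.eval s')).reg rNau = s'.reg rNau :=
      (eval_reg rfl _).trans (eval_reg rfl _)
    rw [f0, f1, f3, g1, Finset.card_eq_zero, Finset.card_eq_zero, e2] at r1
    rw [f0, f3, g2, Finset.card_eq_zero, e3] at r2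
    rw [f0, f3, g3, Finset.card_eq_zero, e4, f2] at r3
    have hev : (block [scanPre, scanRow, scanPost]).eval s' =
      scanPost.eval (scanRow.eval (scanPre.eval s')) := rfl
    rw [hev]
    refine ⟨?_, ?_, ?_, ?_⟩
    · rw [Store.setReg_reg, if_neg (by norm_num), eval_reg (S := scanPost) rfl, q1, pP, hc1.reg0]
      change i * n + n = (i + 1) * n
      ring
    · rw [Store.setReg_reg, if_neg (by norm_num), r1, exists_lt_succ hi]
    · rw [Store.setReg_reg, if_neg (by norm_num), r2, exists_lt_succ hi]
    · rw [Store.setReg_reg, if_neg (by norm_num), r3, exists_lt_succ hi]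

end PMS

namespace PMS

open Finset RAM RAM.Stmt

local notation "rCnt" => (9 : ℕ)
local notation "rPtr" => (10 : ℕ)
local notation "rConf" => (12 : ℕ)
local notation "rRound" => (26 : ℕ)
local notation "rV" => (27 : ℕ)
local notation "rK" => (28 : ℕ)
local notation "rJ" => (29 : ℕ)
local notation "rW" => (30 : ℕ)
local notation "rQ" => (31 : ℕ)

variable {n : ℕ} {G : SimpleGraph (Fin n)} {s : Store}

theorem lab_store {a i v : ℕ} {w : Fin n} (s : Store) (hi : i = w) :
    lab n (s.setArr a i v) a = Function.update (lab n s a) w v := by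
  funext y
  simp only [lab, Store.setArr_arr, if_true, hi, Function.update_apply, Fin.ext_iff]

/-! #### Propagation -/

/-- Decide the vertex `rV` in array `4` if one of the decisions creates a conflict. -/
def updStmt : Stmt := block [
  .op (.load rK 4 rV),
  when (.eq rK 4) (block [
    .op (.store 4 rV 2), scan,
    .ite (.neq rConf 8) (.op (.store 4 rV 1)) (block [
      .op (.store 4 rV 1), scan,
      .ite (.neq rConf 8) (.op (.store 4 rV 2)) (.op (.store 4 rV 4))])])]

/-- Exhaustive propagation in array `4`. -/
def cloStmt : Stmt := .loop rRound (.loop rV updStmt)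

theorem Ctx.setArr (h : Ctx G s) {a i v : ℕ} (ha : a ≠ 0) : Ctx G (s.setArr a i v) :=
  h.of_eq (fun _ _ => rfl) (by simp [Store.setArr_arr, Ne.symm ha])

theorem Ctx.setReg (h : Ctx G s) {x v : ℕ} (hx : 9 ≤ x) : Ctx G (s.setReg x v) :=
  h.of_eq (fun r hr => by simp [show r ≠ x by omega]) rfl

theorem updStmt_spec (h : Ctx G s) {v : Fin n} (hv : s.reg rV = v) :
    lab n (updStmt.eval s) 4 = upd G v (lab n s 4) := by
  set T := lab n s 4 with hT
  set s₁ := s.setReg rK (s.arr 4 v) with hs₁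
  have h1 : Ctx G s₁ := h.setReg (by norm_num)
  have ev : updStmt.eval s = if s.arr 4 v = 4 then (block [
    .op (.store 4 rV 2), scan,
    .ite (.neq rConf 8) (.op (.store 4 rV 1)) (block [
      .op (.store 4 rV 1), scan,
      .ite (.neq rConf 8) (.op (.store 4 rV 2)) (.op (.store 4 rV 4))])]).eval s₁ else s₁ := by
    simp [updStmt, block, eval, Op.apply, when, Test.Holds, hv, hs₁, h.reg4]
  rw [ev]
  have v1 : s₁.reg rV = v := by simp [hs₁, hv]
  have l1 : lab n s₁ 4 = T := rfl
  unfold upd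
  by_cases c : T v = 4
  · rw [if_pos c, if_pos (show s.arr 4 v = 4 from c)]
    set s₂ := s₁.setArr 4 v 2 with hs₂
    have h2 : Ctx G s₂ := h1.setArr (by norm_num)
    have l2 : lab n s₂ 4 = Function.update T v 2 := by rw [hs₂, lab_store _ rfl, l1]
    obtain ⟨c2, -⟩ := scan_spec h2
    have h3 : Ctx G (scan.eval s₂) := h2.eval rfl
    have l3 : lab n (scan.eval s₂) 4 = lab n s₂ 4 := lab_eval rfl s₂
    have v3 : (scan.eval s₂).reg rV = v := (eval_reg rfl s₂).trans v1
    set s₃ := scan.eval s₂ with hs₃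
    have ev2 : (block [
    .op (.store 4 rV 2), scan,
    .ite (.neq rConf 8) (.op (.store 4 rV 1)) (block [
      .op (.store 4 rV 1), scan,
      .ite (.neq rConf 8) (.op (.store 4 rV 2)) (.op (.store 4 rV 4))])]).eval s₁ =
      if s₃.reg rConf ≠ 0 then s₃.setArr 4 v 1 else
        (Stmt.ite (.neq rConf 8) (.op (.store 4 rV 2)) (.op (.store 4 rV 4))).eval
          (scan.eval (s₃.setArr 4 v 1)) := by
      simp only [block, eval, Op.apply, v1, h1.reg2]
      simp only [← hs₂, ← hs₃, Test.Holds, h3.reg8, h3.reg1, v3]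
    rw [ev2]
    rw [l2] at c2 l3
    by_cases d : Conf G (Function.update T v 2)
    · rw [if_pos (c2.2 d), if_pos d, lab_store _ rfl, l3, Function.update_idem]
    · rw [if_neg (fun hh => d (c2.1 hh)), if_neg d]
      set s₄ := s₃.setArr 4 v 1 with hs₄
      have h4 : Ctx G s₄ := h3.setArr (by norm_num)
      have l4 : lab n s₄ 4 = Function.update T v 1 := by
        rw [hs₄, lab_store _ rfl, l3, Function.update_idem]
      obtain ⟨c4, -⟩ := scan_spec h4
      have h5 : Ctx G (scan.eval s₄) := h4.eval rfl
      have l5 : lab n (scan.eval s₄) 4 = lab n s₄ 4 := lab_eval rfl s₄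
      have v5 : (scan.eval s₄).reg rV = v := (eval_reg rfl s₄).trans v3
      rw [l4] at c4 l5
      simp only [eval, Test.Holds, Op.apply, h5.reg8, h5.reg2, h5.reg4, v5]
      by_cases d' : Conf G (Function.update T v 1)
      · rw [if_pos (c4.2 d'), if_pos d', lab_store _ rfl, l5, Function.update_idem]
      · rw [if_neg (fun hh => d' (c4.1 hh)), if_neg d', lab_store _ rfl, l5, Function.update_idem]
        -- Neither trial produced a conflict, and the final store puts back the old label `4`.
        rw [← c, Function.update_eq_self]
  · rw [if_neg c, if_neg (show ¬ s.arr 4 v = 4 from c)]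
    rfl

theorem keeps_updStmt : keeps updStmt = true := rfl

theorem passStmt_spec (h : Ctx G s) :
    lab n ((Stmt.loop rV updStmt).eval s) 4 = pass G (lab n s 4) := by
  have key := eval_loop_induction (s := s) (x := rV) (P := updStmt)
    (fun i s' => Ctx G s' ∧ lab n s' 4 = passTo G (lab n s 4) i) rfl
    ⟨h.setReg (by norm_num), rfl⟩ ?_
  · rw [h.reg0] at key
    exact key.2
  · rintro i hi s' - - hx ⟨hc, hl⟩
    rw [h.reg0] at hi
    refine ⟨(hc.eval keeps_updStmt).setReg (by norm_num), ?_⟩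
    rw [lab_setReg, updStmt_spec hc (v := ⟨i, hi⟩) hx, passTo, dif_pos hi, hl]

theorem cloStmt_spec (h : Ctx G s) : lab n (cloStmt.eval s) 4 = clo G (lab n s 4) := by
  have key := eval_loop_induction (s := s) (x := rRound) (P := Stmt.loop rV updStmt)
    (fun i s' => Ctx G s' ∧ lab n s' 4 = (pass G)^[i] (lab n s 4)) rfl
    ⟨h.setReg (by norm_num), rfl⟩ ?_
  · rw [h.reg0] at key
    exact key.2
  · rintro i hi s' - - hx ⟨hc, hl⟩
    refine ⟨(hc.eval (by rfl)).setReg (by norm_num), ?_⟩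
    rw [lab_setReg, passStmt_spec hc, hl, Function.iterate_succ_apply']

/-! #### Copying, and the stack -/

/-- Copy the labeling in array `a` to array `b`. -/
def copyStmt (a b : ℕ) : Stmt := .loop rJ (block [.op (.load rW a rJ), .op (.store b rJ rW)])

theorem copyStmt_spec {a b : ℕ} (hn : s.reg 0 = n) (hab : a ≠ b) :
    lab n ((copyStmt a b).eval s) b = lab n s a := by
  have key := eval_loop_induction (s := s) (x := rJ)
    (P := block [.op (.load rW a rJ), .op (.store b rJ rW)])
    (fun i s' => ∀ v : Fin n, v.1 < i → s'.arr b v = s.arr a v) rfl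
    (fun v hv => absurd hv (Nat.not_lt_zero _)) ?_
  · funext v
    exact key v (hn ▸ v.2)
  · rintro i hi s' - ha hx hl v hv
    have ha' := ha a (by simp [block, writesArr, Op.writesArr, hab])
    simp only [block, eval, Op.apply, Store.setReg_reg, Store.setReg_arr, Store.setArr_arr, hx, ha',
      if_true, Function.update_apply]
    norm_num
    split_ifs with e
    · rw [e]
    · exact hl v (by omega)

/-- Array contents that list labelings of `n` vertices. -/
def Cells (n : ℕ) (f : ℕ → ℕ) (L : List (Fin n → ℕ)) : Prop :=
  ∀ (j : ℕ) (hj : j < L.length) (v : Fin n), f (j * n + v) = L[j] v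

/-- The stack in array `2` consists of the labelings in `L`. -/
structure Stack (n : ℕ) (s : Store) (L : List (Fin n → ℕ)) : Prop where
  cnt : s.reg rCnt = L.length
  ptr : s.reg rPtr = L.length * n
  cells : Cells n (s.arr 2) L

theorem Cells.left {f : ℕ → ℕ} {L L' : List (Fin n → ℕ)} (h : Cells n f (L ++ L')) :
    Cells n f L := by
  intro j hj v
  rw [h j (by simp; omega) v, List.getElem_append_left hj]

theorem Stack.of_eq {s s' : Store} {L : List (Fin n → ℕ)} (h : Stack n s L)
    (h1 : s'.reg rCnt = s.reg rCnt) (h2 : s'.reg rPtr = s.reg rPtr) (h3 : s'.arr 2 = s.arr 2) :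
    Stack n s' L :=
  ⟨h1.trans h.cnt, h2.trans h.ptr, h3 ▸ h.cells⟩

/-- The structured program does not change the stack. -/
def keepsStack (S : Stmt) : Bool :=
  !S.writesReg rCnt && !S.writesReg rPtr && !S.writesArr 2

theorem Stack.eval {L : List (Fin n → ℕ)} (h : Stack n s L) {S : Stmt}
    (hS : keepsStack S = true) : Stack n (S.eval s) L := by
  simp only [keepsStack, Bool.and_eq_true, Bool.not_eq_true'] at hS
  exact h.of_eq (eval_reg hS.1.1 s) (eval_reg hS.1.2 s) (eval_arr hS.2 s)

/-- Push the labeling in array `4`. -/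
def pushStmt : Stmt := block [
  .loop rJ (block [.op (.load rW 4 rJ), .op (.store 2 rPtr rW), .op (.inc rPtr)]), .op (.inc rCnt)]

theorem pushStmt_spec {L : List (Fin n → ℕ)} (hn : s.reg 0 = n) (h : Stack n s L) :
    Stack n (pushStmt.eval s) (L ++ [lab n s 4]) := by
  have key := eval_loop_induction (s := s) (x := rJ)
    (P := block [.op (.load rW 4 rJ), .op (.store 2 rPtr rW), .op (.inc rPtr)])
    (fun i s' => s'.reg rPtr = L.length * n + i ∧
      (∀ k < L.length * n, s'.arr 2 k = s.arr 2 k) ∧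
      ∀ j < i, s'.arr 2 (L.length * n + j) = s.arr 4 j) rfl
    ⟨by simp [h.ptr], by simp, fun j hj => absurd hj (Nat.not_lt_zero _)⟩ ?_
  · rw [hn] at key
    obtain ⟨k1, k2, k3⟩ := key
    have c1 : ((Stmt.loop rJ (block [.op (.load rW 4 rJ), .op (.store 2 rPtr rW),
      .op (.inc rPtr)])).eval s).reg rCnt = s.reg rCnt := eval_reg rfl s
    generalize he : (Stmt.loop rJ (block [.op (.load rW 4 rJ), .op (.store 2 rPtr rW),
      .op (.inc rPtr)])).eval s = s' at *
    have ev : pushStmt.eval s = s'.setReg rCnt (s'.reg rCnt + 1) := by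
      rw [← he]; rfl
    rw [ev]
    refine ⟨by simp [c1, h.cnt], by simp [k1]; ring, ?_⟩
    intro j hj v
    simp only [Store.setReg_arr]
    by_cases hjL : j < L.length
    · rw [List.getElem_append_left hjL, ← h.cells j hjL v]
      refine k2 _ ?_
      have := v.2
      have : (j + 1) * n ≤ L.length * n := Nat.mul_le_mul_right _ hjL
      linarith
    · have : j = L.length := by
        simp at hj
        omega
      subst this
      rw [k3 _ v.2]
      simp [lab]
  · rintro i hi s' - ha hx ⟨e1, e2, e3⟩
    have a4 := ha 4 rfl
    have ev : (block [.op (.load rW 4 rJ), .op (.store 2 rPtr rW), .op (.inc rPtr)]).eval s' =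
      (((s'.setReg rW (s.arr 4 i)).setArr 2 (L.length * n + i) (s.arr 4 i)).setReg rPtr
        (L.length * n + i + 1)) := by
      simp [block, eval, Op.apply, hx, e1, a4]
    rw [ev]
    refine ⟨by simp [add_assoc], fun k hk => ?_, fun j hj => ?_⟩
    · simp only [Store.setReg_arr, Store.setArr_arr, if_true, Function.update_apply]
      rw [if_neg (by omega), e2 k hk]
    · simp only [Store.setReg_arr, Store.setArr_arr, if_true, Function.update_apply]
      split_ifs with hji
      · congr 1; omega
      · exact e3 j (by omega)

/-- Move the top of the stack to array `3`. -/
def popStmt : Stmt := block [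
  .op (.dec rCnt), .loop rJ (.op (.dec rPtr)), .op (.copy rQ rPtr),
  .loop rJ (block [.op (.load rW 2 rQ), .op (.store 3 rJ rW), .op (.inc rQ)])]

theorem popStmt_spec {L : List (Fin n → ℕ)} {T : Fin n → ℕ} (hn : s.reg 0 = n)
    (h : Stack n s (L ++ [T])) :
    Stack n (popStmt.eval s) L ∧ lab n (popStmt.eval s) 3 = T := by
  set s₁ := s.setReg rCnt L.length with hs₁
  -- In the absence of subtraction, the pointer is moved back by `n` single decrements.
  have key₁ := eval_loop_induction (s := s₁) (x := rJ) (P := .op (.dec rPtr))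
    (fun i s' => s'.reg rPtr = (L.length + 1) * n - i) rfl (by simp [hs₁, h.ptr]) ?_
  swap
  · rintro i hi s' - - - hI
    simp only [eval, Op.apply, Store.setReg_reg, hI]
    norm_num
    omega
  have n1 : s₁.reg 0 = n := by simp [hs₁, hn]
  rw [n1] at key₁
  have key₁' : ((Stmt.loop rJ (.op (.dec rPtr))).eval s₁).reg rPtr = L.length * n := by
    rw [key₁, Nat.add_mul, one_mul, Nat.add_sub_cancel]
  have c2 : ((Stmt.loop rJ (.op (.dec rPtr))).eval s₁).reg rCnt = L.length :=
    (eval_reg rfl s₁).trans (by simp [hs₁])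
  have n2 : ((Stmt.loop rJ (.op (.dec rPtr))).eval s₁).reg 0 = n := (eval_reg rfl s₁).trans n1
  have a2 : ((Stmt.loop rJ (.op (.dec rPtr))).eval s₁).arr 2 = s.arr 2 := eval_arr rfl s₁
  have ev : popStmt.eval s = (Stmt.loop rJ (block [.op (.load rW 2 rQ), .op (.store 3 rJ rW),
      .op (.inc rQ)])).eval ((((Stmt.loop rJ (.op (.dec rPtr))).eval s₁)).setReg rQ
        (((Stmt.loop rJ (.op (.dec rPtr))).eval s₁).reg rPtr)) := by
    have e1 : (Op.dec rCnt).apply s = s₁ := by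
      simp [Op.apply, hs₁, h.cnt]
    simp only [popStmt, block, Stmt.eval, e1]
    rfl
  rw [ev, key₁']
  generalize (Stmt.loop rJ (.op (.dec rPtr))).eval s₁ = s₂ at *
  set s₃ := s₂.setReg rQ (L.length * n) with hs₃
  have n3 : s₃.reg 0 = n := by simp [hs₃, n2]
  have st : Stack n s₃ L :=
    ⟨by simp [hs₃, c2], by simp [hs₃, key₁'], by rw [hs₃, Store.setReg_arr, a2]; exact h.cells.left⟩
  refine ⟨st.eval rfl, ?_⟩
  have key := eval_loop_induction (s := s₃) (x := rJ)
    (P := block [.op (.load rW 2 rQ), .op (.store 3 rJ rW), .op (.inc rQ)])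
    (fun i s' => s'.reg rQ = L.length * n + i ∧
      ∀ v : Fin n, v.1 < i → s'.arr 3 v = T v) rfl
    ⟨by simp [hs₃], fun j hj => absurd hj (Nat.not_lt_zero _)⟩ ?_
  · rw [n3] at key
    funext v
    exact key.2 v v.2
  · rintro i hi s' - ha hx ⟨e1, e2⟩
    rw [n3] at hi
    have b2 : s'.arr 2 = s.arr 2 := (ha 2 rfl).trans a2
    have hT : s.arr 2 (L.length * n + i) = T ⟨i, hi⟩ := by
      have := h.cells L.length (by simp) ⟨i, hi⟩
      simpa using this
    have ev : (block [.op (.load rW 2 rQ), .op (.store 3 rJ rW), .op (.inc rQ)]).eval s' =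
      (((s'.setReg rW (T ⟨i, hi⟩)).setArr 3 i (T ⟨i, hi⟩)).setReg rQ (L.length * n + i + 1)) := by
      simp [block, Stmt.eval, Op.apply, hx, e1, b2, hT]
    rw [ev]
    refine ⟨by simp [add_assoc], fun v hv => ?_⟩
    simp only [Store.setReg_arr, Store.setArr_arr, if_true, Function.update_apply]
    split_ifs with hvi
    · congr 1; exact Fin.ext hvi.symm
    · exact e2 v (by omega)

end PMS

namespace PMS

open Finset RAM RAM.Stmt

local notation "rCnt" => (9 : ℕ)
local notation "rPtr" => (10 : ℕ)
local notation "rConf" => (12 : ℕ)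
local notation "rNau" => (14 : ℕ)
local notation "rU" => (32 : ℕ)
local notation "rC" => (33 : ℕ)
local notation "rAut" => (34 : ℕ)
local notation "rAcc" => (35 : ℕ)
local notation "rCntSave" => (36 : ℕ)
local notation "rPtrSave" => (37 : ℕ)
local notation "rG" => (38 : ℕ)
local notation "rI" => (39 : ℕ)
local notation "rLabA" => (40 : ℕ)
local notation "rLabB" => (41 : ℕ)
local notation "rActSave" => (42 : ℕ)

variable {n : ℕ} {G : SimpleGraph (Fin n)} {s : Store} {l : Fin n → ℕ}

/-! #### Branching -/

/-- Count the vertices that are free in array `3` but not in array `4`. -/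
def gainStmt : Stmt := block [
  .op (.const rG 0),
  .loop rI (block [.op (.load rLabA 3 rI), .op (.load rLabB 4 rI),
    when (.eq rLabA 4) (when (.neq rLabB 4) (.op (.inc rG)))])]

/-- Add the weight of a branch to `rAcc`. -/
def addWt : Stmt :=
  .ite (.lt rG 2) (incBy rAcc 27) (.ite (.eq rG 2) (incBy rAcc 21) (.ite (.eq rG 3) (incBy rAcc 17)
    (.ite (.eq rG 4) (incBy rAcc 13) (.ite (.eq rG 5) (incBy rAcc 11)
      (.ite (.eq rG 6) (incBy rAcc 8) (incBy rAcc 7))))))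

theorem gainStmt_spec (h : Ctx G s) :
    (gainStmt.eval s).reg rG = (newDec (lab n s 3) (lab n s 4)).card := by
  have key := eval_loop_induction (s := s.setReg rG 0) (x := rI)
    (P := block [.op (.load rLabA 3 rI), .op (.load rLabB 4 rI),
    when (.eq rLabA 4) (when (.neq rLabB 4) (.op (.inc rG)))])
    (fun i s' => Ctx G s' ∧ s'.reg rG = Nat.count (fun j => s.arr 3 j = 4 ∧ s.arr 4 j ≠ 4) i) rfl
    ⟨(h.setReg (by norm_num)).setReg (by norm_num), by simp⟩ ?_
  · rw [Store.setReg_reg, if_neg (by norm_num), h.reg0] at key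
    have e := key.2
    rw [count_eq_card _ (fun y : Fin n => lab n s 3 y = 4 ∧ lab n s 4 y ≠ 4) (fun y => by rfl)] at e
    exact e
  · rintro i hi s' - ha hx ⟨hc, e⟩
    have a3 : s'.arr 3 = s.arr 3 := ha 3 rfl
    have a4 : s'.arr 4 = s.arr 4 := ha 4 rfl
    refine ⟨(hc.eval rfl).setReg (by norm_num), ?_⟩
    rw [Nat.count_succ]
    rcases Classical.propComplete (s.arr 3 i = 4) with c1 | c1 <;>
      rcases Classical.propComplete (s.arr 4 i = 4) with c2 | c2 <;>
      simp [block, Stmt.eval, Op.apply, when, Test.Holds, hc.reg4, a3, a4, hx, c1, c2, e]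

theorem addWt_spec (h : Ctx G s) :
    addWt.eval s = s.setReg rAcc (s.reg rAcc + wt (s.reg rG)) := by
  simp only [addWt, Stmt.eval, Test.Holds, eval_incBy, h.reg2, h.reg3, h.reg4, h.reg5, h.reg6, wt]
  split_ifs <;> first | rfl | omega

/-- Push the labeling in array `4` as a further branch, or as the only one if it makes the others
superfluous. -/
def pushBranch : Stmt := block [
  when (.eq rActSave 8) (.op (.const rNau 0)),
  .ite (.eq rNau 8)
    (block [.op (.copy rCnt rCntSave), .op (.copy rPtr rPtrSave), pushStmt, .op (.const rAut 1)])
    (block [pushStmt, gainStmt, addWt])]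

/-- Without active vertices the flag for autarky is overridden, so that one test covers both reasons
for a single branch. Resetting count and pointer to their saved values discards the branches in `M`;
their cells need no erasing. -/
theorem pushBranch_spec {L₀ M : List (Fin n → ℕ)} {T : Fin n → ℕ} (h : Ctx G s)
    (h3 : lab n s 3 = l) (h4 : lab n s 4 = T) (hst : Stack n s (L₀ ++ M))
    (hcnt : s.reg rCntSave = L₀.length) (hptr : s.reg rPtrSave = L₀.length * n)
    (hact : s.reg rActSave ≠ 0 ↔ ¬ NoActive G l) (hnau : s.reg rNau ≠ 0 ↔ ¬ Autark G l T) :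
    ((NoActive G l ∨ Autark G l T) →
      (pushBranch.eval s).reg rAut ≠ 0 ∧ Stack n (pushBranch.eval s) (L₀ ++ [T])) ∧
    (¬ (NoActive G l ∨ Autark G l T) →
      (pushBranch.eval s).reg rAut = s.reg rAut ∧ Stack n (pushBranch.eval s) (L₀ ++ M ++ [T]) ∧
      (pushBranch.eval s).reg rAcc = s.reg rAcc + wt (newDec l T).card) := by
  set s₅ := (when (.eq rActSave 8) (.op (.const rNau 0))).eval s with hs₅
  have c5 : Ctx G s₅ := h.eval rfl
  have st5 : Stack n s₅ (L₀ ++ M) := hst.eval rfl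
  have l5 : lab n s₅ 4 = T := (lab_eval rfl s).trans h4
  have l53 : lab n s₅ 3 = l := (lab_eval rfl s).trans h3
  have r5 : ∀ x, x ≠ rNau → s₅.reg x = s.reg x := fun x hx => by
    rw [hs₅, eval_reg (by simp [when, writesReg, Op.writesReg, hx])]
  have nau : s₅.reg rNau = 0 ↔ (NoActive G l ∨ Autark G l T) := by
    have hact : s.reg rActSave = 0 ↔ NoActive G l := by tauto
    by_cases hna : NoActive G l
    · have : s₅ = s.setReg rNau 0 := by
        rw [hs₅, when, Stmt.eval, if_pos (by simp only [Test.Holds, h.reg8]; exact hact.2 hna)]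
        rfl
      simp [this, hna]
    · have : s₅ = s := by
        rw [hs₅, when, Stmt.eval,
          if_neg (by simp only [Test.Holds, h.reg8]; exact fun hh => hna (hact.1 hh))]
        rfl
      rw [this]
      tauto
  have q1 : s₅.reg rCntSave = L₀.length := (r5 _ (by norm_num)).trans hcnt
  have q2 : (s₅.setReg rCnt L₀.length).reg rPtrSave = L₀.length * n := by
    simp [(r5 rPtrSave (by norm_num)).trans hptr]
  have ev : pushBranch.eval s =
      if s₅.reg rNau = 0 then (pushStmt.eval ((s₅.setReg rCnt L₀.length).setReg rPtr
          (L₀.length * n))).setReg rAut 1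
        else addWt.eval (gainStmt.eval (pushStmt.eval s₅)) := by
    simp only [pushBranch, block, Stmt.eval, ← hs₅, Test.Holds, c5.reg8, Op.apply, q1, q2]
  rw [ev]
  constructor
  · intro haut
    rw [if_pos (nau.2 haut)]
    refine ⟨by simp, ?_⟩
    set s₆ := (s₅.setReg rCnt L₀.length).setReg rPtr (L₀.length * n) with hs₆
    have st6 : Stack n s₆ L₀ := ⟨by simp [hs₆], by simp [hs₆], st5.cells.left⟩
    have := pushStmt_spec (by simp [hs₆, c5.reg0]) st6
    rw [show lab n s₆ 4 = T from l5] at this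
    exact this.of_eq (by simp) (by simp) rfl
  · intro haut
    rw [if_neg (fun hh => haut (nau.1 hh))]
    have st6 := pushStmt_spec c5.reg0 st5
    have c6 : Ctx G (pushStmt.eval s₅) := c5.eval rfl
    have k3 : lab n (pushStmt.eval s₅) 3 = l := (lab_eval rfl s₅).trans l53
    have k4 : lab n (pushStmt.eval s₅) 4 = T := (lab_eval rfl s₅).trans l5
    have ka : (pushStmt.eval s₅).reg rAcc = s.reg rAcc :=
      (eval_reg rfl s₅).trans (r5 _ (by norm_num))
    have kt : (pushStmt.eval s₅).reg rAut = s.reg rAut :=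
      (eval_reg rfl s₅).trans (r5 _ (by norm_num))
    rw [l5] at st6
    generalize pushStmt.eval s₅ = s₆ at *
    have c7 : Ctx G (gainStmt.eval s₆) := c6.eval rfl
    have g7 := gainStmt_spec c6
    rw [k3, k4] at g7
    rw [addWt_spec c7, g7]
    refine ⟨?_, ?_, ?_⟩
    · rw [Store.setReg_reg, if_neg (by norm_num), eval_reg rfl, kt]
    · have := (st6.eval (S := gainStmt) rfl)
      exact this.of_eq (by simp) (by simp) rfl
    · rw [Store.setReg_reg, if_pos rfl, eval_reg rfl, ka]

/-- Examine the branch in which `rU` gets the label `rC`. -/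
def optionStmt : Stmt :=
  when (.eq rAut 8) (block [
    copyStmt 3 4, .op (.store 4 rU rC), cloStmt, scan, when (.eq rConf 8) pushBranch])

/-- The state while the branches in the list `O` have been examined; the stack was `L₀` before. -/
structure OptState (G : SimpleGraph (Fin n)) (l : Fin n → ℕ) (L₀ : List (Fin n → ℕ))
    (O : List (Fin n × ℕ)) (s : Store) : Prop where
  ctx : Ctx G s
  lab_eq : lab n s 3 = l
  cntSave : s.reg rCntSave = L₀.length
  ptrSave : s.reg rPtrSave = L₀.length * n
  act : s.reg rActSave ≠ 0 ↔ ¬ NoActive G l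
  cases : (s.reg rAut = 0 ∧ Stack n s (L₀ ++ children G l O) ∧
      s.reg rAcc = (O.map fun o => childWt G l o.1 o.2).sum ∧
      ∀ o ∈ O, ¬ Conf G (child G l o.1 o.2) →
        ¬ (NoActive G l ∨ Autark G l (child G l o.1 o.2))) ∨
    (s.reg rAut ≠ 0 ∧ ∃ o ∈ O, ¬ Conf G (child G l o.1 o.2) ∧
      (NoActive G l ∨ Autark G l (child G l o.1 o.2)) ∧ Stack n s (L₀ ++ [child G l o.1 o.2]))

theorem children_append (O O' : List (Fin n × ℕ)) :
    children G l (O ++ O') = children G l O ++ children G l O' := by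
  simp [children]

theorem optionStmt_spec {L₀ : List (Fin n → ℕ)} {O : List (Fin n × ℕ)} (h : OptState G l L₀ O s)
    {u : Fin n} {c : ℕ} (hu : s.reg rU = u) (hc : s.reg rC = c) :
    OptState G l L₀ (O ++ [(u, c)]) (optionStmt.eval s) := by
  have f1 : Ctx G (optionStmt.eval s) := h.ctx.eval rfl
  have f2 : lab n (optionStmt.eval s) 3 = l := (lab_eval rfl s).trans h.lab_eq
  have f3 : (optionStmt.eval s).reg rCntSave = L₀.length := (eval_reg rfl s).trans h.cntSave
  have f4 : (optionStmt.eval s).reg rPtrSave = L₀.length * n := (eval_reg rfl s).trans h.ptrSave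
  have f5 : (optionStmt.eval s).reg rActSave ≠ 0 ↔ ¬ NoActive G l := by
    rw [eval_reg rfl s]; exact h.act
  refine ⟨f1, f2, f3, f4, f5, ?_⟩
  rcases h.cases with ⟨e1, e2, e3, e4⟩ | ⟨e1, o, ho, ho'⟩
  swap
  -- A sufficient single branch is already on the stack, and all later options are skipped.
  · right
    have : optionStmt.eval s = s := by
      simp [optionStmt, when, Stmt.eval, Test.Holds, h.ctx.reg8, e1]
    rw [this]
    exact ⟨e1, o, by simp [ho], ho'⟩
  set s₁ := (copyStmt 3 4).eval s with hs₁
  have c1 : Ctx G s₁ := h.ctx.eval rfl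
  have l1 : lab n s₁ 4 = l := (copyStmt_spec h.ctx.reg0 (by norm_num)).trans h.lab_eq
  have u1 : s₁.reg rU = u := (eval_reg rfl s).trans hu
  have d1 : s₁.reg rC = c := (eval_reg rfl s).trans hc
  set s₂ := s₁.setArr 4 u c with hs₂
  have c2 : Ctx G s₂ := c1.setArr (by norm_num)
  have l2 : lab n s₂ 4 = Function.update l u c := by rw [hs₂, lab_store _ rfl, l1]
  set s₃ := cloStmt.eval s₂ with hs₃
  have c3 : Ctx G s₃ := c2.eval rfl
  have l3 : lab n s₃ 4 = child G l u c := by rw [hs₃, cloStmt_spec c2, l2]; rfl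
  set s₄ := scan.eval s₃ with hs₄
  have c4 : Ctx G s₄ := c3.eval rfl
  have l4 : lab n s₄ 4 = child G l u c := (lab_eval rfl s₃).trans l3
  have l33 : lab n s₃ 3 = l := by
    rw [hs₃, lab_eval rfl, hs₂]
    have : lab n (s₁.setArr 4 u c) 3 = lab n s₁ 3 := by
      funext y; simp [lab, Store.setArr_arr]
    rw [this, hs₁, lab_eval rfl, h.lab_eq]
  have l43 : lab n s₄ 3 = l := (lab_eval rfl s₃).trans l33
  obtain ⟨p1, -, p3⟩ := scan_spec c3
  rw [l3] at p1 p3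
  rw [l33] at p3
  rw [← hs₄] at p1 p3
  have r : ∀ x, (copyStmt 3 4).writesReg x = false → cloStmt.writesReg x = false →
      scan.writesReg x = false → s₄.reg x = s.reg x := fun x h1 h2 h3 => by
    rw [hs₄, eval_reg h3, hs₃, eval_reg h2, hs₂, Store.setArr_reg, hs₁, eval_reg h1]
  have st4 : Stack n s₄ (L₀ ++ children G l O) := by
    refine e2.of_eq (r _ rfl rfl rfl) (r _ rfl rfl rfl) ?_
    rw [hs₄, eval_arr rfl, hs₃, eval_arr rfl, hs₂, Store.setArr_arr, if_neg (by norm_num), hs₁,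
      eval_arr rfl]
  have ev : optionStmt.eval s = (when (.eq rConf 8) pushBranch).eval s₄ := by
    rw [optionStmt, when, Stmt.eval, if_pos (by simp [Test.Holds, h.ctx.reg8, e1])]
    simp only [block, Stmt.eval, Op.apply, u1, d1, ← hs₁, ← hs₂, ← hs₃, ← hs₄]
  rw [ev]
  have ra : s₄.reg rAut = 0 := (r _ rfl rfl rfl).trans e1
  have rc : s₄.reg rAcc = (O.map fun o => childWt G l o.1 o.2).sum := (r _ rfl rfl rfl).trans e3
  have spec := pushBranch_spec c4 l43 l4 st4 ((r _ rfl rfl rfl).trans h.cntSave)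
    ((r _ rfl rfl rfl).trans h.ptrSave) (by rw [r rActSave rfl rfl rfl]; exact h.act) p3
  have hev : (when (.eq rConf 8) pushBranch).eval s₄ =
      if s₄.reg rConf = 0 then pushBranch.eval s₄ else s₄ := by
    rw [when, Stmt.eval]
    simp only [Test.Holds, c4.reg8]
    rfl
  rw [hev]
  clear_value s₄
  by_cases hconf : Conf G (child G l u c)
  · left
    rw [if_neg (p1.2 hconf)]
    refine ⟨ra, ?_, ?_, ?_⟩
    · rw [children_append]
      simpa [children, hconf] using st4
    · rw [rc]
      simp [childWt, hconf]
    · intro o ho ho'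
      rcases List.mem_append.1 ho with ho | ho
      · exact e4 o ho ho'
      · rw [List.mem_singleton] at ho
        subst ho
        exact absurd hconf ho'
  · rw [if_pos (by by_contra hh; exact hconf (p1.1 hh))]
    by_cases haut : NoActive G l ∨ Autark G l (child G l u c)
    · right
      obtain ⟨k1, k2⟩ := spec.1 haut
      exact ⟨k1, (u, c), by simp, hconf, haut, k2⟩
    · left
      obtain ⟨k1, k2, k3⟩ := spec.2 haut
      refine ⟨k1.trans ra, ?_, ?_, ?_⟩
      · rw [children_append]
        have e : children G l [(u, c)] = [child G l u c] := by simp [children, hconf]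
        rw [e, ← List.append_assoc]
        exact k2
      · rw [k3, rc]
        simp [childWt, hconf]
      · intro o ho ho'
        rcases List.mem_append.1 ho with ho | ho
        · exact e4 o ho ho'
        · rw [List.mem_singleton] at ho
          subst ho
          exact haut

end PMS

namespace PMS

open Finset RAM RAM.Stmt

local notation "rCnt" => (9 : ℕ)
local notation "rPtr" => (10 : ℕ)
local notation "rAct" => (13 : ℕ)
local notation "rU" => (32 : ℕ)
local notation "rC" => (33 : ℕ)
local notation "rAut" => (34 : ℕ)
local notation "rAcc" => (35 : ℕ)
local notation "rCntSave" => (36 : ℕ)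
local notation "rPtrSave" => (37 : ℕ)
local notation "rActSave" => (42 : ℕ)
local notation "rCand" => (43 : ℕ)
local notation "rLabCand" => (44 : ℕ)
local notation "rLabOpp" => (45 : ℕ)
local notation "rRow" => (46 : ℕ)
local notation "rOpt" => (47 : ℕ)
local notation "rEdge" => (48 : ℕ)
local notation "rLabU" => (49 : ℕ)
local notation "rDone" => (50 : ℕ)

variable {n : ℕ} {G : SimpleGraph (Fin n)} {s : Store} {l : Fin n → ℕ}

/-- Examine the branches on `rCand` that concern the vertex `rU`. -/
def optsStmt : Stmt := block [
  .op (.load rEdge 0 rRow), .op (.inc rRow), .op (.load rLabU 3 rU),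
  when (.eq rLabU 4)
    (.ite (.eq rLabCand 4)
      (when (.eq rU rCand) (block [.op (.const rOpt 1), .op (.copy rC 1), optionStmt,
        .op (.copy rC 2), optionStmt]))
      (when (.lt rLabOpp 3) (when (.eq rEdge 1) (block [.op (.const rOpt 1),
        .op (.copy rC rLabOpp), optionStmt]))))]

theorem OptState.of_eq {L₀ : List (Fin n → ℕ)} {O : List (Fin n × ℕ)} {s' : Store}
    (h : OptState G l L₀ O s)
    (hr : ∀ r, r < 11 ∨ r = rAut ∨ r = rAcc ∨ r = rCntSave ∨ r = rPtrSave ∨ r = rActSave →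
      s'.reg r = s.reg r) (ha : s'.arr = s.arr) : OptState G l L₀ O s' := by
  have st : ∀ {L}, Stack n s L → Stack n s' L := fun hL =>
    hL.of_eq (hr _ (by norm_num)) (hr _ (by norm_num)) (by rw [ha])
  refine ⟨h.ctx.of_eq (fun r h => hr r (by omega)) (by rw [ha]), ?_, ?_, ?_, ?_, ?_⟩
  · rw [← h.lab_eq]; unfold lab; rw [ha]
  · rw [hr _ (by norm_num), h.cntSave]
  · rw [hr _ (by norm_num), h.ptrSave]
  · rw [hr _ (by norm_num), h.act]
  · rw [hr rAut (by norm_num), hr rAcc (by norm_num)]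
    rcases h.cases with ⟨e1, e2, e3⟩ | ⟨e1, o, ho, h1, h2, h3⟩
    · exact Or.inl ⟨e1, st e2, e3⟩
    · exact Or.inr ⟨e1, o, ho, h1, h2, st h3⟩

/-- The row pointer advances even if `u` contributes no branch, so after a full loop it stands at
the row of the next candidate. -/
theorem optsStmt_spec {L₀ : List (Fin n → ℕ)} {O : List (Fin n × ℕ)} (h : OptState G l L₀ O s)
    {x u : Fin n} (hu : s.reg rU = u) (hx : s.reg rCand = x) (hlx : s.reg rLabCand = l x)
    (hlo : s.reg rLabOpp = opp (l x)) (hrow : s.reg rRow = x * n + u)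
    (hopt : s.reg rOpt ≠ 0 ↔ O ≠ []) :
    OptState G l L₀ (O ++ optsAt G l x u) (optsStmt.eval s) ∧
    (optsStmt.eval s).reg rRow = x * n + u + 1 ∧
    ((optsStmt.eval s).reg rOpt ≠ 0 ↔ O ++ optsAt G l x u ≠ []) := by
  set s₁ := ((s.setReg rEdge (s.arr 0 (x * n + u))).setReg rRow (x * n + u + 1)).setReg rLabU (l u)
    with hs₁
  have hlu : s.arr 3 u = l u := congrFun h.lab_eq u
  have hctx := h.ctx
  have h1 : OptState G l L₀ O s₁ := by
    refine h.of_eq (fun r hr => ?_) rfl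
    have : r ≠ rEdge ∧ r ≠ rRow ∧ r ≠ rLabU := by omega
    simp [hs₁, this]
  have f1 : s₁.reg rU = u := by simp [hs₁, hu]
  have f2 : s₁.reg rCand = x := by simp [hs₁, hx]
  have f3 : s₁.reg rLabCand = l x := by simp [hs₁, hlx]
  have f4 : s₁.reg rLabOpp = opp (l x) := by simp [hs₁, hlo]
  have f5 : s₁.reg rEdge = s.arr 0 (x * n + u) := by simp [hs₁]
  have f6 : s₁.reg rLabU = l u := by simp [hs₁]
  have f7 : s₁.reg rRow = x * n + u + 1 := by simp [hs₁]
  have f8 : s₁.reg rOpt ≠ 0 ↔ O ≠ [] := by simpa [hs₁] using hopt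
  set s₂ := s₁.setReg rOpt 1 with hs₂
  have h2 : OptState G l L₀ O s₂ := by
    refine h1.of_eq (fun r hr => ?_) rfl
    have : r ≠ rOpt := by omega
    simp [hs₂, this]
  have setC : ∀ {s' : Store} {O' c}, OptState G l L₀ O' s' → OptState G l L₀ O' (s'.setReg rC c) := by
    intro s' O' c h'
    refine h'.of_eq (fun r hr => ?_) rfl
    have : r ≠ rC := by omega
    simp [this]
  set sA := optionStmt.eval (optionStmt.eval (s₂.setReg rC 1) |>.setReg rC 2) with hsA
  set sB := optionStmt.eval (s₂.setReg rC (opp (l x))) with hsB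
  have e12 : (optionStmt.eval (s₂.setReg rC 1)).reg 2 = 2 := by
    rw [eval_reg rfl]; simp [hs₂, hs₁, hctx.reg2]
  have ev : optsStmt.eval s = if l u = 4 then
      if l x = 4 then (if (u : ℕ) = x then sA else s₁)
      else if opp (l x) < 3 then (if s.arr 0 (x * n + u) = 1 then sB else s₁) else s₁
    else s₁ := by
    have c1 := h1.ctx
    have g4 : s₂.reg rLabOpp = opp (l x) := by simp [hs₂, f4]
    have g1 : s₂.reg 1 = 1 := by simp [hs₂, c1.reg1]
    have e : ∀ S : Stmt, (block [.op (.load rEdge 0 rRow), .op (.inc rRow),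
        .op (.load rLabU 3 rU), S]).eval s = S.eval s₁ := by
      intro S
      simp [block, Stmt.eval, Op.apply, hrow, hu, hlu, hs₁]
    rw [optsStmt, e]
    simp only [when, block, Stmt.eval, Test.Holds, Op.apply, f1, f2, f3, f4, f5, f6, c1.reg1,
      c1.reg3, c1.reg4, ← hs₂, g1, g4, e12]
    rfl
  rw [ev]
  have hA : OptState G l L₀ (O ++ [(u, 1), (u, 2)]) sA := by
    have k1 := optionStmt_spec (setC (c := 1) h2) (u := u) (c := 1) (by simp [hs₂, f1]) (by simp)
    have k2 := optionStmt_spec (setC (c := 2) k1) (u := u) (c := 2)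
      (by rw [Store.setReg_reg, if_neg (by norm_num), eval_reg rfl]; simp [hs₂, f1]) (by simp)
    simpa using k2
  have hB : OptState G l L₀ (O ++ [(u, opp (l x))]) sB :=
    optionStmt_spec (setC h2) (by simp [hs₂, f1]) (by simp)
  have rA : ∀ r, optionStmt.writesReg r = false → r ≠ rC → sA.reg r = s₂.reg r := by
    intro r hr hne
    rw [hsA, eval_reg hr, Store.setReg_reg, if_neg hne, eval_reg hr, Store.setReg_reg, if_neg hne]
  have rB : ∀ r, optionStmt.writesReg r = false → r ≠ rC → sB.reg r = s₂.reg r := by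
    intro r hr hne
    rw [hsB, eval_reg hr, Store.setReg_reg, if_neg hne]
  have adj : s.arr 0 (x * n + u) = 1 ↔ G.Adj x u := hctx.adj x u
  have dec : opp (l x) < 3 ↔ Dec l x := opp_lt_three
  unfold optsAt
  by_cases c1 : l u = 4
  · by_cases c2 : l x = 4
    · by_cases c3 : u = x
      · have c3' : (u : ℕ) = x := by rw [c3]
        simp only [c2, c3, if_true]
        subst c3
        exact ⟨hA, by rw [rA _ rfl (by norm_num)]; simp [hs₂, f7],
          by rw [rA _ rfl (by norm_num)]; simp [hs₂]⟩
      · have c3' : ¬ (u : ℕ) = x := fun e => c3 (Fin.ext e)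
        simp only [c1, c2, c3', c3, if_true, if_false, List.append_nil]
        exact ⟨h1, f7, f8⟩
    · by_cases c3 : Dec l x
      · by_cases c4 : G.Adj x u
        · simp only [c1, c2, dec, adj, c3, c4, if_true, if_false]
          exact ⟨hB, by rw [rB _ rfl (by norm_num)]; simp [hs₂, f7],
            by rw [rB _ rfl (by norm_num)]; simp [hs₂]⟩
        · simp only [c1, c2, dec, adj, c3, c4, if_true, if_false, List.append_nil]
          exact ⟨h1, f7, f8⟩
      · simp only [c1, c2, dec, c3, if_true, if_false, List.append_nil]
        exact ⟨h1, f7, f8⟩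
  · simp only [c1, if_false, List.append_nil]
    exact ⟨h1, f7, f8⟩

/-! ### Choosing the vertex to branch on. -/

/-- Examine the branches on `rCand`, and keep them on the stack if they are cheap enough. -/
def candMain : Stmt := block [
  .loop rU optsStmt,
  .ite (.neq rAut 8) (.op (.const rDone 1))
    (.ite (.eq rOpt 8) (block [.op (.copy rCnt rCntSave), .op (.copy rPtr rPtrSave)])
      (.ite (.lt 7 rAcc) (block [.op (.copy rCnt rCntSave), .op (.copy rPtr rPtrSave)])
        (.op (.const rDone 1))))]

/-- Try to branch on `rCand`. -/
def candStmt : Stmt := block [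
  .op (.copy rCntSave rCnt), .op (.copy rPtrSave rPtr), .op (.const rAcc 0), .op (.const rAut 0),
  .op (.const rOpt 0), .op (.load rLabCand 3 rCand), .op (.const rLabOpp 7),
  when (.eq rLabCand 1) (.op (.const rLabOpp 2)), when (.eq rLabCand 2) (.op (.const rLabOpp 1)),
  candMain]

/-- The preparations of `candStmt`. -/
theorem candStmt_prefix (h : Ctx G s) (S : Stmt) {x : Fin n} (hx : s.reg rCand = x) :
    ∃ s₁, (block [
      .op (.copy rCntSave rCnt), .op (.copy rPtrSave rPtr), .op (.const rAcc 0),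
      .op (.const rAut 0), .op (.const rOpt 0), .op (.load rLabCand 3 rCand),
      .op (.const rLabOpp 7), when (.eq rLabCand 1) (.op (.const rLabOpp 2)),
      when (.eq rLabCand 2) (.op (.const rLabOpp 1)), S]).eval s = S.eval s₁ ∧
    s₁.arr = s.arr ∧ s₁.reg rCntSave = s.reg rCnt ∧ s₁.reg rPtrSave = s.reg rPtr ∧
    s₁.reg rAcc = 0 ∧ s₁.reg rAut = 0 ∧ s₁.reg rOpt = 0 ∧ s₁.reg rLabCand = lab n s 3 x ∧
    s₁.reg rLabOpp = opp (lab n s 3 x) ∧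
    ∀ r, (r < 11 ∨ r = rCand ∨ r = rRow ∨ r = rActSave ∨ r = rDone) → s₁.reg r = s.reg r := by
  set s₀ := ((((((s.setReg rCntSave (s.reg rCnt)).setReg rPtrSave (s.reg rPtr)).setReg rAcc 0).setReg
    rAut 0).setReg rOpt 0).setReg rLabCand (lab n s 3 x)).setReg rLabOpp 7 with hs₀
  have e : (block [
      .op (.copy rCntSave rCnt), .op (.copy rPtrSave rPtr), .op (.const rAcc 0),
      .op (.const rAut 0), .op (.const rOpt 0), .op (.load rLabCand 3 rCand),
      .op (.const rLabOpp 7), when (.eq rLabCand 1) (.op (.const rLabOpp 2)),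
      when (.eq rLabCand 2) (.op (.const rLabOpp 1)), S]).eval s =
      S.eval (s₀.setReg rLabOpp (opp (lab n s 3 x))) := by
    have hl : s.arr 3 x = lab n s 3 x := rfl
    have id7 : s₀ = s₀.setReg rLabOpp 7 := by
      ext r <;> simp [hs₀]
      intro hr; simp [hr]
    unfold opp
    rcases Classical.propComplete (lab n s 3 x = 1) with c1 | c1 <;>
      rcases Classical.propComplete (lab n s 3 x = 2) with c2 | c2
    · exfalso; simp only [eq_iff_iff, iff_true] at c1 c2; omega
    · simp only [block, Stmt.eval, Op.apply, when, Test.Holds, Store.setReg_reg, Store.setReg_arr]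
      norm_num
      simp only [hx, hl, h.reg1, c1, c2, if_true, if_false, ← hs₀, Store.setReg_reg]
      norm_num
      simp [hs₀, h.reg2, c2]
    · simp only [block, Stmt.eval, Op.apply, when, Test.Holds, Store.setReg_reg, Store.setReg_arr]
      norm_num
      simp only [hx, hl, h.reg1, c1, c2, if_true, if_false, ← hs₀]
      simp [hs₀, h.reg2, c2]
    · simp only [block, Stmt.eval, Op.apply, when, Test.Holds, Store.setReg_reg, Store.setReg_arr]
      norm_num
      simp only [hx, hl, h.reg1, c1, c2, if_false, ← hs₀]
      rw [← id7]
      simp [hs₀, h.reg2, c2]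
  refine ⟨_, e, rfl, ?_, ?_, ?_, ?_, ?_, ?_, ?_, fun r hr => ?_⟩
  · simp [hs₀]
  · simp [hs₀]
  · simp [hs₀]
  · simp [hs₀]
  · simp [hs₀]
  · simp [hs₀]
  · simp [hs₀]
  · have : r ≠ rLabOpp ∧ r ≠ rLabCand ∧ r ≠ rOpt ∧ r ≠ rAut ∧ r ≠ rAcc ∧ r ≠ rPtrSave ∧
      r ≠ rCntSave := by omega
    simp [hs₀, this]

theorem candMain_spec {L₀ : List (Fin n → ℕ)} (hl : Entry G l) (h : OptState G l L₀ [] s)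
    {x : Fin n} (hx : s.reg rCand = x) (hlx : s.reg rLabCand = l x)
    (hlo : s.reg rLabOpp = opp (l x)) (hrow : s.reg rRow = x * n) (hopt : s.reg rOpt = 0)
    (hdone : s.reg rDone = 0) :
    ((candMain.eval s).reg rDone ≠ 0 ∧ ∃ L, Expands G l L ∧ Stack n (candMain.eval s) (L₀ ++ L)) ∨
    ((candMain.eval s).reg rDone = 0 ∧ Stack n (candMain.eval s) L₀ ∧
      (candMain.eval s).reg rRow = (x + 1) * n ∧ ¬ GoodBranch G l x) := by
  have key := eval_loop_induction (s := s) (x := rU) (P := optsStmt)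
    (fun i s' => OptState G l L₀ (optsTo G l x i) s' ∧ s'.reg rRow = x * n + i ∧
      (s'.reg rOpt ≠ 0 ↔ optsTo G l x i ≠ [])) rfl
    ⟨h.of_eq (fun r hr => by simp [show r ≠ rU by omega]) rfl, by simp [hrow],
      by simp [hopt, optsTo]⟩ ?_
  swap
  · rintro i hi s' hr - hu ⟨k1, k2, k3⟩
    rw [h.ctx.reg0] at hi
    obtain ⟨e1, e2, e3⟩ := optsStmt_spec k1 (u := ⟨i, hi⟩) hu ((hr _ rfl).trans hx)
      ((hr _ rfl).trans hlx) ((hr _ rfl).trans hlo) k2 k3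
    refine ⟨?_, ?_, ?_⟩
    · rw [optsTo, dif_pos hi]
      exact e1.of_eq (fun r hr => by simp [show r ≠ rU by omega]) rfl
    · simpa [add_assoc] using e2
    · rw [optsTo, dif_pos hi]
      simpa using e3
  rw [h.ctx.reg0] at key
  obtain ⟨k1, k2, k3⟩ := key
  have hdone' : ((Stmt.loop rU optsStmt).eval s).reg rDone = 0 := (eval_reg rfl s).trans hdone
  have ev : candMain.eval s = (Stmt.ite (.neq rAut 8) (.op (.const rDone 1))
    (.ite (.eq rOpt 8) (block [.op (.copy rCnt rCntSave), .op (.copy rPtr rPtrSave)])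
      (.ite (.lt 7 rAcc) (block [.op (.copy rCnt rCntSave), .op (.copy rPtr rPtrSave)])
        (.op (.const rDone 1))))).eval ((Stmt.loop rU optsStmt).eval s) := rfl
  rw [ev]
  generalize (Stmt.loop rU optsStmt).eval s = s₁ at *
  have c1 := k1.ctx
  have hev : (Stmt.ite (.neq rAut 8) (.op (.const rDone 1))
    (.ite (.eq rOpt 8) (block [.op (.copy rCnt rCntSave), .op (.copy rPtr rPtrSave)])
      (.ite (.lt 7 rAcc) (block [.op (.copy rCnt rCntSave), .op (.copy rPtr rPtrSave)])
        (.op (.const rDone 1))))).eval s₁ =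
      if s₁.reg rAut ≠ 0 then s₁.setReg rDone 1
      else if s₁.reg rOpt = 0 then (s₁.setReg rCnt L₀.length).setReg rPtr (L₀.length * n)
      else if 34 < s₁.reg rAcc then (s₁.setReg rCnt L₀.length).setReg rPtr (L₀.length * n)
      else s₁.setReg rDone 1 := by
    have : (s₁.setReg rCnt L₀.length).reg rPtrSave = L₀.length * n := by simp [k1.ptrSave]
    simp only [Stmt.eval, block, Test.Holds, Op.apply, c1.reg8, c1.reg7, k1.cntSave, this]
  rw [hev]
  have hrow' : ∀ a b, ((s₁.setReg rCnt a).setReg rPtr b).reg rRow = (x + 1) * n := by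
    intro a b
    simp [k2, Nat.add_mul]
  have hst : ∀ {L}, Stack n s₁ (L₀ ++ L) →
      Stack n ((s₁.setReg rCnt L₀.length).setReg rPtr (L₀.length * n)) L₀ := fun hL =>
    ⟨by simp, by simp, hL.cells.left⟩
  have hd : ∀ {L}, Stack n s₁ L → Stack n (s₁.setReg rDone 1) L := fun hL =>
    hL.of_eq (by simp) (by simp) rfl
  rcases k1.cases with ⟨e1, e2, e3, e4⟩ | ⟨e1, o, ho, h1, h2, h3⟩
  · rw [if_neg (by simpa using e1)]
    -- An empty list of branches has total weight `0` and would pass the test of the budget,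
    -- although it covers nothing; `rOpt` excludes it.
    by_cases hno : optsTo G l x n = []
    · right
      rw [if_pos (by by_contra hh; exact k3.1 hh hno)]
      refine ⟨by simp [hdone'], hst e2, hrow' _ _, fun hg => ?_⟩
      obtain ⟨u, c, ho⟩ := hg.exists_option
      have : (u, c) ∈ optsTo G l x n := mem_optsTo.2 ⟨u.2, ho⟩
      simp [hno] at this
    · rw [if_neg (k3.2 hno)]
      have hex : ∃ u c, IsOption G l x u c := by
        obtain ⟨o, ho⟩ := List.exists_mem_of_ne_nil _ hno
        exact ⟨o.1, o.2, (mem_optsTo.1 ho).2⟩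
      by_cases h34 : 34 < s₁.reg rAcc
      · right
        rw [if_pos h34]
        refine ⟨by simp [hdone'], hst e2, hrow' _ _, fun hg => ?_⟩
        rw [e3, sum_optsTo] at h34
        rcases hg.2 with hg | ⟨u, c, ho, hc, haut⟩
        · omega
        · exact e4 (u, c) (mem_optsTo.2 ⟨u.2, ho⟩) hc haut
      · left
        rw [if_neg h34]
        exact ⟨by simp, _, expands_children hl hex (by rw [← e3]; omega), hd e2⟩
  · left
    rw [if_pos e1]
    exact ⟨by simp, _, expands_single hl (mem_optsTo.1 ho).2 h1 h2, hd h3⟩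

theorem candStmt_spec {L₀ : List (Fin n → ℕ)} (hl : Entry G l) (h : Ctx G s) (h3 : lab n s 3 = l)
    (hact : s.reg rActSave ≠ 0 ↔ ¬ NoActive G l) (hst : Stack n s L₀)
    {x : Fin n} (hx : s.reg rCand = x) (hrow : s.reg rRow = x * n) (hdone : s.reg rDone = 0) :
    ((candStmt.eval s).reg rDone ≠ 0 ∧ ∃ L, Expands G l L ∧ Stack n (candStmt.eval s) (L₀ ++ L)) ∨
    ((candStmt.eval s).reg rDone = 0 ∧ Stack n (candStmt.eval s) L₀ ∧
      (candStmt.eval s).reg rRow = (x + 1) * n ∧ ¬ GoodBranch G l x) := by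
  obtain ⟨s₁, e, a1, a2, a3, a4, a5, a6, a7, a8, a9⟩ := candStmt_prefix h candMain hx
  have hc : Ctx G s₁ := h.of_eq (fun r hr => a9 r (by omega)) (by rw [a1])
  have ho : OptState G l L₀ [] s₁ := by
    refine ⟨hc, ?_, a2.trans hst.cnt, a3.trans hst.ptr, by rw [a9 _ (by norm_num)]; exact hact,
      Or.inl ⟨a5, ?_, by simpa using a4, by simp⟩⟩
    · rw [← h3]; unfold lab; rw [a1]
    · have := hst.of_eq (s' := s₁) (a9 _ (by norm_num)) (a9 _ (by norm_num)) (by rw [a1])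
      simpa [children] using this
  rw [h3] at a7 a8
  have := candMain_spec hl ho ((a9 _ (by norm_num)).trans hx) a7 a8
    ((a9 _ (by norm_num)).trans hrow) a6 ((a9 _ (by norm_num)).trans hdone)
  rw [← e] at this
  exact this

/-- Replace the labeling in array `3` by cheap branches. -/
def expandStmt : Stmt := block [
  copyStmt 3 4, scan, .op (.copy rActSave rAct), .op (.const rDone 0), .op (.const rRow 0),
  .loop rCand (when (.eq rDone 8) candStmt)]

/-- A rejected candidate is not good, and `exists_goodBranch` provides a good one, so the loop
cannot reject them all. -/
theorem expandStmt_spec {L₀ : List (Fin n → ℕ)} (hl : Entry G l) (hfree : ∃ v, l v = 4)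
    (h : Ctx G s) (h3 : lab n s 3 = l) (hst : Stack n s L₀) :
    ∃ L, Expands G l L ∧ Stack n (expandStmt.eval s) (L₀ ++ L) := by
  set s₁ := (copyStmt 3 4).eval s with hs₁
  have c1 : Ctx G s₁ := h.eval rfl
  have l4 : lab n s₁ 4 = l := (copyStmt_spec h.reg0 (by norm_num)).trans h3
  have l3 : lab n s₁ 3 = l := (lab_eval rfl s).trans h3
  have st1 : Stack n s₁ L₀ := hst.eval rfl
  set s₂ := scan.eval s₁ with hs₂
  have c2 : Ctx G s₂ := c1.eval rfl
  have l23 : lab n s₂ 3 = l := (lab_eval rfl s₁).trans l3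
  have st2 : Stack n s₂ L₀ := st1.eval rfl
  obtain ⟨-, p2, -⟩ := scan_spec c1
  rw [l4, ← hs₂] at p2
  set s₃ := ((s₂.setReg rActSave (s₂.reg rAct)).setReg rDone 0).setReg rRow 0 with hs₃
  have c3 : Ctx G s₃ := ((c2.setReg (by norm_num)).setReg (by norm_num)).setReg (by norm_num)
  have st3 : Stack n s₃ L₀ := st2.of_eq (by simp [hs₃]) (by simp [hs₃]) rfl
  have act3 : s₃.reg rActSave ≠ 0 ↔ ¬ NoActive G l := by rw [← p2]; simp [hs₃]
  have ev : expandStmt.eval s = (Stmt.loop rCand (when (.eq rDone 8) candStmt)).eval s₃ := rfl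
  rw [ev]
  have l33 : lab n s₃ 3 = l := l23
  clear_value s₃
  have key := eval_loop_induction (s := s₃) (x := rCand) (P := when (.eq rDone 8) candStmt)
    (fun i s' => (s'.reg rDone ≠ 0 ∧ ∃ L, Expands G l L ∧ Stack n s' (L₀ ++ L)) ∨
      (s'.reg rDone = 0 ∧ Stack n s' L₀ ∧ s'.reg rRow = i * n ∧
        ∀ x : Fin n, x.1 < i → ¬ GoodBranch G l x)) rfl
    (Or.inr ⟨by simp [hs₃], st3.of_eq (by simp) (by simp) rfl, by simp [hs₃],
      fun x hx => absurd hx (Nat.not_lt_zero _)⟩) ?_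
  · rw [c3.reg0] at key
    rcases key with ⟨-, hL⟩ | ⟨-, -, -, hbad⟩
    · exact hL
    · exfalso
      obtain ⟨x, hx⟩ := exists_goodBranch (hl.2.2.imp_right fun h x hx => absurd hx (h x)) hl.2.1
        hfree
      exact hbad x x.2 hx
  · rintro i hi s' hr ha hx hI
    rw [c3.reg0] at hi
    have hc : Ctx G s' :=
      c3.of_eq (fun r hr' => hr r (by interval_cases r <;> rfl)) (ha 0 rfl)
    have hstep : ∀ s'' L v, Stack n s'' L → Stack n (s''.setReg rCand v) L := fun _ _ _ hL =>
      hL.of_eq (by simp) (by simp) rfl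
    have hev : (when (.eq rDone 8) candStmt).eval s' =
        if s'.reg rDone = 0 then candStmt.eval s' else s' := by
      rw [when, Stmt.eval]
      simp only [Test.Holds, hc.reg8]
      rfl
    rw [hev]
    rcases hI with ⟨d, L, hL, hL'⟩ | ⟨d, hL, hrow, hbad⟩
    · left
      rw [if_neg d]
      exact ⟨by simpa using d, L, hL, hstep _ _ _ hL'⟩
    · rw [if_pos d]
      have l3' : lab n s' 3 = l := by
        unfold lab
        rw [ha 3 rfl]
        exact l33
      rcases candStmt_spec hl hc l3' (by rw [hr _ rfl]; exact act3) hL (x := ⟨i, hi⟩) hx hrow d with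
        ⟨e1, L, e2, e3⟩ | ⟨e1, e2, e3, e4⟩
      · exact Or.inl ⟨by simpa using e1, L, e2, hstep _ _ _ e3⟩
      · refine Or.inr ⟨by simpa using e1, hstep _ _ _ e2, by simpa using e3, fun y hy => ?_⟩
        rcases Nat.lt_succ_iff_lt_or_eq.1 hy with hy | hy
        · exact hbad y hy
        · have : y = ⟨i, hi⟩ := Fin.ext hy
          exact this ▸ e4

end PMS

namespace PMS

open Finset RAM RAM.Stmt

local notation "rBest" => (11 : ℕ)
local notation "rConf" => (12 : ℕ)
local notation "rFound" => (51 : ℕ)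
local notation "rZ" => (52 : ℕ)
local notation "rI" => (53 : ℕ)
local notation "rLab" => (54 : ℕ)
local notation "rLhs" => (55 : ℕ)
local notation "rRhs" => (56 : ℕ)
local notation "rNum" => (57 : ℕ)

variable {n : ℕ} {G : SimpleGraph (Fin n)} {s : Store} {l : Fin n → ℕ}

/-! #### Searching and counting labels -/

/-- Look for a vertex whose label in array `3` is the content of register `k`. -/
def findStmt (k : ℕ) : Stmt := block [
  .op (.const rFound 0),
  .loop rI (block [.op (.load rLab 3 rI),
    when (.eq rLab k) (block [.op (.const rFound 1), .op (.copy rZ rI)])])]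

theorem findStmt_spec {k : ℕ} (hk : k < 9) (hn : s.reg 0 = n) :
    ((findStmt k).eval s).reg rFound = 0 ∧ (∀ v, lab n s 3 v ≠ s.reg k) ∨
    ((findStmt k).eval s).reg rFound ≠ 0 ∧
      ∃ v : Fin n, ((findStmt k).eval s).reg rZ = v ∧ lab n s 3 v = s.reg k := by
  have key := eval_loop_induction (s := s.setReg rFound 0) (x := rI)
    (P := block [.op (.load rLab 3 rI),
      when (.eq rLab k) (block [.op (.const rFound 1), .op (.copy rZ rI)])])
    (fun i s' => s'.reg rFound = 0 ∧ (∀ v : Fin n, v.1 < i → lab n s 3 v ≠ s.reg k) ∨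
      s'.reg rFound ≠ 0 ∧ ∃ v : Fin n, s'.reg rZ = v ∧ lab n s 3 v = s.reg k) rfl
    (Or.inl ⟨by simp, fun v hv => absurd hv (Nat.not_lt_zero _)⟩) ?_
  · rw [Store.setReg_reg, if_neg (by norm_num), hn] at key
    rcases key with ⟨h, h'⟩ | h
    · exact Or.inl ⟨h, fun v => h' v v.2⟩
    · exact Or.inr h
  · rintro i hi s' hr ha hx hI
    rw [Store.setReg_reg, if_neg (by norm_num), hn] at hi
    have hk' : s'.reg k = s.reg k := by
      rw [hr k (by simp [block, writesReg, when, Op.writesReg]; omega), Store.setReg_reg,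
        if_neg (by omega)]
    have a3 : s'.arr 3 = s.arr 3 := ha 3 rfl
    have hk54 : k ≠ 54 := by omega
    rcases Classical.propComplete (s.arr 3 i = s.reg k) with c | c
    · refine Or.inr ⟨?_, ⟨i, hi⟩, ?_, of_eq_true c⟩ <;>
        simp [block, Stmt.eval, Op.apply, when, Test.Holds, hk', hk54, a3, hx, c]
    · have e : (block [.op (.load rLab 3 rI),
          when (.eq rLab k) (block [.op (.const rFound 1), .op (.copy rZ rI)])]).eval s' =
          s'.setReg rLab (s.arr 3 i) := by
        simp [block, Stmt.eval, Op.apply, when, Test.Holds, hk', hk54, a3, hx, c]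
      rw [e]
      rcases hI with ⟨h, h'⟩ | ⟨h, v, h'⟩
      · refine Or.inl ⟨by simpa using h, fun v hv => ?_⟩
        rcases Nat.lt_succ_iff_lt_or_eq.1 hv with hv | hv
        · exact h' v hv
        · have : v = ⟨i, hi⟩ := Fin.ext hv
          exact this ▸ of_eq_false c
      · exact Or.inr ⟨by simpa using h, v, by simpa using h'⟩

/-- Compute `27` times the number of occurrences of the content of register `p` in array `4`, and
`g` times the number of vertices. -/
def limStmt (p g : ℕ) : Stmt := block [
  .op (.const rLhs 0), .op (.const rRhs 0),
  .loop rI (block [.op (.load rLab 4 rI), when (.eq rLab p) (incBy rLhs 27), incBy rRhs g])]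

theorem writesReg_incBy (x k r : ℕ) : (incBy x k).writesReg r = (r == x && k != 0) := by
  induction k with
  | zero => simp [incBy, writesReg]
  | succ k ih =>
    simp only [incBy, writesReg, Op.writesReg, ih]
    cases r == x <;> simp

theorem writesArr_incBy (x k b : ℕ) : (incBy x k).writesArr b = false := by
  induction k with
  | zero => rfl
  | succ k ih => simpa [incBy, writesArr, Op.writesArr] using ih

theorem wf_incBy (x k : ℕ) : (incBy x k).wf = true := by
  induction k with
  | zero => rfl
  | succ k ih => simpa [incBy, wf] using ih

/-- Both sides of the limit are accumulated by repeated increments, since neither products nor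
quotients are available. -/
theorem limStmt_spec {p g : ℕ} (hp : p < 9) (hn : s.reg 0 = n) :
    ((limStmt p g).eval s).reg rLhs = 27 * numLab (lab n s 4) (s.reg p) ∧
    ((limStmt p g).eval s).reg rRhs = g * n := by
  have key := eval_loop_induction (s := (s.setReg rLhs 0).setReg rRhs 0) (x := rI)
    (P := block [.op (.load rLab 4 rI), when (.eq rLab p) (incBy rLhs 27), incBy rRhs g])
    (fun i s' => s'.reg rLhs = 27 * Nat.count (fun j => s.arr 4 j = s.reg p) i ∧
      s'.reg rRhs = g * i)
    (by simp [wf, block, when, writesReg, Op.writesReg, writesReg_incBy, wf_incBy]) (by simp) ?_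
  · rw [Store.setReg_reg, if_neg (by norm_num), Store.setReg_reg, if_neg (by norm_num), hn] at key
    rw [count_eq_card _ (fun v : Fin n => lab n s 4 v = s.reg p) (fun v => Iff.rfl)] at key
    exact key
  · rintro i hi s' hr ha hx ⟨e1, e2⟩
    have hp' : s'.reg p = s.reg p := by
      rw [hr p (by simp [block, writesReg, when, Op.writesReg, writesReg_incBy]; omega),
        Store.setReg_reg, if_neg (by omega), Store.setReg_reg, if_neg (by omega)]
    have a4 : s'.arr 4 = s.arr 4 :=
      ha 4 (by simp [block, writesArr, when, Op.writesArr, writesArr_incBy])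
    have hp54 : p ≠ 54 := by omega
    simp only [Nat.count_succ]
    rcases Classical.propComplete (s.arr 4 i = s.reg p) with c | c <;>
      simp [block, Stmt.eval, Op.apply, when, Test.Holds, eval_incBy, hp', hp54, a4, hx, c, e1, e2,
        Nat.mul_add]

/-! #### Branching at an undecided vertex -/

/-- Push the two labelings that give the vertex `rZ` the labels `q` and `p`; the latter only if the
label `p` does not occur too often. -/
def branchStmt (p q g : ℕ) : Stmt := block [
  copyStmt 3 4, .op (.store 4 rZ q), pushStmt, .op (.store 4 rZ p), limStmt p g,
  when (.nlt rRhs rLhs) pushStmt]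

/-- The labelings that arise by labeling the vertex `z`. -/
def branch (p q g : ℕ) (l : Fin n → ℕ) (z : Fin n) : List (Fin n → ℕ) :=
  Function.update l z q :: if 27 * numLab (Function.update l z p) p ≤ g * n then
    [Function.update l z p] else []

theorem keeps_limStmt (p g : ℕ) : keeps (limStmt p g) = true ∧ keepsStack (limStmt p g) = true ∧
    (limStmt p g).writesArr 4 = false := by
  have h : ∀ r, r < 53 → (limStmt p g).writesReg r = false := by
    intro r hr
    simp [limStmt, block, writesReg, when, Op.writesReg, writesReg_incBy]
    omega
  have h' : ∀ a, (limStmt p g).writesArr a = false := by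
    intro a
    simp [limStmt, block, writesArr, when, Op.writesArr, writesArr_incBy]
  refine ⟨?_, by simp [keepsStack, h, h'], h' 4⟩
  simp only [keeps, Bool.and_eq_true, List.all_eq_true, List.mem_range, Bool.not_eq_true', h',
    and_true]
  exact fun r hr => h r (by omega)

/-- The numbers `p` and `q` serve as labels and as names of the registers holding these labels, so
one routine serves both trees. -/
theorem branchStmt_spec {p q g : ℕ} (hp : p < 9) (hq : q < 9) (hsp : s.reg p = p)
    (hsq : s.reg q = q) {L : List (Fin n → ℕ)} {z : Fin n} (h : Ctx G s) (hst : Stack n s L)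
    (hz : s.reg rZ = z) :
    Stack n ((branchStmt p q g).eval s) (L ++ branch p q g (lab n s 3) z) ∧
    ((branchStmt p q g).eval s).reg rBest = s.reg rBest ∧
    ((branchStmt p q g).eval s).arr 1 = s.arr 1 ∧ Ctx G ((branchStmt p q g).eval s) := by
  have lt9 : ∀ {S : Stmt} (s : Store) {k}, keeps S = true → k < 9 → (S.eval s).reg k = s.reg k := by
    intro S s k hS hk
    simp only [keeps, Bool.and_eq_true, List.all_eq_true, List.mem_range, Bool.not_eq_true'] at hS
    exact eval_reg (hS.1 k hk) s
  set l := lab n s 3 with hl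
  set s₁ := (copyStmt 3 4).eval s with hs₁
  have c1 : Ctx G s₁ := h.eval rfl
  have l1 : lab n s₁ 4 = l := copyStmt_spec h.reg0 (by norm_num)
  have st1 : Stack n s₁ L := hst.eval rfl
  have z1 : s₁.reg rZ = z := (eval_reg rfl s).trans hz
  have p1 : s₁.reg p = p := (lt9 s rfl hp).trans hsp
  have q1 : s₁.reg q = q := (lt9 s rfl hq).trans hsq
  set s₂ := s₁.setArr 4 z q with hs₂
  have c2 : Ctx G s₂ := c1.setArr (by norm_num)
  have l2 : lab n s₂ 4 = Function.update l z q := by rw [hs₂, lab_store _ rfl, l1]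
  have st2 : Stack n s₂ L := st1.of_eq rfl rfl (by simp [hs₂, Store.setArr_arr])
  have st3 := pushStmt_spec c2.reg0 st2
  rw [l2] at st3
  have c3 : Ctx G (pushStmt.eval s₂) := c2.eval rfl
  have l3 : lab n (pushStmt.eval s₂) 4 = Function.update l z q := (lab_eval rfl s₂).trans l2
  have z3 : (pushStmt.eval s₂).reg rZ = z := (eval_reg rfl s₂).trans z1
  have p3 : (pushStmt.eval s₂).reg p = p := (lt9 s₂ rfl hp).trans p1
  have b3 : (pushStmt.eval s₂).reg rBest = s.reg rBest := (eval_reg rfl s₂).trans (eval_reg rfl s)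
  have o3 : (pushStmt.eval s₂).arr 1 = s.arr 1 := by
    rw [eval_arr rfl, hs₂, Store.setArr_arr, if_neg (by norm_num), hs₁, eval_arr rfl]
  have ev : (branchStmt p q g).eval s = (when (.nlt rRhs rLhs) pushStmt).eval
      ((limStmt p g).eval ((pushStmt.eval s₂).setArr 4 z p)) := by
    have e1 : (Op.store 4 rZ q).apply s₁ = s₂ := by simp [Op.apply, z1, q1, hs₂]
    have e2 : (Op.store 4 rZ p).apply (pushStmt.eval s₂) = (pushStmt.eval s₂).setArr 4 z p := by
      simp [Op.apply, z3, p3]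
    rw [← e2, ← e1]
    rfl
  rw [ev]
  generalize pushStmt.eval s₂ = s₃ at *
  set s₄ := s₃.setArr 4 z p with hs₄
  have c4 : Ctx G s₄ := c3.setArr (by norm_num)
  have l4 : lab n s₄ 4 = Function.update l z p := by
    rw [hs₄, lab_store _ rfl, l3, Function.update_idem]
  have p4 : s₄.reg p = p := p3
  have st4 : Stack n s₄ (L ++ [Function.update l z q]) :=
    st3.of_eq rfl rfl (by simp [hs₄, Store.setArr_arr])
  have b4 : s₄.reg rBest = s.reg rBest := b3
  have o4 : s₄.arr 1 = s.arr 1 := by rw [hs₄, Store.setArr_arr, if_neg (by norm_num), o3]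
  obtain ⟨k1, k2, k3⟩ := keeps_limStmt p g
  obtain ⟨e1, e2⟩ := limStmt_spec (g := g) hp c4.reg0
  rw [l4, p4] at e1
  have c5 : Ctx G ((limStmt p g).eval s₄) := c4.eval k1
  have l5 := (lab_eval (n := n) k3 s₄).trans l4
  have st5 := st4.eval k2
  have b5 : ((limStmt p g).eval s₄).reg rBest = s.reg rBest := by
    rw [eval_reg _ s₄, b4]
    simp [limStmt, block, writesReg, when, Op.writesReg, writesReg_incBy]
  have o5 : ((limStmt p g).eval s₄).arr 1 = s.arr 1 := by
    rw [eval_arr _ s₄, o4]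
    simp [limStmt, block, writesArr, when, Op.writesArr, writesArr_incBy]
  generalize (limStmt p g).eval s₄ = s₅ at *
  have ev2 : (when (.nlt rRhs rLhs) pushStmt).eval s₅ =
      if 27 * numLab (Function.update l z p) p ≤ g * n then pushStmt.eval s₅ else s₅ := by
    simp only [when, Stmt.eval, Test.Holds, e1, e2, not_lt]
  rw [ev2, branch]
  split_ifs
  · have := pushStmt_spec c5.reg0 st5
    rw [l5] at this
    exact ⟨by simpa using this, (eval_reg rfl s₅).trans b5, (eval_arr rfl s₅).trans o5, c5.eval rfl⟩
  · exact ⟨st5, b5, o5, c5⟩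

/-! #### Recording a pair of perfectly matched sets -/

/-- The output is a pair of perfectly matched sets, and its size is stored. -/
def Out (G : SimpleGraph (Fin n)) (s : Store) : Prop :=
  IsPerfectlyMatched G (outputSet n s 1) (outputSet n s 2) ∧
    s.reg rBest = (outputSet n s 1).card

theorem Out.of_eq {s' : Store} (h : Out G s) (h1 : s'.reg rBest = s.reg rBest)
    (h2 : s'.arr 1 = s.arr 1) : Out G s' := by
  unfold Out outputSet at *
  rw [h1, h2]
  exact h

/-- Record the labeling in array `4` if it describes a pair larger than the best one so far. -/
def recordStmt : Stmt := block [
  scan, .op (.const rNum 0),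
  .loop rI (block [.op (.load rLab 4 rI), when (.eq rLab 1) (.op (.inc rNum))]),
  when (.eq rConf 8) (when (.lt rBest rNum) (block [copyStmt 4 1, .op (.copy rBest rNum)]))]

/-- The output is overwritten only by a strictly larger labeling without conflicts, so it describes
a valid pair at all times and its size never decreases. -/
theorem recordStmt_spec (h : Ctx G s) (ho : Out G s)
    (hl : ∀ v, lab n s 4 v = 1 ∨ lab n s 4 v = 2 ∨ lab n s 4 v = 3) :
    Out G (recordStmt.eval s) ∧ s.reg rBest ≤ (recordStmt.eval s).reg rBest ∧
    (¬ Conf G (lab n s 4) → numLab (lab n s 4) 1 ≤ (recordStmt.eval s).reg rBest) := by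
  obtain ⟨p1, -, -⟩ := scan_spec h
  set s₁ := (scan.eval s).setReg rNum 0 with hs₁
  have c1 : Ctx G s₁ := (h.eval (S := scan) rfl).setReg (by norm_num)
  have l1 : lab n s₁ 4 = lab n s 4 := lab_eval (S := scan) rfl s
  have b1 : s₁.reg rBest = s.reg rBest := eval_reg (S := scan) rfl s
  have o1 : s₁.arr 1 = s.arr 1 := eval_arr (S := scan) rfl s
  have p1' : s₁.reg rConf ≠ 0 ↔ Conf G (lab n s 4) := p1
  have key := eval_loop_induction (s := s₁) (x := rI)
    (P := block [.op (.load rLab 4 rI), when (.eq rLab 1) (.op (.inc rNum))])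
    (fun i s' => s'.reg rNum = Nat.count (fun j => s₁.arr 4 j = 1) i) rfl
    (by simp [hs₁]) ?_
  swap
  · rintro i hi s' hr ha hx e
    have r1 : s'.reg 1 = 1 := (hr 1 rfl).trans c1.reg1
    have a4 := ha 4 rfl
    simp only [Nat.count_succ]
    rcases Classical.propComplete (s₁.arr 4 i = 1) with c | c <;>
      simp [block, Stmt.eval, Op.apply, when, Test.Holds, r1, a4, hx, c, e]
  rw [c1.reg0, count_eq_card _ (fun v : Fin n => lab n s₁ 4 v = 1) (fun v => Iff.rfl)] at key
  have ev : recordStmt.eval s = (when (.eq rConf 8) (when (.lt rBest rNum)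
      (block [copyStmt 4 1, .op (.copy rBest rNum)]))).eval ((Stmt.loop rI (block [
        .op (.load rLab 4 rI), when (.eq rLab 1) (.op (.inc rNum))])).eval s₁) := rfl
  have c2 : Ctx G ((Stmt.loop rI (block [
        .op (.load rLab 4 rI), when (.eq rLab 1) (.op (.inc rNum))])).eval s₁) := c1.eval rfl
  have l2 : lab n ((Stmt.loop rI (block [
        .op (.load rLab 4 rI), when (.eq rLab 1) (.op (.inc rNum))])).eval s₁) 4 = lab n s 4 :=
    (lab_eval rfl s₁).trans l1
  have b2 : ((Stmt.loop rI (block [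
        .op (.load rLab 4 rI), when (.eq rLab 1) (.op (.inc rNum))])).eval s₁).reg rBest =
      s.reg rBest := (eval_reg rfl s₁).trans b1
  have p2 : ((Stmt.loop rI (block [
        .op (.load rLab 4 rI), when (.eq rLab 1) (.op (.inc rNum))])).eval s₁).reg rConf ≠ 0 ↔
      Conf G (lab n s 4) := by rw [eval_reg rfl s₁, p1']
  have o2 : ((Stmt.loop rI (block [
        .op (.load rLab 4 rI), when (.eq rLab 1) (.op (.inc rNum))])).eval s₁).arr 1 = s.arr 1 :=
    (eval_arr rfl s₁).trans o1
  rw [l1] at key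
  rw [ev]
  clear_value s₁
  generalize (Stmt.loop rI (block [
        .op (.load rLab 4 rI), when (.eq rLab 1) (.op (.inc rNum))])).eval s₁ = s₂ at *
  have key' : s₂.reg rNum = numLab (lab n s 4) 1 := key
  have hout : Out G s₂ := ho.of_eq b2 o2
  by_cases hc : Conf G (lab n s 4)
  · have e : (when (.eq rConf 8) (when (.lt rBest rNum)
      (block [copyStmt 4 1, .op (.copy rBest rNum)]))).eval s₂ = s₂ := by
      rw [when, Stmt.eval, if_neg]
      · rfl
      · simp only [Test.Holds, c2.reg8]
        exact p2.2 hc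
    rw [e]
    exact ⟨hout, b2.ge, fun h => absurd hc h⟩
  · have e : (when (.eq rConf 8) (when (.lt rBest rNum)
      (block [copyStmt 4 1, .op (.copy rBest rNum)]))).eval s₂ =
      if s.reg rBest < numLab (lab n s 4) 1 then
        ((copyStmt 4 1).eval s₂).setReg rBest (numLab (lab n s 4) 1) else s₂ := by
      have e0 : ((copyStmt 4 1).eval s₂).reg rNum = numLab (lab n s 4) 1 :=
        (eval_reg rfl s₂).trans key'
      rw [when, Stmt.eval, if_pos]
      · simp only [when, Stmt.eval, Test.Holds, block, Op.apply, e0, b2, key']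
      · simp only [Test.Holds, c2.reg8]
        exact not_not.1 fun h => hc (p2.1 h)
    rw [e]
    split_ifs with hlt
    · have l3 : lab n ((copyStmt 4 1).eval s₂) 1 = lab n s 4 :=
        (copyStmt_spec c2.reg0 (by norm_num)).trans l2
      have hS : IsSol G (lab n ((copyStmt 4 1).eval s₂) 1) := by
        rw [l3]
        exact ⟨hl, hc⟩
      refine ⟨⟨hS.isPerfectlyMatched, ?_⟩, by simpa using hlt.le, fun _ => by simp⟩
      rw [Store.setReg_reg, if_pos rfl, ← l3]
      rfl
    · exact ⟨hout, b2.ge, fun _ => b2 ▸ not_lt.1 hlt⟩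

end PMS

/-! ### Completing a first set greedily -/

namespace PMS

open Finset RAM RAM.Stmt

local notation "rBest" => (11 : ℕ)
local notation "rConf" => (12 : ℕ)
local notation "rFound" => (51 : ℕ)
local notation "rI" => (53 : ℕ)
local notation "rLab" => (54 : ℕ)
local notation "rNum" => (57 : ℕ)
local notation "rRow" => (58 : ℕ)
local notation "rAdj" => (59 : ℕ)
local notation "rW" => (60 : ℕ)
local notation "rLabW" => (61 : ℕ)

section

variable {V : Type*} [Fintype V] [DecidableEq V] (G : SimpleGraph V)

open Classical in
/-- The neighbours of `v` in the first set. -/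
noncomputable def oneNbrs (T : V → ℕ) (v : V) : Finset V := univ.filter fun a => G.Adj v a ∧ T a = 1

/-- The labeling makes a vertex outside the first set free if it has exactly one neighbour there. -/
noncomputable def candidates (l : V → ℕ) (v : V) : ℕ :=
  if l v = 5 then if (oneNbrs G l v).card = 1 then 4 else 3 else l v

/-- A partial second set without conflicts, where every vertex that is free or belongs to the second
set has exactly one neighbour in the first set. -/
structure IsPartial (T : V → ℕ) : Prop where
  label : ∀ v, T v = 1 ∨ T v = 2 ∨ T v = 3 ∨ T v = 4
  card_oneNbrs : ∀ v, T v = 2 ∨ T v = 4 → (oneNbrs G T v).card = 1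

open Classical in
/-- Put the free vertex `v` into the second set unless this creates a conflict. -/
noncomputable def greedy (v : V) (T : V → ℕ) : V → ℕ :=
  if T v = 4 then
    if Conf G (Function.update T v 2) then Function.update T v 3 else Function.update T v 2
  else T

variable {G} {T : V → ℕ}

theorem oneNbrs_update {v : V} {c : ℕ} (hv : T v ≠ 1) (hc : c ≠ 1) (w : V) :
    oneNbrs G (Function.update T v c) w = oneNbrs G T w := by
  ext a
  simp only [oneNbrs, mem_filter, mem_univ, true_and, Function.update_apply]
  by_cases h : a = v
  · subst h; simp [hv, hc]
  · simp [h]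

theorem IsPartial.update (h : IsPartial G T) {v : V} (hv : T v = 4) {c : ℕ} (hc : c = 2 ∨ c = 3) :
    IsPartial G (Function.update T v c) := by
  refine ⟨fun w => ?_, fun w hw => ?_⟩
  · by_cases e : w = v
    · subst e; simp; omega
    · simpa [e] using h.label w
  · rw [oneNbrs_update (by omega) (by omega)]
    refine h.card_oneNbrs w ?_
    by_cases e : w = v
    · subst e; exact Or.inr hv
    · simpa [e] using hw

theorem IsPartial.greedy (h : IsPartial G T) (v : V) : IsPartial G (greedy G v T) := by
  unfold PMS.greedy
  split_ifs with h4
  · exact h.update h4 (.inr rfl)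
  · exact h.update h4 (.inl rfl)
  · exact h

theorem oppNbrs_eq_oneNbrs {x : V} (hx : T x = 2) : oppNbrs G T x = oneNbrs G T x := by
  unfold oppNbrs oneNbrs
  rw [hx, opp_two]

/-- Conflicts concern only vertices of the first set. -/
theorem IsPartial.conf_iff (h : IsPartial G T) : Conf G T ↔ ∃ x, T x = 1 ∧
    (2 ≤ (oppNbrs G T x).card ∨ (oppNbrs G T x = ∅ ∧ freeNbrs G T x = ∅)) := by
  constructor
  · rintro ⟨x, hx | hx, h'⟩
    · exact ⟨x, hx, h'⟩
    · have := h.card_oneNbrs x (.inl hx)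
      rw [oppNbrs_eq_oneNbrs hx] at h'
      rcases h' with h' | ⟨h', -⟩
      · omega
      · simp [h'] at this
  · rintro ⟨x, hx, h'⟩
    exact ⟨x, .inl hx, h'⟩

/-- The decision on a free `v` matters to a single vertex of the first set, its only neighbour
there. Accepting `v` fails only if that vertex already has a partner, and then rejecting `v` does no
harm. -/
theorem IsPartial.not_conf_greedy (h : IsPartial G T) (hc : ¬ Conf G T) (v : V) :
    ¬ Conf G (PMS.greedy G v T) := by
  unfold PMS.greedy
  split_ifs with h4 h2
  · obtain ⟨x, hx, hx'⟩ := (h.update h4 (.inl rfl)).conf_iff.1 h2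
    rw [(h.update h4 (.inr rfl)).conf_iff]
    rintro ⟨y, hy, hy'⟩
    have one : ∀ {c : ℕ} {y}, c ≠ 1 → Function.update T v c y = 1 → T y = 1 := by
      intro c y hc e
      by_cases e' : y = v
      · subst e'; simp at e; exact absurd e hc
      · simpa [e'] using e
    have hx1 := one (by norm_num) hx
    have hy1 := one (by norm_num) hy
    have hxv : x ≠ v := by rintro rfl; omega
    have hyv : y ≠ v := by rintro rfl; omega
    have opp2 : ∀ z w, T z = 1 → w ≠ v →
        (w ∈ oppNbrs G (Function.update T v 2) z ↔ w ∈ oppNbrs G T z) := by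
      intro z w hz hw
      have hzv : z ≠ v := by rintro rfl; omega
      simp [mem_oppNbrs, hzv, hw]
    have opp3 : ∀ z, T z = 1 → oppNbrs G (Function.update T v 3) z = oppNbrs G T z := by
      intro z hz
      have hzv : z ≠ v := by rintro rfl; omega
      ext w
      by_cases hw : w = v
      · subst hw; simp [mem_oppNbrs, hzv, hz, opp_one, h4]
      · simp [mem_oppNbrs, hzv, hw]
    have adj : ∀ z, T z = 1 → ¬ G.Adj v z →
        oppNbrs G (Function.update T v 2) z = oppNbrs G T z ∧
        ∀ c, freeNbrs G (Function.update T v c) z = freeNbrs G T z := by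
      intro z hz hvz
      constructor
      · ext w
        by_cases hw : w = v
        · subst hw; simp [mem_oppNbrs, G.adj_comm z, hvz]
        · exact opp2 z w hz hw
      · intro c
        ext w
        by_cases hw : w = v
        · subst hw; simp [mem_freeNbrs, G.adj_comm z, hvz]
        · simp [mem_freeNbrs, hw]
    have hvx : G.Adj v x := by
      by_contra hvx
      obtain ⟨e1, e2⟩ := adj x hx1 hvx
      rw [e1, e2] at hx'
      exact hc ⟨x, .inl hx1, hx'⟩
    have hvy : G.Adj v y := by
      by_contra hvy
      obtain ⟨-, e2⟩ := adj y hy1 hvy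
      rw [opp3 y hy1, e2] at hy'
      exact hc ⟨y, .inl hy1, hy'⟩
    -- Both conflicts would arise next to `v`, hence at its unique neighbour in the first set.
    have hxy : x = y := by
      obtain ⟨a, ha⟩ := Finset.card_eq_one.1 (h.card_oneNbrs v (.inr h4))
      have mem : ∀ z, T z = 1 → G.Adj v z → z = a := by
        intro z hz hvz
        have : z ∈ oneNbrs G T v := by simp [oneNbrs, hz, hvz]
        simpa [ha] using this
      rw [mem x hx1 hvx, mem y hy1 hvy]
    subst hxy
    rw [opp3 x hx1] at hy'
    rcases hy' with hy' | ⟨hy', -⟩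
    · exact hc ⟨x, .inl hx1, .inl hy'⟩
    -- If rejection leaves `x` without a partner, then acceptance gives it exactly one, namely `v`,
    -- and creates no conflict.
    · have hsub : oppNbrs G (Function.update T v 2) x ⊆ {v} := by
        intro w hw
        by_contra hwv
        rw [Finset.mem_singleton] at hwv
        rw [opp2 x w hx1 hwv, hy'] at hw
        simp at hw
      have hv : v ∈ oppNbrs G (Function.update T v 2) x := by
        simp [mem_oppNbrs, hxv, hx1, opp_one, hvx.symm]
      rcases hx' with hx' | ⟨hx', -⟩
      · have := Finset.card_le_card hsub
        simp at this
        omega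
      · simp [hx'] at hv
  · exact h2
  · exact hc

theorem greedy_ne_four (v : V) (T : V → ℕ) : greedy G v T v ≠ 4 := by
  unfold greedy
  split_ifs with h <;> simp [*]

theorem greedy_of_ne {v w : V} (h : w ≠ v) (T : V → ℕ) : greedy G v T w = T w := by
  unfold greedy
  split_ifs <;> simp [h]

theorem greedy_eq_one_iff {v w : V} : greedy G v T w = 1 ↔ T w = 1 := by
  by_cases h : w = v
  · subst h
    unfold greedy
    split_ifs with h4 <;> simp [h4]
  · rw [greedy_of_ne h]

theorem isPartial_candidates {l : V → ℕ} (hl : ∀ v, l v = 1 ∨ l v = 5) :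
    IsPartial G (candidates G l) := by
  have one : ∀ v, oneNbrs G (candidates G l) v = oneNbrs G l v := by
    intro v
    ext a
    have : candidates G l a = 1 ↔ l a = 1 := by
      unfold candidates
      split_ifs <;> omega
    simp [oneNbrs, this]
  refine ⟨fun v => ?_, fun v hv => ?_⟩
  · have := hl v
    unfold candidates
    split_ifs <;> omega
  · rw [one]
    unfold candidates at hv
    have := hl v
    split_ifs at hv <;> omega

theorem candidates_eq_one_iff {l : V → ℕ} {v : V} : candidates G l v = 1 ↔ l v = 1 := by
  unfold candidates
  split_ifs <;> omega

/-- The partner in `S` of a vertex of the first set has no other neighbour there, so it is a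
candidate. Thus every vertex of the first set has a free neighbour. -/
theorem not_conf_candidates {l S : V → ℕ} (hl : ∀ v, l v = 1 ∨ l v = 5) (hS : IsSol G S)
    (h : ∀ v, S v = 1 ↔ l v = 1) : ¬ Conf G (candidates G l) := by
  have two : ∀ v, candidates G l v ≠ 2 := by
    intro v
    have := hl v
    unfold candidates
    split_ifs <;> omega
  rw [(isPartial_candidates hl).conf_iff]
  rintro ⟨x, hx, hx'⟩
  have ho : oppNbrs G (candidates G l) x = ∅ := by
    refine Finset.eq_empty_of_forall_notMem fun w hw => ?_
    rw [mem_oppNbrs, hx] at hw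
    exact two w hw.2
  have hSx : S x = 1 := (h x).2 (candidates_eq_one_iff.1 hx)
  obtain ⟨y, hxy, hy⟩ := hS.exists_opp (.inl hSx)
  rw [hSx, opp_one] at hy
  have hly : l y = 5 := by
    have := h y
    have := hl y
    omega
  have h1 : oneNbrs G l y = oppNbrs G S y := by
    rw [oppNbrs_eq_oneNbrs hy]
    ext a
    simp [oneNbrs, h]
  have h2 : (oneNbrs G l y).card = 1 := by
    rw [h1]
    have hx : x ∈ oppNbrs G S y := by simp [mem_oppNbrs, hxy.symm, hy, opp_two, hSx]
    have := Finset.card_pos.2 ⟨x, hx⟩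
    by_contra hne
    exact hS.2 ⟨y, .inr hy, .inl (by omega)⟩
  have hf : y ∈ freeNbrs G (candidates G l) x := by
    simp [mem_freeNbrs, hxy, candidates, hly, h2]
  rcases hx' with hx' | ⟨-, hx'⟩
  · simp [ho] at hx'
  · simp [hx'] at hf

end

section

variable {n : ℕ} (G : SimpleGraph (Fin n))

/-- The greedy procedure at the vertices below `i`. -/
noncomputable def greedyTo (T : Fin n → ℕ) : ℕ → Fin n → ℕ
  | 0 => T
  | i + 1 => if h : i < n then greedy G ⟨i, h⟩ (greedyTo T i) else greedyTo T i

variable {G} {T : Fin n → ℕ}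

theorem IsPartial.greedyTo (h : IsPartial G T) (i : ℕ) : IsPartial G (greedyTo G T i) := by
  induction i with
  | zero => exact h
  | succ i ih =>
    unfold PMS.greedyTo
    split
    · exact ih.greedy _
    · exact ih

theorem IsPartial.not_conf_greedyTo (h : IsPartial G T) (hc : ¬ Conf G T) (i : ℕ) :
    ¬ Conf G (PMS.greedyTo G T i) := by
  induction i with
  | zero => exact hc
  | succ i ih =>
    unfold PMS.greedyTo
    split
    · exact (h.greedyTo i).not_conf_greedy ih _
    · exact ih

theorem greedyTo_eq_one_iff (i : ℕ) (v : Fin n) : greedyTo G T i v = 1 ↔ T v = 1 := by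
  induction i with
  | zero => rfl
  | succ i ih =>
    unfold greedyTo
    split
    · rw [greedy_eq_one_iff, ih]
    · exact ih

theorem greedyTo_ne_four {i : ℕ} (hi : i ≤ n) {v : Fin n} (h : v.1 < i) :
    greedyTo G T i v ≠ 4 := by
  induction i with
  | zero => exact absurd h (Nat.not_lt_zero _)
  | succ i ih =>
    rw [greedyTo, dif_pos (show i < n from hi)]
    rcases eq_or_ne v ⟨i, hi⟩ with rfl | hne
    · exact greedy_ne_four _ _
    · rw [greedy_of_ne hne]
      exact ih (by omega) (lt_of_le_of_ne (by omega) fun e => hne (Fin.ext e))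

end

variable {n : ℕ} {G : SimpleGraph (Fin n)} {s : Store} {l : Fin n → ℕ}

/-! #### The greedy procedure on the machine -/

/-- Count the neighbours of a vertex with label `1` in array `3`. -/
def oneStmt : Stmt := .loop rI (block [.op (.load rAdj 0 rRow), .op (.inc rRow),
  when (.eq rAdj 1) (block [.op (.load rLab 3 rI), when (.eq rLab 1) (.op (.inc rNum))])])

/-- Enter the candidates for the second set into array `4`. -/
def candidatesStmt : Stmt := block [
  copyStmt 3 4, .op (.const rRow 0),
  .loop rW (block [.op (.const rNum 0), oneStmt, .op (.load rLabW 3 rW),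
    when (.eq rLabW 5) (.ite (.eq rNum 1) (.op (.store 4 rW 4)) (.op (.store 4 rW 3)))])]

/-- Put the vertices that are free in array `4` greedily into the second set. -/
def greedyStmt : Stmt := .loop rW (block [
  .op (.load rLabW 4 rW),
  when (.eq rLabW 4) (block [.op (.store 4 rW 2), scan,
    when (.neq rConf 8) (.op (.store 4 rW 3))])])

theorem oneStmt_spec (h : Ctx G s) {v : Fin n} (hr : s.reg rRow = v * n) (hN : s.reg rNum = 0) :
    (oneStmt.eval s).reg rRow = (v + 1) * n ∧
    (oneStmt.eval s).reg rNum = (oneNbrs G (lab n s 3) v).card := by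
  classical
  have key := eval_loop_induction (s := s) (x := rI)
    (P := block [.op (.load rAdj 0 rRow), .op (.inc rRow),
      when (.eq rAdj 1) (block [.op (.load rLab 3 rI), when (.eq rLab 1) (.op (.inc rNum))])])
    (fun i s' => s'.reg rRow = v * n + i ∧ s'.reg rNum =
      Nat.count (fun j => s.arr 0 (v * n + j) = 1 ∧ s.arr 3 j = 1) i) rfl (by simp [hr, hN]) ?_
  · rw [h.reg0, count_eq_card _ (fun a : Fin n => G.Adj v a ∧ lab n s 3 a = 1)
      (fun a => by rw [h.adj]; rfl)] at key
    refine ⟨key.1.trans (by ring), key.2.trans ?_⟩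
    unfold oneNbrs
    congr
  · rintro i hi s' hr ha hx ⟨e1, e2⟩
    have r1 : s'.reg 1 = 1 := (hr 1 rfl).trans h.reg1
    have a0 := ha 0 rfl
    have a3 := ha 3 rfl
    simp only [Nat.count_succ]
    rcases Classical.propComplete (s.arr 0 (v * n + i) = 1) with c1 | c1 <;>
      rcases Classical.propComplete (s.arr 3 i = 1) with c2 | c2 <;>
      simp [block, Stmt.eval, Op.apply, when, Test.Holds, r1, a0, a3, hx, c1, c2, e1, e2, add_assoc]

theorem candidatesStmt_spec (h : Ctx G s) :
    lab n (candidatesStmt.eval s) 4 = candidates G (lab n s 3) := by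
  set l := lab n s 3 with hl
  set s₁ := ((copyStmt 3 4).eval s).setReg rRow 0 with hs₁
  have c1 : Ctx G s₁ := (h.eval (S := copyStmt 3 4) rfl).setReg (by norm_num)
  have l1 : lab n s₁ 4 = l := copyStmt_spec h.reg0 (by norm_num)
  have l13 : lab n s₁ 3 = l := lab_eval (S := copyStmt 3 4) rfl s
  have r1 : s₁.reg rRow = 0 := by simp [hs₁]
  have ev : candidatesStmt.eval s = (Stmt.loop rW (block [.op (.const rNum 0), oneStmt,
      .op (.load rLabW 3 rW), when (.eq rLabW 5)
        (.ite (.eq rNum 1) (.op (.store 4 rW 4)) (.op (.store 4 rW 3)))])).eval s₁ := rfl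
  rw [ev]
  clear_value s₁
  have key := eval_loop_induction (s := s₁) (x := rW)
    (P := block [.op (.const rNum 0), oneStmt,
      .op (.load rLabW 3 rW), when (.eq rLabW 5)
        (.ite (.eq rNum 1) (.op (.store 4 rW 4)) (.op (.store 4 rW 3)))])
    (fun i s' => s'.reg rRow = i * n ∧
      lab n s' 4 = fun v => if v.1 < i then candidates G l v else l v) rfl
    ⟨by simp [r1], by simpa [lab_setReg] using l1⟩ ?_
  · rw [c1.reg0] at key
    rw [key.2]
    funext v
    simp
  · rintro i hi s' hr ha hx ⟨e1, e2⟩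
    rw [c1.reg0] at hi
    have hc : Ctx G s' :=
      c1.of_eq (fun r hr' => hr r (by interval_cases r <;> rfl)) (ha 0 rfl)
    have l3 : lab n s' 3 = l := by
      rw [← l13]
      unfold lab
      rw [ha 3 rfl]
    set v : Fin n := ⟨i, hi⟩ with hv
    obtain ⟨f1, f2⟩ := oneStmt_spec (s := s'.setReg rNum 0) (v := v) (hc.setReg (by norm_num))
      (by simpa using e1) (by simp)
    rw [lab_setReg, l3] at f2
    set s₂ := oneStmt.eval (s'.setReg rNum 0) with hs₂
    have c2 : Ctx G s₂ := (hc.setReg (x := rNum) (v := 0) (by norm_num)).eval rfl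
    have w2 : s₂.reg rW = v := (eval_reg rfl _).trans (by simpa using hx)
    have l23 : s₂.arr 3 v = l v := by
      rw [hs₂, eval_arr rfl]
      exact congrFun l3 v
    have l24 : lab n s₂ 4 = lab n s' 4 := lab_eval (S := oneStmt) rfl _
    have ev2 : (block [.op (.const rNum 0), oneStmt, .op (.load rLabW 3 rW), when (.eq rLabW 5)
        (.ite (.eq rNum 1) (.op (.store 4 rW 4)) (.op (.store 4 rW 3)))]).eval s' =
        (Stmt.seq (.op (.load rLabW 3 rW)) (when (.eq rLabW 5)
        (.ite (.eq rNum 1) (.op (.store 4 rW 4)) (.op (.store 4 rW 3))))).eval s₂ := rfl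
    rw [ev2]
    clear_value s₂
    have hrow : ((Stmt.seq (.op (.load rLabW 3 rW)) (when (.eq rLabW 5)
        (.ite (.eq rNum 1) (.op (.store 4 rW 4)) (.op (.store 4 rW 3))))).eval s₂).reg rRow =
        (i + 1) * n := (eval_reg rfl s₂).trans f1
    have hlab : lab n ((Stmt.seq (.op (.load rLabW 3 rW)) (when (.eq rLabW 5)
        (.ite (.eq rNum 1) (.op (.store 4 rW 4)) (.op (.store 4 rW 3))))).eval s₂) 4 =
        Function.update (lab n s₂ 4) v (candidates G l v) := by
      have h2v : lab n s₂ 4 v = l v := by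
        rw [l24, e2]
        simp [hv]
      unfold candidates
      by_cases h5 : l v = 5
      · by_cases hN : (oneNbrs G l v).card = 1
        · simp [Stmt.eval, Op.apply, when, Test.Holds, w2, l23, f2, h5, hN, c2.reg5, c2.reg1,
            c2.reg4, lab_store _ rfl, lab_setReg]
        · simp [Stmt.eval, Op.apply, when, Test.Holds, w2, l23, f2, h5, hN, c2.reg5, c2.reg1,
            c2.reg3, lab_store _ rfl, lab_setReg]
      · simp [Stmt.eval, Op.apply, when, Test.Holds, w2, l23, h5, c2.reg5, lab_setReg]
        exact h2v
    refine ⟨by rw [Store.setReg_reg, if_neg (by norm_num), hrow], ?_⟩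
    rw [lab_setReg, hlab, l24, e2]
    funext w
    rw [Function.update_apply]
    by_cases hw : w = v
    · subst hw
      simp [hv]
    · have : w.1 ≠ i := fun e => hw (Fin.ext e)
      simp only [hw, if_false]
      by_cases h1 : w.1 < i
      · rw [if_pos h1, if_pos (by omega)]
      · rw [if_neg h1, if_neg (by omega)]

theorem greedyStmt_spec (h : Ctx G s) :
    lab n (greedyStmt.eval s) 4 = greedyTo G (lab n s 4) n := by
  have key := eval_loop_induction (s := s) (x := rW)
    (P := block [.op (.load rLabW 4 rW), when (.eq rLabW 4) (block [.op (.store 4 rW 2), scan,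
      when (.neq rConf 8) (.op (.store 4 rW 3))])])
    (fun i s' => Ctx G s' ∧ lab n s' 4 = greedyTo G (lab n s 4) i) rfl
    ⟨h.setReg (by norm_num), rfl⟩ ?_
  · rw [h.reg0] at key
    exact key.2
  · rintro i hi s' - - hx ⟨hc, hl⟩
    rw [h.reg0] at hi
    refine ⟨(hc.eval (by rfl)).setReg (by norm_num), ?_⟩
    rw [lab_setReg, greedyTo, dif_pos hi, ← hl]
    set v : Fin n := ⟨i, hi⟩
    have hv : s'.reg rW = v := hx
    set T := lab n s' 4 with hT
    unfold greedy
    set s₁ := s'.setReg rLabW (T v) with hs₁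
    have c1 : Ctx G s₁ := hc.setReg (by norm_num)
    have v1 : s₁.reg rW = v := by simp [hs₁, hv]
    have ev : (block [.op (.load rLabW 4 rW), when (.eq rLabW 4) (block [.op (.store 4 rW 2), scan,
        when (.neq rConf 8) (.op (.store 4 rW 3))])]).eval s' =
        if T v = 4 then (when (.neq rConf 8) (.op (.store 4 rW 3))).eval
          (scan.eval (s₁.setArr 4 v 2)) else s₁ := by
      have e1 : (Op.load rLabW 4 rW).apply s' = s₁ := by simp [Op.apply, hv, hs₁, hT, lab]
      have e2 : s₁.reg rLabW = T v := by simp [hs₁]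
      simp only [block, when, Stmt.eval, Test.Holds, e1, e2, c1.reg4]
      simp only [Op.apply, v1, c1.reg2]
    rw [ev]
    by_cases h4 : T v = 4
    · rw [if_pos h4, if_pos h4]
      set s₂ := s₁.setArr 4 v 2 with hs₂
      have c2 : Ctx G s₂ := c1.setArr (by norm_num)
      have l2 : lab n s₂ 4 = Function.update T v 2 := by
        rw [hs₂, lab_store _ rfl, hs₁, lab_setReg]
      obtain ⟨p, -, -⟩ := scan_spec c2
      have c3 : Ctx G (scan.eval s₂) := c2.eval rfl
      have l3 : lab n (scan.eval s₂) 4 = Function.update T v 2 := (lab_eval rfl s₂).trans l2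
      have v3 : (scan.eval s₂).reg rW = v := (eval_reg rfl s₂).trans v1
      rw [l2] at p
      simp only [when, Stmt.eval, Test.Holds, Op.apply, c3.reg8, c3.reg3, v3]
      by_cases hcf : Conf G (Function.update T v 2)
      · rw [if_pos (p.2 hcf), if_pos hcf, lab_store _ rfl, l3, Function.update_idem]
      · rw [if_neg (fun e => hcf (p.1 e)), if_neg hcf, l3]
    · rw [if_neg h4, if_neg h4]
      rfl

/-! #### The leaves of the search trees -/

/-- Complete the first set that is given by array `3`. -/
def completeStmt : Stmt := block [candidatesStmt, greedyStmt, recordStmt]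

/-- The greedy procedure leaves the first set unchanged and succeeds if any solution `S` has that
first set; the result then has the size of `S`. -/
theorem completeStmt_spec (h : Ctx G s) (ho : Out G s)
    (hl : ∀ v, lab n s 3 v = 1 ∨ lab n s 3 v = 5) :
    Out G (completeStmt.eval s) ∧ s.reg rBest ≤ (completeStmt.eval s).reg rBest ∧
    ∀ S, IsSol G S → (∀ v, S v = 1 ↔ lab n s 3 v = 1) →
      numLab S 1 ≤ (completeStmt.eval s).reg rBest := by
  set l := lab n s 3 with hl'
  set s₁ := candidatesStmt.eval s with hs₁
  have c1 : Ctx G s₁ := h.eval rfl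
  have o1 : Out G s₁ := ho.of_eq (eval_reg rfl s) (eval_arr rfl s)
  have b1 : s₁.reg rBest = s.reg rBest := eval_reg rfl s
  have l1 := candidatesStmt_spec h
  rw [← hs₁, ← hl'] at l1
  set s₂ := greedyStmt.eval s₁ with hs₂
  have c2 : Ctx G s₂ := c1.eval rfl
  have o2 : Out G s₂ := o1.of_eq (eval_reg rfl s₁) (eval_arr rfl s₁)
  have b2 : s₂.reg rBest = s.reg rBest := (eval_reg rfl s₁).trans b1
  have l2 := greedyStmt_spec c1
  rw [← hs₂, l1] at l2
  have hp := isPartial_candidates (G := G) hl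
  have ev : completeStmt.eval s = recordStmt.eval s₂ := rfl
  obtain ⟨e1, e2, e3⟩ := recordStmt_spec c2 o2 (fun v => by
    have h1 := (hp.greedyTo n).label v
    have h2 := greedyTo_ne_four (G := G) (T := candidates G l) le_rfl v.2
    rw [l2]
    omega)
  rw [ev]
  refine ⟨e1, b2 ▸ e2, fun S hS hSl => ?_⟩
  have hc := hp.not_conf_greedyTo (not_conf_candidates hl hS hSl) n
  rw [l2] at e3
  refine le_trans (le_of_eq ?_) (e3 hc)
  unfold numLab
  congr 1
  ext v
  simp only [mem_filter, mem_univ, true_and]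
  rw [hSl, greedyTo_eq_one_iff, candidates_eq_one_iff]

/-- Replace the labeling in array `3` by cheap branches, or record it. -/
def refineStmt : Stmt := block [
  findStmt 4, .ite (.neq rFound 8) expandStmt (block [copyStmt 3 4, recordStmt])]

theorem refineStmt_spec {L₀ : List (Fin n → ℕ)} (hl : Entry G l) (h : Ctx G s) (ho : Out G s)
    (h3 : lab n s 3 = l) (hst : Stack n s L₀) :
    Out G (refineStmt.eval s) ∧ s.reg rBest ≤ (refineStmt.eval s).reg rBest ∧
    (((∃ v, l v = 4) ∧ ∃ L, Expands G l L ∧ Stack n (refineStmt.eval s) (L₀ ++ L)) ∨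
      (IsSol G l ∧ numLab l 1 ≤ (refineStmt.eval s).reg rBest ∧
        Stack n (refineStmt.eval s) L₀)) := by
  have f := findStmt_spec (n := n) (k := 4) (by norm_num) h.reg0
  set s₁ := (findStmt 4).eval s with hs₁
  have c1 : Ctx G s₁ := h.eval rfl
  have b1 : s₁.reg rBest = s.reg rBest := eval_reg rfl s
  have o1 : Out G s₁ := ho.of_eq b1 (eval_arr rfl s)
  have l1 : lab n s₁ 3 = l := (lab_eval rfl s).trans h3
  have st1 : Stack n s₁ L₀ := hst.eval rfl
  rw [h3, h.reg4] at f
  have ev : refineStmt.eval s = if s₁.reg rFound ≠ 0 then expandStmt.eval s₁ else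
      recordStmt.eval ((copyStmt 3 4).eval s₁) := by
    simp only [refineStmt, block, Stmt.eval, ← hs₁, Test.Holds, c1.reg8]
  rw [ev]
  clear_value s₁
  rcases f with ⟨f1, f2⟩ | ⟨f1, v, -, f2⟩
  · rw [if_neg (not_not.2 f1)]
    have l2 : lab n ((copyStmt 3 4).eval s₁) 4 = l := (copyStmt_spec c1.reg0 (by norm_num)).trans l1
    have c2 : Ctx G ((copyStmt 3 4).eval s₁) := c1.eval rfl
    have b2 : ((copyStmt 3 4).eval s₁).reg rBest = s.reg rBest := (eval_reg rfl s₁).trans b1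
    have o2 : Out G ((copyStmt 3 4).eval s₁) := o1.of_eq (eval_reg rfl s₁) (eval_arr rfl s₁)
    have st2 : Stack n ((copyStmt 3 4).eval s₁) L₀ := st1.eval rfl
    generalize (copyStmt 3 4).eval s₁ = s₂ at *
    have lab3 : ∀ v, l v = 1 ∨ l v = 2 ∨ l v = 3 := fun v => by
      have := hl.1 v
      have := f2 v
      omega
    obtain ⟨e1, e2, e3⟩ := recordStmt_spec c2 o2 (by rw [l2]; exact lab3)
    rw [l2] at e3
    exact ⟨e1, b2 ▸ e2, Or.inr ⟨⟨lab3, hl.2.1⟩, e3 hl.2.1, st2.eval rfl⟩⟩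
  · rw [if_pos f1]
    refine ⟨o1.of_eq (eval_reg rfl s₁) (eval_arr rfl s₁),
      b1.symm.trans_le (eval_reg (S := expandStmt) rfl s₁).ge, Or.inl ⟨⟨v, f2⟩, ?_⟩⟩
    exact expandStmt_spec hl ⟨v, f2⟩ c1 l1 st1

end PMS

/-! ### The analysis of the search trees -/

namespace PMS

open Finset RAM RAM.Stmt

variable {n : ℕ} {G : SimpleGraph (Fin n)} {s : Store} {T S : Fin n → ℕ} {p q g : ℕ}

/-- The pair described by `S` is still possible for the partial labeling `T`. -/
def Compat (T S : Fin n → ℕ) : Prop :=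
  ∀ v, T v = 0 ∨ S v = T v ∨ (T v = 4 ∧ (S v = 1 ∨ S v = 2)) ∨ (T v = 5 ∧ (S v = 2 ∨ S v = 3))

/-- The labeling arises from branching only. -/
def Branched (p q : ℕ) (T : Fin n → ℕ) : Prop := ∀ v, T v = 0 ∨ T v = p ∨ T v = q

/-- The labels `p` and `q` of the two search trees. -/
def Labels (p q : ℕ) : Prop := (p = 1 ∧ q = 5) ∨ (p = 3 ∧ q = 4)

theorem numLab_update_of_ne {z : Fin n} {c a : ℕ} (hz : T z ≠ a) (hc : c ≠ a) :
    numLab (Function.update T z c) a = numLab T a := by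
  unfold numLab
  congr 1
  ext v
  by_cases h : v = z
  · subst h; simp [hz, hc]
  · simp [h]

theorem numLab_update_self {z : Fin n} {c : ℕ} (hz : T z ≠ c) :
    numLab (Function.update T z c) c = numLab T c + 1 := by
  unfold numLab
  rw [← Finset.card_insert_of_notMem (a := z) (by simp [hz])]
  congr 1
  ext v
  by_cases h : v = z
  · subst h; simp
  · simp [h]

theorem numLab_update_add {z : Fin n} {c : ℕ} (hz : T z ≠ c) :
    numLab (Function.update T z c) (T z) + 1 = numLab T (T z) := by
  have := numLab_update_self (T := Function.update T z c) (z := z) (c := T z) (by simpa using hz.symm)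
  rw [← this]
  simp

/-- The labels `1` and `3` are final, unlike `4` and `5`. Hence a labeling beyond the limit for `p`
cannot lead to a solution within it and may be dropped. -/
theorem Compat.numLab_le (hpq : Labels p q) (h : Compat T S) : numLab T p ≤ numLab S p := by
  refine Finset.card_le_card fun v hv => ?_
  simp only [mem_filter, mem_univ, true_and] at hv ⊢
  rcases hpq with ⟨rfl, rfl⟩ | ⟨rfl, rfl⟩ <;> rcases h v with e | e | e | e <;> omega

theorem Compat.update (h : Compat T S) {z : Fin n} {c : ℕ}
    (hc : S z = c ∨ (c = 4 ∧ (S z = 1 ∨ S z = 2)) ∨ (c = 5 ∧ (S z = 2 ∨ S z = 3))) :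
    Compat (Function.update T z c) S := by
  intro v
  by_cases hv : v = z
  · subst hv; simpa using Or.inr hc
  · simpa [hv] using h v

theorem Compat.ext (h : Compat T S) (hT : ∀ v, T v ≠ 0 ∧ T v ≠ 5) : Ext T S := by
  intro v
  rcases h v with e | e | e | e
  · exact absurd e (hT v).1
  · exact Or.inl e
  · exact Or.inr e
  · exact absurd e.1 (hT v).2

theorem Ext.compat (h : Ext T S) : Compat T S := fun v => by
  rcases h v with e | e
  · exact Or.inr (Or.inl e)
  · exact Or.inr (Or.inr (Or.inl e))

/-! #### The potential -/

/-- The parameters of the potential. -/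
structure IsWeight (g : ℕ) (κ c y : ℝ) : Prop where
  pos : 0 < κ
  pow_eq : κ ^ 27 * y ^ g = 1
  one_le : 1 ≤ c
  y_pos : 0 < y
  y_le : y ≤ 1
  root : κ * (c + y) ≤ 1.966

/-- The potential without its polynomial factor. -/
noncomputable def basePot (κ c y : ℝ) (p q : ℕ) (T : Fin n → ℕ) : ℝ :=
  κ ^ n * y ^ numLab T p * c ^ numLab T q * (c + y) ^ numLab T 0

/-- The potential of a labeling, which bounds the size of the search tree below it. -/
noncomputable def pot (κ c y : ℝ) (p q : ℕ) (T : Fin n → ℕ) : ℝ :=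
  basePot κ c y p q T * (2 * numLab T 0 + numLab T q + 1)

variable {κ c y : ℝ}

/-- Since `κ ^ 27 * y ^ g = 1` and `y ≤ 1`, the limit on the label `p` gives `κ ^ n * y ^ numLab T p
≥ 1`, as comparison of the 27th powers shows. The remaining factors are at least `1` anyway. -/
theorem IsWeight.one_le_basePot (h : IsWeight g κ c y) (hT : 27 * numLab T p ≤ g * n) :
    1 ≤ basePot κ c y p q T := by
  have h1 : 1 ≤ κ ^ n * y ^ numLab T p := by
    have h0 : 0 ≤ κ ^ n * y ^ numLab T p := mul_nonneg (pow_nonneg h.pos.le _) (pow_nonneg h.y_pos.le _)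
    by_contra hlt
    have h2 := pow_lt_one₀ h0 (not_le.1 hlt) (n := 27) (by norm_num)
    have h3 : (κ ^ n * y ^ numLab T p) ^ 27 ≥ (κ ^ 27 * y ^ g) ^ n := by
      have e1 : (κ ^ n * y ^ numLab T p) ^ 27 = κ ^ (n * 27) * y ^ (numLab T p * 27) := by
        rw [mul_pow, pow_mul, pow_mul]
      have e2 : (κ ^ 27 * y ^ g) ^ n = κ ^ (n * 27) * y ^ (g * n) := by
        rw [mul_pow, ← pow_mul, ← pow_mul, mul_comm 27]
      rw [e1, e2]
      refine mul_le_mul_of_nonneg_left ?_ (pow_nonneg h.pos.le _)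
      exact pow_le_pow_of_le_one h.y_pos.le h.y_le (by linarith)
    rw [h.pow_eq, one_pow] at h3
    linarith
  have h2 : 1 ≤ c ^ numLab T q := one_le_pow₀ h.one_le
  have h3 : 1 ≤ (c + y) ^ numLab T 0 := one_le_pow₀ (by linarith [h.one_le, h.y_pos])
  unfold basePot
  calc (1 : ℝ) = 1 * 1 * 1 := by norm_num
    _ ≤ _ := mul_le_mul (mul_le_mul h1 h2 zero_le_one (by linarith)) h3 zero_le_one
      (by nlinarith)

theorem IsWeight.basePot_nonneg (h : IsWeight g κ c y) : 0 ≤ basePot κ c y p q T := by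
  have := h.pos
  have := h.y_pos
  have := h.one_le
  unfold basePot
  positivity

theorem IsWeight.pot_nonneg (h : IsWeight g κ c y) : 0 ≤ pot κ c y p q T :=
  mul_nonneg h.basePot_nonneg (by positivity)

theorem IsWeight.one_le_pot (h : IsWeight g κ c y) (hT : 27 * numLab T p ≤ g * n) :
    1 ≤ pot κ c y p q T := by
  have := h.one_le_basePot (q := q) hT
  unfold pot
  have h2 : (1 : ℝ) ≤ 2 * numLab T 0 + numLab T q + 1 := by
    have : (0 : ℝ) ≤ 2 * numLab T 0 + numLab T q := by positivity
    linarith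
  nlinarith

theorem IsWeight.pot_root (h : IsWeight g κ c y) (hpq : Labels p q) :
    pot κ c y p q (fun _ : Fin n => 0) ≤ (2 * n + 1) * 1.966 ^ n := by
  have h0 : numLab (fun _ : Fin n => 0) 0 = n := by simp [numLab]
  have hp : numLab (fun _ : Fin n => 0) p = 0 := by
    have : (0 : ℕ) ≠ p := by rcases hpq with h | h <;> omega
    simp [numLab, this]
  have hq : numLab (fun _ : Fin n => 0) q = 0 := by
    have : (0 : ℕ) ≠ q := by rcases hpq with h | h <;> omega
    simp [numLab, this]
  unfold pot basePot
  rw [h0, hp, hq]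
  have h1 : (κ * (c + y)) ^ n ≤ 1.966 ^ n := by
    refine pow_le_pow_left₀ ?_ h.root n
    have := h.pos
    have := h.y_pos
    have := h.one_le
    positivity
  rw [mul_pow] at h1
  have : (0 : ℝ) ≤ 2 * n + 1 := by positivity
  push_cast
  nlinarith

/-- The labelings in `N` replace the labeling `T` in the search, and `b` is the size of the best
pair found so far. -/
structure Progress (G : SimpleGraph (Fin n)) (p q g : ℕ) (ok : (Fin n → ℕ) → Prop) (κ c y : ℝ)
    (T : Fin n → ℕ) (N : List (Fin n → ℕ)) (b : ℕ) : Prop where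
  ok : ∀ T' ∈ N, ok T' ∧ 27 * numLab T' p ≤ g * n
  pot : (N.map (pot κ c y p q)).sum + 1 ≤ PMS.pot κ c y p q T
  cover : ∀ S, IsSol G S → 27 * numLab S p ≤ g * n → Compat T S → numLab S 1 ≤ b ∨
    ∃ T' ∈ N, ∃ S', IsSol G S' ∧ 27 * numLab S' p ≤ g * n ∧ numLab S' 1 = numLab S 1 ∧ Compat T' S'

/-- The base potential splits exactly, `A * (c + y) = A * c + A * y`. The linear factor drops by `1`
for the label `q` and by `2` for `p`, which releases at least one base potential, hence at least
`1`. -/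
theorem IsWeight.progress_branch {ok : (Fin n → ℕ) → Prop} {z : Fin n} (h : IsWeight g κ c y)
    (hpq : Labels p q) (hT : Branched p q T) (hlim : 27 * numLab T p ≤ g * n) (hz : T z = 0)
    (hok : ∀ T' : Fin n → ℕ, Branched p q T' → ok T') (b : ℕ) :
    Progress G p q g ok κ c y T (branch p q g T z) b := by
  have hp0 : p ≠ 0 := by rcases hpq with h | h <;> omega
  have hq0 : q ≠ 0 := by rcases hpq with h | h <;> omega
  have hpq' : p ≠ q := by rcases hpq with h | h <;> omega
  have hb : ∀ a, a = p ∨ a = q → Branched p q (Function.update T z a) := by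
    intro a ha v
    by_cases hv : v = z
    · subst hv; simp [ha]
    · simpa [hv] using hT v
  have hqp : numLab (Function.update T z q) p = numLab T p :=
    numLab_update_of_ne (by omega) hpq'.symm
  refine ⟨?_, ?_, ?_⟩
  · intro T' hT'
    simp only [branch, List.mem_cons] at hT'
    rcases hT' with rfl | hT'
    · exact ⟨hok _ (hb q (.inr rfl)), by rwa [hqp]⟩
    · split_ifs at hT' with hl
      · rw [List.mem_singleton] at hT'
        subst hT'
        exact ⟨hok _ (hb p (.inl rfl)), hl⟩
      · simp at hT'
  · have hqq : numLab (Function.update T z q) q = numLab T q + 1 := numLab_update_self (by omega)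
    have hpp : numLab (Function.update T z p) p = numLab T p + 1 := numLab_update_self (by omega)
    have hpq2 : numLab (Function.update T z p) q = numLab T q :=
      numLab_update_of_ne (by omega) hpq'
    obtain ⟨m, hm⟩ : ∃ m, numLab T 0 = m + 1 :=
      ⟨_, by rw [← hz]; exact (numLab_update_add (T := T) (z := z) (c := p) (by omega)).symm⟩
    have hp0' : numLab (Function.update T z p) 0 = m := by
      have := numLab_update_add (T := T) (z := z) (c := p) (by omega)
      rw [hz] at this
      omega
    have hq0' : numLab (Function.update T z q) 0 = m := by
      have := numLab_update_add (T := T) (z := z) (c := q) (by omega)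
      rw [hz] at this
      omega
    have hB := h.one_le_basePot (q := q) hlim
    have h1 : ((branch p q g T z).map (PMS.pot κ c y p q)).sum ≤
        PMS.pot κ c y p q (Function.update T z q) + PMS.pot κ c y p q (Function.update T z p) := by
      unfold branch
      split_ifs
      · simp
      · simpa using h.pot_nonneg
    refine (add_le_add_left h1 1).trans ?_
    unfold PMS.pot basePot at *
    rw [hqq, hqp, hq0', hpp, hpq2, hp0', hm]
    rw [hm] at hB
    set A := κ ^ n * y ^ numLab T p * c ^ numLab T q * (c + y) ^ m with hA
    have hA0 : 0 ≤ A := by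
      have := h.pos
      have := h.y_pos
      have := h.one_le
      positivity
    have e1 : κ ^ n * y ^ numLab T p * c ^ (numLab T q + 1) * (c + y) ^ m = A * c := by
      rw [hA]; ring
    have e2 : κ ^ n * y ^ (numLab T p + 1) * c ^ numLab T q * (c + y) ^ m = A * y := by
      rw [hA]; ring
    have e3 : κ ^ n * y ^ numLab T p * c ^ numLab T q * (c + y) ^ (m + 1) = A * (c + y) := by
      rw [hA]; ring
    rw [e1, e2, e3]
    rw [e3] at hB
    have hAy : 0 ≤ A * y := mul_nonneg hA0 h.y_pos.le
    push_cast
    nlinarith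
  · intro S hS hlS hTS
    right
    by_cases hSz : S z = p
    · have hc := hTS.update (z := z) (c := p) (.inl hSz)
      have hl : 27 * numLab (Function.update T z p) p ≤ g * n :=
        (Nat.mul_le_mul_left _ (hc.numLab_le hpq)).trans hlS
      exact ⟨_, by simp [branch, hl], S, hS, hlS, rfl, hc⟩
    · refine ⟨Function.update T z q, by simp [branch], S, hS, hlS, rfl, hTS.update ?_⟩
      have := hS.1 z
      rcases hpq with ⟨rfl, rfl⟩ | ⟨rfl, rfl⟩ <;> omega

theorem Ext.numLab_three (h : Ext T S) : numLab S 3 = numLab T 3 := by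
  unfold numLab
  congr 1
  ext v
  simp only [mem_filter, mem_univ, true_and]
  rcases h v with e | e
  · rw [e]
  · omega

/-- Deciding `i` vertices divides the base potential by `c ^ i`, so a child keeps at most the share
`wt i / 34`, and the shares sum to at most `1`. Every child decides a vertex, so its linear factor
drops by at least `1`, which again releases a base potential. -/
theorem IsWeight.progress_expand (h : IsWeight g κ c y) (hwt : ∀ i, 0 < i → 34 ≤ wt i * c ^ i)
    {l : Fin n → ℕ} (hl : Entry G l) {L : List (Fin n → ℕ)} (hL : Expands G l L)
    {ok : (Fin n → ℕ) → Prop} (hok : ∀ T', Entry G T' → ok T')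
    (hlim : 27 * numLab l 3 ≤ g * n) (b : ℕ) :
    Progress G 3 4 g ok κ c y l L b := by
  obtain ⟨h1, h2, h3⟩ := hL
  have zero : ∀ T', Ext l T' → numLab T' 0 = 0 := by
    intro T' hT'
    refine Finset.card_eq_zero.2 (Finset.filter_eq_empty_iff.2 fun v _ => ?_)
    have := hl.labels_of_ext hT' v
    omega
  refine ⟨fun T' hT' => ?_, ?_, fun S hS hlS hTS => ?_⟩
  · obtain ⟨e1, e2, e3, -⟩ := h1 T' hT'
    exact ⟨hok _ ⟨hl.labels_of_ext e1, e3, .inl e2⟩, by rwa [e1.numLab_three]⟩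
  · set B := basePot κ c y 3 4 l with hB
    have hB1 : 1 ≤ B := h.one_le_basePot hlim
    have hpot : ∀ T' ∈ L, pot κ c y 3 4 T' ≤ B * numLab l 4 / 34 * (wt (newDec l T').card : ℝ) := by
      intro T' hT'
      obtain ⟨e1, -, -, e4⟩ := h1 T' hT'
      have hc := e1.card_newDec
      set i := (newDec l T').card
      have hw := hwt i e4
      unfold pot
      rw [zero T' e1]
      have hBT : basePot κ c y 3 4 T' * c ^ i = B := by
        rw [hB, basePot, basePot, e1.numLab_three, zero T' e1, zero l (.refl l), ← hc]
        ring
      have hn : (numLab T' 4 : ℝ) + 1 ≤ numLab l 4 := by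
        have : numLab T' 4 + 1 ≤ numLab l 4 := by omega
        exact_mod_cast this
      have hT0 : 0 ≤ basePot κ c y 3 4 T' := h.basePot_nonneg
      have step : basePot κ c y 3 4 T' * 34 ≤ B * wt i := by
        rw [← hBT]
        nlinarith
      have : 0 ≤ (numLab l 4 : ℝ) := by positivity
      push_cast
      calc basePot κ c y 3 4 T' * (2 * 0 + (numLab T' 4 : ℝ) + 1)
          ≤ basePot κ c y 3 4 T' * numLab l 4 := by
            refine mul_le_mul_of_nonneg_left (by linarith) hT0
        _ ≤ B * numLab l 4 / 34 * wt i := by nlinarith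
    have hsum : (L.map (pot κ c y 3 4)).sum ≤
        B * numLab l 4 / 34 * ((L.map fun T' => wt (newDec l T').card).sum : ℕ) := by
      have e : (((L.map fun T' => wt (newDec l T').card).sum : ℕ) : ℝ) =
          (L.map fun T' => (wt (newDec l T').card : ℝ)).sum := by
        rw [Nat.cast_list_sum, List.map_map]
        rfl
      rw [e, ← List.sum_map_mul_left]
      exact List.sum_le_sum hpot
    have h34 : (((L.map fun T' => wt (newDec l T').card).sum : ℕ) : ℝ) ≤ 34 := by exact_mod_cast h3
    have hB4 : 0 ≤ B * numLab l 4 / 34 := by positivity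
    have := mul_le_mul_of_nonneg_left h34 hB4
    have hpl : pot κ c y 3 4 l = B * (numLab l 4 + 1) := by
      rw [pot, ← hB, zero l (.refl l)]
      push_cast
      ring
    rw [hpl]
    linarith
  · right
    obtain ⟨T', hT', S', hS', e1, e2⟩ := h2 S hS (hTS.ext fun v => by have := hl.1 v; omega)
    have hlS' : Ext l S := hTS.ext fun v => by have := hl.1 v; omega
    -- Both solutions extend `l` and have the same outside vertices, so the exchanged pair has the
    -- same size and respects the limit.
    have e3 : numLab S' 3 = numLab S 3 := by rw [e2.numLab_three, hlS'.numLab_three]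
    have a1 := hS.numLab_add
    have a2 := hS'.numLab_add
    exact ⟨T', hT', S', hS', by rwa [e3], by omega, e1.compat⟩

end PMS

/-! ### The two searches -/

namespace PMS

open Finset RAM RAM.Stmt

local notation "rCnt" => (9 : ℕ)
local notation "rBest" => (11 : ℕ)
local notation "rFound" => (51 : ℕ)
local notation "rI" => (53 : ℕ)

variable {n : ℕ} {G : SimpleGraph (Fin n)} {s : Store} {T : Fin n → ℕ} {p q g : ℕ} {κ c y : ℝ}
  {ok : (Fin n → ℕ) → Prop}

/-- Treat the top of the stack; `leaf` is responsible for labelings without undecided vertices. -/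
def bodyStmt (p q g : ℕ) (leaf : Stmt) : Stmt := block [
  popStmt, findStmt 8, .ite (.neq rFound 8) (branchStmt p q g) leaf]

/-- After the execution of `P`, the stack contains labelings that replace `T`. -/
def Replaces (G : SimpleGraph (Fin n)) (p q g : ℕ) (ok : (Fin n → ℕ) → Prop) (κ c y : ℝ)
    (P : Stmt) (s : Store) (L : List (Fin n → ℕ)) (T : Fin n → ℕ) : Prop :=
  ∃ N, Ctx G (P.eval s) ∧ Out G (P.eval s) ∧ s.reg rBest ≤ (P.eval s).reg rBest ∧
    Stack n (P.eval s) (L ++ N) ∧ Progress G p q g ok κ c y T N ((P.eval s).reg rBest)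

theorem Labels.lt (hpq : Labels p q) : p < 9 ∧ q < 9 := by rcases hpq with h | h <;> omega

theorem Ctx.reg_labels (h : Ctx G s) (hpq : Labels p q) : s.reg p = p ∧ s.reg q = q := by
  rcases hpq with ⟨rfl, rfl⟩ | ⟨rfl, rfl⟩
  · exact ⟨h.reg1, h.reg5⟩
  · exact ⟨h.reg3, h.reg4⟩

theorem bodyStmt_spec {leaf : Stmt} (hw : IsWeight g κ c y) (hpq : Labels p q)
    (hok : ∀ T' : Fin n → ℕ, Branched p q T' → ok T')
    (hok' : ∀ T' : Fin n → ℕ, ok T' → (∃ v, T' v = 0) → Branched p q T')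
    (hleaf : ∀ (s : Store) (L : List (Fin n → ℕ)), Ctx G s → Out G s → Stack n s L → lab n s 3 = T →
      (∀ v, T v ≠ 0) → Replaces G p q g ok κ c y leaf s L T)
    {L : List (Fin n → ℕ)} (h : Ctx G s) (ho : Out G s) (hst : Stack n s (L ++ [T])) (hT : ok T)
    (hlim : 27 * numLab T p ≤ g * n) :
    Replaces G p q g ok κ c y (bodyStmt p q g leaf) s L T := by
  obtain ⟨st1, l1⟩ := popStmt_spec h.reg0 hst
  have c1 : Ctx G (popStmt.eval s) := h.eval rfl
  have o1 : Out G (popStmt.eval s) := ho.of_eq (eval_reg rfl s) (eval_arr rfl s)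
  have b1 : (popStmt.eval s).reg rBest = s.reg rBest := eval_reg rfl s
  have ev : (bodyStmt p q g leaf).eval s =
      (Stmt.ite (.neq rFound 8) (branchStmt p q g) leaf).eval
        ((findStmt 8).eval (popStmt.eval s)) := rfl
  unfold Replaces
  rw [ev]
  generalize popStmt.eval s = s₁ at *
  have f := findStmt_spec (n := n) (k := 8) (by norm_num) c1.reg0
  have c2 : Ctx G ((findStmt 8).eval s₁) := c1.eval rfl
  have o2 : Out G ((findStmt 8).eval s₁) := o1.of_eq (eval_reg rfl s₁) (eval_arr rfl s₁)
  have b2 : ((findStmt 8).eval s₁).reg rBest = s.reg rBest := (eval_reg rfl s₁).trans b1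
  have st2 : Stack n ((findStmt 8).eval s₁) L := st1.eval rfl
  have l2 : lab n ((findStmt 8).eval s₁) 3 = T := (lab_eval rfl s₁).trans l1
  rw [l1, c1.reg8] at f
  generalize (findStmt 8).eval s₁ = s₂ at *
  have ev2 : (Stmt.ite (.neq rFound 8) (branchStmt p q g) leaf).eval s₂ =
      if s₂.reg rFound ≠ 0 then (branchStmt p q g).eval s₂ else leaf.eval s₂ := by
    simp only [Stmt.eval, Test.Holds, c2.reg8]
  rw [ev2]
  rcases f with ⟨f1, f2⟩ | ⟨f1, z, f2, f3⟩
  · rw [if_neg (not_not.2 f1), ← b2]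
    exact hleaf s₂ L c2 o2 st2 l2 f2
  · rw [if_pos f1]
    obtain ⟨r1, r2⟩ := c2.reg_labels hpq
    obtain ⟨e1, e2, e3, e4⟩ :=
      branchStmt_spec (g := g) hpq.lt.1 hpq.lt.2 r1 r2 c2 st2 f2
    rw [l2] at e1
    exact ⟨_, e4, o2.of_eq e2 e3, (b2.symm.trans e2.symm).le, e1,
      hw.progress_branch hpq (hok' T hT ⟨z, f3⟩) hlim f3 hok _⟩

/-- One search through the stack. -/
theorem exec_search {P : Stmt} (hwf : P.wf = true) (hP : P.writesReg 0 = false)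
    (hw : IsWeight g κ c y) (hpq : Labels p q) (hok : ok fun _ => 0)
    (hstep : ∀ (s : Store) (L : List (Fin n → ℕ)) (T : Fin n → ℕ), Ctx G s → Out G s →
      Stack n s (L ++ [T]) → ok T → 27 * numLab T p ≤ g * n → Replaces G p q g ok κ c y P s L T)
    (h : Ctx G s) (ho : Out G s) (hst : Stack n s [fun _ => 0]) :
    ∃ (t : ℕ) (s' : Store), Exec (.while (.neq rCnt 8) P.compile) s t s' ∧ Ctx G s' ∧ Out G s' ∧
      Stack n s' [] ∧ s.reg rBest ≤ s'.reg rBest ∧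
      (∀ S, IsSol G S → 27 * numLab S p ≤ g * n → numLab S 1 ≤ s'.reg rBest) ∧
      (t : ℝ) ≤ (2 * n + 1) * 1.966 ^ n * (P.cost n + 1) + 1 := by
  -- A solution within the limit is never lost without compensation: its size is reached by the
  -- recorded pair, or a solution of equal size is compatible with a labeling on the stack.
  set I : List (Fin n → ℕ) → Store → Prop := fun L s' => Ctx G s' ∧ Out G s' ∧ Stack n s' L ∧
    s.reg rBest ≤ s'.reg rBest ∧ (∀ T ∈ L, ok T ∧ 27 * numLab T p ≤ g * n) ∧
    ∀ S, IsSol G S → 27 * numLab S p ≤ g * n → numLab S 1 ≤ s'.reg rBest ∨ ∃ T ∈ L, ∃ S',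
      IsSol G S' ∧ 27 * numLab S' p ≤ g * n ∧ numLab S' 1 = numLab S 1 ∧ Compat T S' with hI
  have hzero : numLab (fun _ : Fin n => 0) p = 0 := by
    have : (0 : ℕ) ≠ p := by rcases hpq with h | h <;> omega
    simp [numLab, this]
  have key := exec_while (K := P.cost n) I
    (fun L => (L.map (pot κ c y p q)).sum)
    (fun L => List.sum_nonneg (by simpa using fun T _ => hw.pot_nonneg)) (b := .neq rCnt 8)
    (P := P.compile) (L := [fun _ => 0]) (s := s) ?_ ?_ ?_
  · obtain ⟨t, s', e1, ⟨e2, e3, e4, e5, -, e6⟩, e7⟩ := key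
    refine ⟨t, s', e1, e2, e3, e4, e5, fun S hS hlS => ?_, e7.trans ?_⟩
    · simpa using e6 S hS hlS
    · have := hw.pot_root (n := n) hpq
      have h0 : (0 : ℝ) ≤ P.cost n + 1 := by positivity
      simpa using mul_le_mul_of_nonneg_right this h0
  · rintro L s' ⟨k1, -, k2, -⟩
    simp only [Test.Holds, k1.reg8, k2.cnt]
    simp
  · rintro L s' ⟨k1, k2, k3, k4, k5, k6⟩ hL
    obtain rfl | ⟨L₀, T, rfl⟩ := L.eq_nil_or_concat
    · exact absurd rfl hL
    rw [List.concat_eq_append] at *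
    obtain ⟨hT, hlim⟩ := k5 T (by simp)
    obtain ⟨N, m1, m2, m3, m4, m5⟩ := hstep s' L₀ T k1 k2 k3 hT hlim
    obtain ⟨t, ht, he⟩ := exec_compile hwf hP s'
    rw [k1.reg0] at ht
    refine ⟨t, ht, _, L₀ ++ N, he, ⟨m1, m2, m4, k4.trans m3, ?_, ?_⟩, ?_⟩
    · intro T' hT'
      rcases List.mem_append.1 hT' with hT' | hT'
      · exact k5 T' (by simp [hT'])
      · exact m5.ok T' hT'
    · intro S hS hlS
      rcases k6 S hS hlS with hb | ⟨T', hT', S', hS', a1, a2, a3⟩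
      · exact Or.inl (hb.trans m3)
      · rcases List.mem_append.1 hT' with hT' | hT'
        · exact Or.inr ⟨T', by simp [hT'], S', hS', a1, a2, a3⟩
        · rw [List.mem_singleton] at hT'
          subst hT'
          rcases m5.cover S' hS' a1 a3 with hb | ⟨T'', hT'', S'', hS'', b1, b2, b3⟩
          · exact Or.inl (a2 ▸ hb)
          · exact Or.inr ⟨T'', by simp [hT''], S'', hS'', b1, b2.trans a2, b3⟩
    · have := m5.pot
      simp only [List.map_append, List.sum_append, List.map_cons, List.map_nil, List.sum_cons,
        List.sum_nil]
      linarith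
  · refine ⟨h, ho, hst, le_rfl, ?_, fun S hS hlS => Or.inr ⟨_, by simp, S, hS, hlS, rfl, fun v => .inl rfl⟩⟩
    simp only [List.mem_singleton, forall_eq]
    exact ⟨hok, by simp [hzero]⟩

/-- Nothing is pushed at a leaf; its own potential, at least `1`, pays for the round. -/
theorem completeStmt_replaces (hw : IsWeight 11 κ c y) (L : List (Fin n → ℕ)) (h : Ctx G s)
    (ho : Out G s) (hst : Stack n s L) (h3 : lab n s 3 = T) (hT : Branched 1 5 T)
    (hT' : ∀ v, T v ≠ 0) (hlim : 27 * numLab T 1 ≤ 11 * n) :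
    Replaces G 1 5 11 (Branched 1 5) κ c y completeStmt s L T := by
  have hl : ∀ v, T v = 1 ∨ T v = 5 := fun v => (hT v).resolve_left (hT' v)
  obtain ⟨e1, e2, e3⟩ := completeStmt_spec h ho (by rw [h3]; exact hl)
  rw [h3] at e3
  refine ⟨[], h.eval rfl, e1, e2, by simpa using hst.eval (S := completeStmt) rfl, by simp,
    by simpa using hw.one_le_pot hlim, fun S hS _ hTS => Or.inl (e3 S hS fun v => ?_)⟩
  have := hl v
  have := hTS v
  omega

theorem refineStmt_replaces (hw : IsWeight 5 κ c y) (hwt : ∀ i, 0 < i → 34 ≤ wt i * c ^ i)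
    (L : List (Fin n → ℕ)) (h : Ctx G s)
    (ho : Out G s) (hst : Stack n s L) (h3 : lab n s 3 = T) (hT : Branched 3 4 T ∨ Entry G T)
    (hT' : ∀ v, T v ≠ 0) (hlim : 27 * numLab T 3 ≤ 5 * n) :
    Replaces G 3 4 5 (fun T => Branched 3 4 T ∨ Entry G T) κ c y refineStmt s L T := by
  have hE : Entry G T := by
    rcases hT with hT | hT
    -- A labeling fresh from the outer tree has not been propagated, but it contains only the labels
    -- `3` and `4`, so there is no decided vertex.
    · have hd : ∀ v, ¬ Dec T v := by
        intro v hv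
        have := hT v
        have := hT' v
        rcases hv with e | e <;> omega
      refine ⟨fun v => ?_, fun ⟨x, hx, _⟩ => hd x hx, .inr hd⟩
      have := hT v
      have := hT' v
      omega
    · exact hT
  obtain ⟨e1, e2, ⟨-, N, e3, e4⟩ | ⟨e3, e4, e5⟩⟩ := refineStmt_spec hE h ho h3 hst
  · exact ⟨N, h.eval rfl, e1, e2, e4, hw.progress_expand hwt hE e3 (fun _ => Or.inr) hlim _⟩
  · refine ⟨[], h.eval rfl, e1, e2, by simpa using e5, by simp, by simpa using hw.one_le_pot hlim,
      fun S hS _ hTS => Or.inl ?_⟩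
    have : S = T := by
      funext v
      have := e3.1 v
      have := hTS v
      omega
    rwa [this]

/-! ### The numerical parameters. -/

theorem exists_isWeight {g : ℕ} {c y : ℝ} (hc : 1 ≤ c) (hy : 0 < y) (hy' : y ≤ 1)
    (h : (c + y) ^ 27 ≤ 1.966 ^ 27 * y ^ g) : ∃ κ, IsWeight g κ c y := by
  have hyg : 0 < y ^ g := pow_pos hy g
  -- The calibration forces `κ = y ^ (-g / 27)`. Taking 27th powers turns the bound at the root into
  -- an inequality without roots, which `norm_num` can decide for rational parameters.
  refine ⟨((y ^ g)⁻¹) ^ ((27 : ℕ) : ℝ)⁻¹, ?_⟩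
  have h27 : (((y ^ g)⁻¹) ^ ((27 : ℕ) : ℝ)⁻¹) ^ 27 = (y ^ g)⁻¹ :=
    Real.rpow_inv_natCast_pow (by positivity) (by norm_num)
  have hpos : 0 < ((y ^ g)⁻¹) ^ ((27 : ℕ) : ℝ)⁻¹ := Real.rpow_pos_of_pos (by positivity) _
  refine ⟨hpos, ?_, hc, hy, hy', ?_⟩
  · rw [h27, inv_mul_cancel₀ hyg.ne']
  · refine le_of_pow_le_pow_left₀ (n := 27) (by norm_num) (by norm_num) ?_
    rw [mul_pow, h27, inv_mul_le_iff₀ hyg, mul_comm]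
    exact h

/-- The tightest case is `i = 6`; from `7` on the weight is constant while the power grows. -/
theorem le_wt_mul_pow (i : ℕ) (hi : 0 < i) : (34 : ℝ) ≤ wt i * 1.2728 ^ i := by
  by_cases h : i < 7
  · interval_cases i <;> norm_num [wt]
  · have h1 : (1.2728 : ℝ) ^ 7 ≤ 1.2728 ^ i := pow_le_pow_right₀ (by norm_num) (by omega)
    have h2 : wt i = 7 := by
      unfold wt
      split_ifs <;> omega
    rw [h2]
    norm_num at h1 ⊢
    linarith

/-! #### The complete algorithm -/

/-- The search for pairs whose first set has at most `11 n / 27` elements. -/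
def searchFew : Stmt := bodyStmt 1 5 11 completeStmt

/-- The search for pairs with at most `5 n / 27` vertices outside. -/
def searchMany : Stmt := bodyStmt 3 4 5 refineStmt

/-- Enter the constants. -/
def initStmt : Stmt := block [
  .op (.const 1 1), .op (.const 2 2), .op (.const 3 3), .op (.const 4 4), .op (.const 5 5),
  .op (.const 6 6), .op (.const 7 34)]

/-- Push the labeling without decisions. -/
def rootStmt : Stmt := block [.loop rI (.op (.store 4 rI 8)), pushStmt]

theorem rootStmt_spec (h : Ctx G s) (hst : Stack n s []) :
    Stack n (rootStmt.eval s) [fun _ => 0] := by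
  have key := eval_loop_induction (s := s) (x := rI) (P := .op (.store 4 rI 8))
    (fun i s' => Ctx G s' ∧ Stack n s' [] ∧ ∀ v : Fin n, v.1 < i → lab n s' 4 v = 0) rfl
    ⟨h.setReg (by norm_num), hst.of_eq (by simp) (by simp) rfl,
      fun v hv => absurd hv (Nat.not_lt_zero _)⟩ ?_
  · rw [h.reg0] at key
    obtain ⟨k1, k2, k3⟩ := key
    have := pushStmt_spec k1.reg0 k2
    rw [show lab n _ 4 = fun _ => 0 from funext fun v => k3 v v.2] at this
    exact this
  · rintro i hi s' - - hx ⟨k1, k2, k3⟩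
    rw [h.reg0] at hi
    have e : (Stmt.op (.store 4 rI 8)).eval s' = s'.setArr 4 i 0 := by
      simp [Stmt.eval, Op.apply, hx, k1.reg8]
    rw [e]
    refine ⟨(k1.setArr (by norm_num)).setReg (by norm_num),
      k2.of_eq (by simp) (by simp) (by simp [Store.setArr_arr]), fun v hv => ?_⟩
    rw [lab_setReg, lab_store (w := ⟨i, hi⟩) _ rfl, Function.update_apply]
    split_ifs with hvi
    · rfl
    · exact k3 v (lt_of_le_of_ne (by omega) fun e => hvi (Fin.ext e))

theorem initStmt_spec (G : SimpleGraph (Fin n)) :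
    Ctx G (initStmt.eval (input G)) ∧ Out G (initStmt.eval (input G)) ∧
    Stack n (initStmt.eval (input G)) [] := by
  have r : ∀ x, (initStmt.eval (input G)).reg x = if x = 7 then 34 else if x = 0 then n else
      if x < 7 then x else 0 := by
    intro x
    simp only [initStmt, block, Stmt.eval, Op.apply, Store.setReg_reg, input]
    split_ifs <;> omega
  have ha : (initStmt.eval (input G)).arr = (input G).arr := rfl
  refine ⟨⟨by simp [r], by simp [r], by simp [r], by simp [r], by simp [r], by simp [r], by simp [r],
    by simp [r], by simp [r], fun x y => ?_⟩, ⟨?_, ?_⟩, by simp [r], by simp [r], ?_⟩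
  · rw [ha]
    simp only [input, true_and]
    constructor
    · intro h
      have h : ∃ i j : Fin n, G.Adj i j ∧ (x : ℕ) * n + y = i * n + j := by
        by_contra hne
        rw [if_neg fun e => hne e.2] at h
        exact zero_ne_one h
      obtain ⟨i, j, hij, e⟩ := h
      have hn : 0 < n := x.pos
      -- A position in the matrix determines row and column by division with remainder.
      have hx : (x : ℕ) = i := by
        have := congrArg (· / n) e
        simpa [Nat.add_div_of_dvd_right, Nat.mul_add_div, mul_comm _ n, Nat.div_eq_of_lt, hn] using this
      have hy : (y : ℕ) = j := by
        rw [hx] at e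
        omega
      rw [Fin.ext hx, Fin.ext hy]
      exact hij
    · intro h
      exact if_pos ⟨rfl, x, y, h, rfl⟩
  · have : ∀ c, c ≠ 0 → outputSet n (initStmt.eval (input G)) c = ∅ := by
      intro c hc
      unfold outputSet
      rw [ha]
      simp [input, hc.symm]
    rw [this 1 (by norm_num), this 2 (by norm_num)]
    simp [IsPerfectlyMatched]
  · rw [r]
    unfold outputSet
    rw [ha]
    simp [input]
  · intro j hj
    simp at hj

end PMS

namespace PMS

open Finset RAM RAM.Stmt

local notation "rCnt" => (9 : ℕ)

/-- The complete algorithm. -/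
def program : Program :=
  .seq initStmt.compile (.seq rootStmt.compile (.seq (.while (.neq rCnt 8) searchFew.compile)
    (.seq rootStmt.compile (.while (.neq rCnt 8) searchMany.compile))))

theorem exec_searchFew {n : ℕ} {G : SimpleGraph (Fin n)} {s : Store} (h : Ctx G s) (ho : Out G s)
    (hst : Stack n s [fun _ => 0]) :
    ∃ (t : ℕ) (s' : Store), Exec (.while (.neq rCnt 8) searchFew.compile) s t s' ∧ Ctx G s' ∧
      Out G s' ∧ Stack n s' [] ∧ s.reg 11 ≤ s'.reg 11 ∧
      (∀ S, IsSol G S → 27 * numLab S 1 ≤ 11 * n → numLab S 1 ≤ s'.reg 11) ∧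
      (t : ℝ) ≤ (2 * n + 1) * 1.966 ^ n * (searchFew.cost n + 1) + 1 := by
  -- Leaves are completed in polynomial time, so `c = 1`. The choice `y / (1 + y) = 11 / 27` is
  -- optimal and gives the base `27 / (11 ^ (11/27) * 16 ^ (16/27)) < 1.966`.
  obtain ⟨κ, hw⟩ := exists_isWeight (g := 11) (c := 1) (y := 11 / 16) le_rfl (by norm_num)
    (by norm_num) (by norm_num)
  refine exec_search (ok := Branched 1 5) rfl rfl hw (.inl ⟨rfl, rfl⟩) (fun _ => .inl rfl) ?_ h ho hst
  intro s L T h ho hst hT hlim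
  exact bodyStmt_spec hw (.inl ⟨rfl, rfl⟩) (fun _ => id) (fun _ h _ => h)
    (fun s L h ho hst h3 hT' => completeStmt_replaces hw L h ho hst h3 hT hT' hlim) h ho hst hT hlim

theorem exec_searchMany {n : ℕ} {G : SimpleGraph (Fin n)} {s : Store} (h : Ctx G s) (ho : Out G s)
    (hst : Stack n s [fun _ => 0]) :
    ∃ (t : ℕ) (s' : Store), Exec (.while (.neq rCnt 8) searchMany.compile) s t s' ∧ Ctx G s' ∧
      Out G s' ∧ Stack n s' [] ∧ s.reg 11 ≤ s'.reg 11 ∧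
      (∀ S, IsSol G S → 27 * numLab S 3 ≤ 5 * n → numLab S 1 ≤ s'.reg 11) ∧
      (t : ℝ) ≤ (2 * n + 1) * 1.966 ^ n * (searchMany.cost n + 1) + 1 := by
  -- Here `c` is the base of the branching from `le_wt_mul_pow`, and `y` is close to the optimum `5
  -- * c / 22`, at which `y / (c + y) = 5 / 27`.
  obtain ⟨κ, hw⟩ := exists_isWeight (g := 5) (c := 1.2728) (y := 0.289) (by norm_num) (by norm_num)
    (by norm_num) (by norm_num)
  refine exec_search (ok := fun T => Branched 3 4 T ∨ Entry G T) rfl rfl hw (.inr ⟨rfl, rfl⟩)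
    (.inl fun _ => .inl rfl) ?_ h ho hst
  intro s L T h ho hst hT hlim
  refine bodyStmt_spec hw (.inr ⟨rfl, rfl⟩) (fun _ => Or.inl) (fun T' h' hv => ?_)
    (fun s L h ho hst h3 hT' => refineStmt_replaces hw le_wt_mul_pow L h ho hst h3 hT hT' hlim)
    h ho hst hT hlim
  obtain ⟨v, hv⟩ := hv
  rcases h' with h' | h'
  · exact h'
  · have := h'.1 v
    omega

theorem exec_program {n : ℕ} (G : SimpleGraph (Fin n)) :
    ∃ (t : ℕ) (s : Store), Exec program (input G) t s ∧
      IsLargestPerfectlyMatched G (outputSet n s 1) (outputSet n s 2) ∧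
      (t : ℝ) ≤ ((initStmt.cost n + 2 * rootStmt.cost n +
        (2 * n + 1) * (searchFew.cost n + searchMany.cost n + 2) + 2 : ℕ) : ℝ) * 1.966 ^ n := by
  obtain ⟨c1, o1, st1⟩ := initStmt_spec G
  obtain ⟨t1, ht1, e1⟩ := exec_compile (S := initStmt) rfl rfl (input G)
  have hn : (input G).reg 0 = n := rfl
  rw [hn] at ht1
  generalize initStmt.eval (input G) = s1 at *
  obtain ⟨t2, ht2, e2⟩ := exec_compile (S := rootStmt) rfl rfl s1
  rw [c1.reg0] at ht2
  have c2 : Ctx G (rootStmt.eval s1) := c1.eval rfl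
  have o2 : Out G (rootStmt.eval s1) := o1.of_eq (eval_reg rfl s1) (eval_arr rfl s1)
  obtain ⟨t3, s3, e3, c3, o3, st3, -, m3, ht3⟩ := exec_searchFew c2 o2 (rootStmt_spec c1 st1)
  obtain ⟨t4, ht4, e4⟩ := exec_compile (S := rootStmt) rfl rfl s3
  rw [c3.reg0] at ht4
  have c4 : Ctx G (rootStmt.eval s3) := c3.eval rfl
  have o4 : Out G (rootStmt.eval s3) := o3.of_eq (eval_reg rfl s3) (eval_arr rfl s3)
  have b4 : (rootStmt.eval s3).reg 11 = s3.reg 11 := eval_reg rfl s3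
  obtain ⟨t5, s5, e5, -, o5, -, b5, m5, ht5⟩ := exec_searchMany c4 o4 (rootStmt_spec c3 st3)
  refine ⟨_, s5, .seq e1 (.seq e2 (.seq e3 (.seq e4 e5))), ⟨o5.1, fun A B hAB => ?_⟩, ?_⟩
  · have hS := isSol_of_isPerfectlyMatched hAB
    set S : Fin n → ℕ := fun v => if v ∈ A then 1 else if v ∈ B then 2 else 3 with hSdef
    have hA : numLab S 1 = A.card := by
      unfold numLab
      congr 1
      ext v
      simp only [hSdef, mem_filter, mem_univ, true_and]
      split_ifs <;> simp_all
    rw [← o5.2, ← hA]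
    have hadd := hS.numLab_add
    -- The two limits are complementary: `27 * |A| ≥ 11 * n` leaves at most `5 * n / 27` vertices
    -- outside, by `hadd`.
    rcases le_total (27 * numLab S 1) (11 * n) with hle | hle
    · exact (m3 S hS hle).trans (b4 ▸ b5)
    · exact m5 S hS (by omega)
  · have h1 : (1 : ℝ) ≤ 1.966 ^ n := one_le_pow₀ (by norm_num)
    have k1 : (t1 : ℝ) ≤ initStmt.cost n := by exact_mod_cast ht1
    have k2 : (t2 : ℝ) ≤ rootStmt.cost n := by exact_mod_cast ht2
    have k4 : (t4 : ℝ) ≤ rootStmt.cost n := by exact_mod_cast ht4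
    have k0 : (0 : ℝ) ≤ (initStmt.cost n + 2 * rootStmt.cost n + 2) := by positivity
    generalize (1.966 : ℝ) ^ n = X at *
    push_cast
    nlinarith

end PMS

/-- There are a program `P` and a polynomial `p` such that, for every graph `G` on `n` vertices, `P`
halts on `G` after at most `p(n) * 1.966 ^ n` units of time and has found a largest pair of perfectly
matched sets of `G`: the first set consists of the vertices that the output marks `1`, the second
one of those that it marks `2`. -/
theorem mainTheorem4 :
    ∃ (P : RAM.Program) (p : Polynomial ℕ), ∀ (n : ℕ) (G : SimpleGraph (Fin n)),
      ∃ (t : ℕ) (s : RAM.Store),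
        RAM.Exec P (RAM.input G) t s ∧
        IsLargestPerfectlyMatched G (RAM.outputSet n s 1) (RAM.outputSet n s 2) ∧
        (t : ℝ) ≤ ((p.eval n : ℕ) : ℝ) * (1.966 : ℝ) ^ n := by
  obtain ⟨p₁, h₁⟩ := PMS.initStmt.exists_polynomial_cost
  obtain ⟨p₂, h₂⟩ := PMS.rootStmt.exists_polynomial_cost
  obtain ⟨p₃, h₃⟩ := PMS.searchFew.exists_polynomial_cost
  obtain ⟨p₄, h₄⟩ := PMS.searchMany.exists_polynomial_cost
  refine ⟨PMS.program, p₁ + 2 * p₂ + (2 * Polynomial.X + 1) * (p₃ + p₄ + 2) + 2, fun n G => ?_⟩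
  obtain ⟨t, s, h, h', ht⟩ := PMS.exec_program G
  refine ⟨t, s, h, h', ht.trans (le_of_eq ?_)⟩
  simp [h₁, h₂, h₃, h₄]
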